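/- Let $\hbar\in\mathbb C\setminus\{0\}$, $p=2\hbar$, $n,\ell\in\mathbb Z_{\ge 0}$, $V=\mathbb Cv_+\oplus\mathbb Cv_-$. Let $\sigma^\pm, H\in\operatorname{End}V$ be given by $\sigma^+v_-=v_+$, $\sigma^+v_+=0$, $\sigma^-v_+=v_-$, $\sigma^-v_-=0$, $Hv_+=0$, $Hv_-=v_-$, let $P$ be the permutation of $V\otimes V$, and $R(x)=(x+\hbar P)/(x+\hbar)$. For $X\in\operatorname{End}V$, $X_i$ acts on $V^{\otimes n}$ as $X$ in the $i$-th factor; similarly $R_{ij}(x)$ acts in the $i$-th and $j$-th factors. For $z=(z_1,\dots,z_n)\in\mathbb C^n$ set $$K_m(z)=R_{m,m-1}(z_m-z_{m-1}+p)\cdots R_{m,1}(z_m-z_1+p)\,e^{\mu H_m}\,R_{m,n}(z_m-z_n)\cdots R_{m,m+1}(z_m-z_{m+1}),$$ $$L(z)=\sum_{m=1}^n z_mH_m+\frac{\hbar}{e^\mu-1}\Bigl(e^\mu\sum_{m=1}^nH_m+\sum_{1\le k<m\le n}\bigl(e^\mu\sigma^-_k\sigma^+_m+\sigma^+_k\sigma^-_m\bigr)\Bigr).$$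 The qKZ equation is the system $\Psi(z_1,\dots,z_m+p,\dots,z_n)=K_m(z)\Psi(z)$, $m=1,\dots,n$. Call $z$ generic if $z_k-z_m+\hbar\notin p\mathbb Z$ for all $k\ne m$. For $M=\{m_1<\dots<m_\ell\}\subset\{1,\dots,n\}$ let $v_M=v_{\varepsilon_1}\otimes\dots\otimes v_{\varepsilon_n}$ with $\varepsilon_m=-$ if $m\in M$ and $\varepsilon_m=+$ otherwise, and let $w_M(t_1,\dots,t_\ell)=\sum_{\sigma\in S_\ell}\operatorname{sgn}(\sigma)\,g_M(t_{\sigma_1},\dots,t_{\sigma_\ell})$, where $$g_M(t)=\prod_{a=1}^\ell\Bigl(\frac1{t_a-z_{m_a}}\prod_{1\le j<m_a}\frac{t_a-z_j-\hbar}{t_a-z_j}\Bigr)\prod_{1\le a<b\le\ell}(t_a-t_b-\hbar).$$ Let $\phi(t)=e^{\mu t/p}\prod_{m=1}^n\Gamma((t-z_m-\hbar)/p)/\Gamma((t-z_m)/p)$. Let $\mathcal F$ be the space of functions $W(t_1,\dots,t_\ell;z_1,\dots,z_n)$ that are $p$-periodic in each $z_m$ and for which $W\prod_{m=1}^n\prod_{a=1}^\ell(1-e^{2\pi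 i(t_a-z_m)/p})$ is an antisymmetric polynomial in $e^{2\pi it_1/p},\dots,e^{2\pi it_\ell/p}$ of degree less than $n$ in each of these variables. Let $z$ be generic and let $C$ be a simple curve with a smooth parametrization $\rho:\mathbb R\to\mathbb C$ such that $|\rho(u)|\to\infty$ as $|u|\to\infty$, $\rho'(u)\to\alpha_\pm$ as $u\to\pm\infty$ with $\operatorname{Im}(\alpha_\pm/p)>0$, and such that $\bigcup_m(z_m+\hbar+p\mathbb Z_{\le0})$ and $\bigcup_m(z_m+p\mathbb Z_{\ge0})$ lie in two different connected components of $\mathbb C\setminus C$. Let $D_C$ be the set of $\mu$ with $0<\operatorname{Im}\mu<2\pi$, $\operatorname{Re}(\mu\alpha_+/p)<0$ and $\operatorname{Re}((\mu-2\pi i)\alpha_- /p)>0$, and let $S_C$ be the set of $\mu\ne0$ with $0\le\operatorname{Im}\mu<2\pi$ in the closure of $D_C$. (If $\alpha_\pm/p\in i\mathbb R$, then $D_C=\{0<\operatorname{Im}\mu<2\pi\}$ and $S_C=\{0\le\operatorname{Im}\mu<2\pi\}\setminus\{0\}$.) For $W\in\mathcal F$ and $\mu\in D_C$ put $$I(w_M,W)=\frac1{\ell!}\int_{C^\ell}w_M(t)\,W(t;z)\prod_{a=1}^\ell\phi(t_a)\,dt_a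 ,$$ and for $\mu\in S_C\setminus D_C$ let $I(w_M,W)$ be the limit of these integrals from inside $D_C$. The hypergeometric solution of the qKZ equation corresponding to $W$ is $\Psi_W=\sum_{\#M=\ell}I(w_M,W)\,v_M$. **Theorem.** (a) For all such $W$, $z$, $C$: the integrals $I(w_M,W)$ converge absolutely for $\mu\in D_C$, the limits defining them for $\mu\in S_C\setminus D_C$ exist, and $\Psi=\Psi_W(z)$ is differentiable in $\mu$ on $S_C$ (at boundary points: within $S_C$) and satisfies $$p\,\partial_\mu\Psi=L(z)\,\Psi .$$ (b) This equation is compatible with the qKZ equation: for generic $z$, all $\mu$ with $e^\mu\ne1$, and $m=1,\dots,n$, $$L(z_1,\dots,z_m+p,\dots,z_n)\,K_m(z)=p\,\partial_\mu K_m(z)+K_m(z)\,L(z).$$ -/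

import Mathlib

namespace QKZ

open Filter Topology MeasureTheory Complex
open scoped ContDiff

/-! ### The tensor power `V^{⊗n}`, `V = ℂ v₊ ⊕ ℂ v₋`, and operators on it -/

/-- `V^{⊗n}` in coordinates. The basis vector `v_{ε_1} ⊗ ⋯ ⊗ v_{ε_n}` is the indicator of
`ε : Fin n → Fin 2`, where `0` stands for `+` and `1` for `-`. -/
abbrev TensorV (n : ℕ) : Type := (Fin n → Fin 2) → ℂ

/-- The matrix of `σ⁺` in the basis `v₊, v₋`. -/
def sigmaPlus : Matrix (Fin 2) (Fin 2) ℂ := !![0, 1; 0, 0]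

/-- The matrix of `σ⁻`. -/
def sigmaMinus : Matrix (Fin 2) (Fin 2) ℂ := !![0, 0; 1, 0]

/-- The matrix of `H = (1 - σ³) / 2`. -/
def matH : Matrix (Fin 2) (Fin 2) ℂ := !![0, 0; 0, 1]

/-- The permutation operator `P (x ⊗ y) = y ⊗ x` on `V ⊗ V`. -/
def matP : Matrix (Fin 2 × Fin 2) (Fin 2 × Fin 2) ℂ :=
  Matrix.of fun a b => if a = b.swap then 1 else 0

/-- The `R`-matrix `R(x) = (x + ħ P) / (x + ħ)`. -/
noncomputable def matR (ħ x : ℂ) : Matrix (Fin 2 × Fin 2) (Fin 2 × Fin 2) ℂ :=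
  (x + ħ)⁻¹ • (x • (1 : Matrix (Fin 2 × Fin 2) (Fin 2 × Fin 2) ℂ) + ħ • matP)

/-- `X_i`: the operator `X` acting in the `i`-th tensor factor. -/
noncomputable def site {n : ℕ} (X : Matrix (Fin 2) (Fin 2) ℂ) (i : Fin n) :
    Module.End ℂ (TensorV n) :=
  Matrix.toLin' (Matrix.of fun ε δ : Fin n → Fin 2 =>
    if ∀ k, k ≠ i → ε k = δ k then X (ε i) (δ i) else 0)

/-- `R_{ij}` (for `i ≠ j`): the operator `R` on `V ⊗ V` acting in the `i`-th and `j`-th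
factors, its first leg in the `i`-th and its second leg in the `j`-th one. -/
noncomputable def site₂ {n : ℕ} (R : Matrix (Fin 2 × Fin 2) (Fin 2 × Fin 2) ℂ) (i j : Fin n) :
    Module.End ℂ (TensorV n) :=
  Matrix.toLin' (Matrix.of fun ε δ : Fin n → Fin 2 =>
    if ∀ k, k ≠ i → k ≠ j → ε k = δ k then R (ε i, ε j) (δ i, δ j) else 0)

/-- The shifted point `(z_1, …, z_m + p, …, z_n)`. -/
def shift {n : ℕ} (p : ℂ) (z : Fin n → ℂ) (m : Fin n) : Fin n → ℂ :=
  Function.update z m (z m + p)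

/-- The qKZ operator
`K_m(z) = R_{m,m-1}(z_m - z_{m-1} + p) ⋯ R_{m,1}(z_m - z_1 + p) exp(μ H_m)
  R_{m,n}(z_m - z_n) ⋯ R_{m,m+1}(z_m - z_{m+1})`.
In both products the index `j` decreases from left to right. -/
noncomputable def opK {n : ℕ} (ħ p μ : ℂ) (z : Fin n → ℂ) (m : Fin n) :
    Module.End ℂ (TensorV n) :=
  ((((List.finRange n).filter (fun j => j < m)).reverse.map
      (fun j => site₂ (matR ħ (z m - z j + p)) m j)).prod *
    site (NormedSpace.exp (μ • matH)) m) *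
  (((List.finRange n).filter (fun j => m < j)).reverse.map
      (fun j => site₂ (matR ħ (z m - z j)) m j)).prod

/-- The operator
`L = ∑ z_m H_m + ħ/(e^μ - 1) (e^μ ∑ H_m + ∑_{k<m} (e^μ σ⁻_k σ⁺_m + σ⁺_k σ⁻_m))`. -/
noncomputable def opL {n : ℕ} (ħ μ : ℂ) (z : Fin n → ℂ) : Module.End ℂ (TensorV n) :=
  ∑ m, z m • site matH m +
    (ħ / (exp μ - 1)) •
      (exp μ • ∑ m : Fin n, site matH m +
        ∑ m : Fin n, ∑ k ∈ Finset.univ.filter (fun k => k < m),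
          (exp μ • (site sigmaMinus k * site sigmaPlus m) + site sigmaPlus k * site sigmaMinus m))

/-- The points `z_1, …, z_n` are generic: `z_k - z_m + ħ ∉ p ℤ` for `k ≠ m`. -/
def Generic {n : ℕ} (ħ p : ℂ) (z : Fin n → ℂ) : Prop :=
  ∀ k m : Fin n, k ≠ m → ∀ s : ℤ, z k - z m + ħ ≠ p * s

/-! ### Rational and periodic functions -/

/-- `Asym f (t_1, …, t_ℓ) = ∑_σ sgn σ f(t_{σ 1}, …, t_{σ ℓ})`. -/
def asym {ℓ : ℕ} (f : (Fin ℓ → ℂ) → ℂ) (t : Fin ℓ → ℂ) : ℂ :=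
  ∑ σ : Equiv.Perm (Fin ℓ), ((Equiv.Perm.sign σ : ℤ) : ℂ) * f (fun a => t (σ a))

/-- The subsets `M = {m_1 < ⋯ < m_ℓ}` of the index set. -/
abbrev Subsets (n ℓ : ℕ) : Type := {M : Finset (Fin n) // M.card = ℓ}

/-- `g_M(t) = ∏_a (1/(t_a - z_{m_a}) ∏_{j < m_a} (t_a - z_j - ħ)/(t_a - z_j))
  ∏_{a < b} (t_a - t_b - ħ)`. -/
noncomputable def gM {n ℓ : ℕ} (ħ : ℂ) (z : Fin n → ℂ) (M : Subsets n ℓ) (t : Fin ℓ → ℂ) : ℂ :=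
  (∏ a : Fin ℓ, (1 / (t a - z (M.1.orderEmbOfFin M.2 a)) *
      ∏ j ∈ Finset.univ.filter (fun j => j < M.1.orderEmbOfFin M.2 a),
        (t a - z j - ħ) / (t a - z j))) *
    ∏ a : Fin ℓ, ∏ b ∈ Finset.univ.filter (fun b => a < b), (t a - t b - ħ)

/-- `w_M = Asym g_M`. -/
noncomputable def wM {n ℓ : ℕ} (ħ : ℂ) (z : Fin n → ℂ) (M : Subsets n ℓ) :
    (Fin ℓ → ℂ) → ℂ :=
  asym (gM ħ z M)

/-- The basis vector `v_M`: `-` at the places in `M` and `+` elsewhere. -/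
noncomputable def vM {n ℓ : ℕ} (M : Subsets n ℓ) : TensorV n :=
  Pi.single (fun m => if m ∈ M.1 then 1 else 0) 1

/-- `e^{2πi x/p}`. -/
noncomputable def ex (p x : ℂ) : ℂ := exp (2 * Real.pi * I * x / p)

/-- The space of periodic functions `W(t_1, …, t_ℓ; z_1, …, z_n)`: `W` is `p`-periodic in each
`z_m`, and `W ∏_m ∏_a (1 - e^{2πi (t_a - z_m)/p})` is, as a function of `t`, an antisymmetric
polynomial in the exponentials `e^{2πi t_a/p}` of degree less than `n` in each of them. The last
condition is imposed off the zeros of the product (where `W` may have poles). -/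
def IsPeriodicFun {n ℓ : ℕ} (p : ℂ) (W : (Fin ℓ → ℂ) → (Fin n → ℂ) → ℂ) : Prop :=
  (∀ t z m, W t (shift p z m) = W t z) ∧
  ∀ z : Fin n → ℂ, ∃ P : MvPolynomial (Fin ℓ) ℂ,
    (∀ σ : Equiv.Perm (Fin ℓ), MvPolynomial.rename σ P = ((Equiv.Perm.sign σ : ℤ) : ℂ) • P) ∧
    (∀ d ∈ P.support, ∀ a, d a < n) ∧
    ∀ t : Fin ℓ → ℂ, (∀ a m, ex p (t a - z m) ≠ 1) →
      W t z * ∏ m, ∏ a, (1 - ex p (t a - z m)) = MvPolynomial.eval (fun a => ex p (t a)) P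

/-- The phase function `φ(t) = exp(μ t/p) ∏_m Γ((t - z_m - ħ)/p) / Γ((t - z_m)/p)`. -/
noncomputable def phase {n : ℕ} (ħ p μ : ℂ) (z : Fin n → ℂ) (t : ℂ) : ℂ :=
  exp (μ * t / p) * ∏ m, Gamma ((t - z m - ħ) / p) / Gamma ((t - z m) / p)

/-! ### Contours and hypergeometric integrals -/

/-- The set `⋃_m (z_m + ħ + p ℤ_{≤ 0})`. -/
def leftPoles {n : ℕ} (ħ p : ℂ) (z : Fin n → ℂ) : Set ℂ :=
  {t | ∃ (m : Fin n) (k : ℕ), t = z m + ħ - p * k}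

/-- The set `⋃_m (z_m + p ℤ_{≥ 0})`. -/
def rightPoles {n : ℕ} (p : ℂ) (z : Fin n → ℂ) : Set ℂ :=
  {t | ∃ (m : Fin n) (k : ℕ), t = z m + p * k}

/-- A smoothly parametrized simple curve going from `-ip∞` to `+ip∞` and separating the sets
`⋃_m (z_m + ħ + p ℤ_{≤ 0})` and `⋃_m (z_m + p ℤ_{≥ 0})`, that is, these sets lie in two different
connected components of the complement of the curve. -/
structure Contour {n : ℕ} (ħ p : ℂ) (z : Fin n → ℂ) where
  /-- the parametrization -/
  ρ : ℝ → ℂ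
  smooth : ContDiff ℝ ∞ ρ
  simple : Function.Injective ρ
  proper : Tendsto (fun u => ‖ρ u‖) (cocompact ℝ) atTop
  /-- the limit of the derivative at `+∞` -/
  αTop : ℂ
  /-- the limit of the derivative at `-∞` -/
  αBot : ℂ
  deriv_top : Tendsto (deriv ρ) atTop (𝓝 αTop)
  deriv_bot : Tendsto (deriv ρ) atBot (𝓝 αBot)
  im_top : 0 < (αTop / p).im
  im_bot : 0 < (αBot / p).im
  separates : ∃ a b : ℂ,
    leftPoles ħ p z ⊆ connectedComponentIn (Set.range ρ)ᶜ a ∧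
    rightPoles p z ⊆ connectedComponentIn (Set.range ρ)ᶜ b ∧
    Disjoint (connectedComponentIn (Set.range ρ)ᶜ a) (connectedComponentIn (Set.range ρ)ᶜ b)

variable {n ℓ : ℕ} {ħ p : ℂ} {z : Fin n → ℂ}

/-- The values `μ` of the strip `0 < Im μ < 2π` for which `e^{μ t/p}` decays exponentially
along the upper end of the contour and `e^{(μ - 2πi) t/p}` does so along the lower end. It is
the whole strip if the ends are asymptotically parallel to `ip`. -/
def Contour.decay (C : Contour ħ p z) : Set ℂ :=
  {μ | 0 < μ.im ∧ μ.im < 2 * Real.pi ∧ (μ * (C.αTop / p)).re < 0 ∧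
    0 < ((μ - 2 * Real.pi * I) * (C.αBot / p)).re}

/-- The admissible values `μ`: those with `0 ≤ Im μ < 2π`, `μ ≠ 0`, in the closure of
`C.decay`. If the ends of the contour are asymptotically parallel to `ip`, then these are all
`μ ≠ 0` with `0 ≤ Im μ < 2π`. -/
def Contour.domain (C : Contour ħ p z) : Set ℂ :=
  {μ | 0 ≤ μ.im ∧ μ.im < 2 * Real.pi ∧ μ ≠ 0 ∧ μ ∈ closure C.decay}

/-- The integrand `w(t) W(t) ∏_a φ(t_a) dt_a` pulled back to `ℝ^ℓ` by the parametrization. -/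
noncomputable def integrand (C : Contour ħ p z) (w W : (Fin ℓ → ℂ) → ℂ) (μ : ℂ)
    (u : Fin ℓ → ℝ) : ℂ :=
  w (fun a => C.ρ (u a)) * W (fun a => C.ρ (u a)) *
    ∏ a, (phase ħ p μ z (C.ρ (u a)) * deriv C.ρ (u a))

/-- `(1/ℓ!) ∫_{C^ℓ} w(t) W(t) ∏_a φ(t_a) dt_a`. -/
noncomputable def rawInt (C : Contour ħ p z) (w W : (Fin ℓ → ℂ) → ℂ) (μ : ℂ) : ℂ :=
  1 / (ℓ.factorial : ℂ) * ∫ u : Fin ℓ → ℝ, integrand C w W μ u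

open Classical in
/-- The hypergeometric integral `I^{⊗ℓ}(w, W)`: the convergent integral in the domain of
exponential decay, and its limit from inside of this domain at the other values `μ`. -/
noncomputable def hypInt (C : Contour ħ p z) (w W : (Fin ℓ → ℂ) → ℂ) (μ : ℂ) : ℂ :=
  if μ ∈ C.decay then rawInt C w W μ
  else limUnder (𝓝[C.decay] μ) (fun ν => rawInt C w W ν)

/-- The hypergeometric solution `Ψ_W = ∑_M I^{⊗ℓ}(w_M, W) v_M`, its value at the point `z`
as a function of `μ`. -/
noncomputable def Psi (C : Contour ħ p z) (W : (Fin ℓ → ℂ) → (Fin n → ℂ) → ℂ) (μ : ℂ) :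
    TensorV n :=
  ∑ M : Subsets n ℓ, hypInt C (wM ħ z M) (fun t => W t z) μ • vM M

end QKZ

/-!
# The dynamical differential equation for the hypergeometric solutions of the qKZ equation

**The differential equation.** On the contour, differentiation of the phase function in `μ` brings
down the factor `∑_a t_a / p`, so the question is how multiplication by `∑_a t_a` acts on the
integrals of the functions `w_M`. Each `w_M` is an antisymmetrized product
`w_{m_1} ⋆ ⋯ ⋆ w_{m_ℓ}` of functions of one variable (`star`). With
`X_k(t) = ∏_{j < k} (t - z_j - ħ)/(t - z_j)` one has

* `t w_{k} = z_k w_{k} + X_k`,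
* `X_k - X_{k+1} = ħ w_{k}`,
* `w_{k} ⋆ X_{k+1} = X_k ⋆ w_{k}`.

The first relation turns `(∑_a t_a) w_M` into products with one factor `X_m`. The other two let this
factor travel to either end of the product, leaving behind the terms `ħ w_{N ∪ {k}}`, which are the
off-diagonal entries of `L`. What remains are the differences `1 ⋆ w_N - e^μ w_N ⋆ X_n`
(`sum_mul_wFun_eq`), and for `p = 2ħ` each of them is the antisymmetrization of a total difference
`F(t) - e^μ X_n(t_1) F(t_1 + p, t_2, …)` (`star_cons_sub_star_append`). Since the phase function is
multiplied by `e^μ X_n(t)` under `t ↦ t + p`, these integrate to zero.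

**The integrals.** The reflection formula turns the products of the phase functions and of the
periodic function into a combination of products of the entire functions `e^{μ t/p}` and of kernels
`kerG`, with the factors `Γ(x - 1/2) Γ(1 - x)`. By bounds for the beta integral these decay
exponentially along the contour if `μ` is in the domain of convergence. All the integrands become
sums of products of functions of one variable, so that convergence, differentiation under the
integral sign, and the vanishing of the total differences are statements about one variable. The last
one asks for shifting the contour by `p` (`shiftNull_of_poles`). No residues are collected, as every
pole `q` in the swept strip lies in the same component of the complement of the contour as `q - p`:
after the principal parts are subtracted, Cauchy's theorem applies, and the integrals of
`1/(t - q)` and `1/(t - q + p)` agree because they are locally constant off the contour.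

**The boundary.** The domain of convergence is convex, and `L` is continuous where `e^μ ≠ 1`. So
near a boundary point the solutions are bounded by Gronwall's inequality, hence Lipschitz, hence have
limits; the extended function satisfies the equation since its derivative has a limit
(`hasDerivWithinAt_closure_of_linear_ode`).

**Compatibility with the qKZ equation.** `L` makes sense for any order of the tensor factors, and
`R_{mj}(z_m - z_j)` intertwines the operators for two orders that differ by a transposition of
neighbours `m` and `j` (`matR_mul_opLMoved`). The operator `e^{μ H_m}` moves `m` from the last place
to the first one and shifts `z_m` by `p`, up to the term `p ∂_μ` (`exp_mul_opLMoved`). In the product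
`K_m` the factor `m` travels once around all of the others (`hasDerivAt_opK`).
-/

namespace QKZ

open Filter Topology MeasureTheory Complex
open scoped ContDiff

/-! ### Operators on the tensor power -/

theorem site_apply {n : ℕ} (X : Matrix (Fin 2) (Fin 2) ℂ) (i : Fin n) (v : TensorV n)
    (ε : Fin n → Fin 2) :
    site X i v ε = ∑ s, X (ε i) s * v (Function.update ε i s) := by
  simp only [site, Matrix.toLin'_apply, Matrix.mulVec, dotProduct, Matrix.of_apply]
  symm
  refine Finset.sum_of_injOn (fun s => Function.update ε i s)
    (Function.update_injective ε i).injOn (by simp) ?_ ?_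
  · intro δ _ hδ
    rw [if_neg, zero_mul]
    intro h
    refine hδ ⟨δ i, by simp, ?_⟩
    funext k
    by_cases hk : k = i
    · subst hk; simp
    · simp [hk, h k hk]
  · intro s _
    rw [if_pos]
    · simp
    · intro k hk
      simp [hk]

theorem site₂_matP_apply {n : ℕ} {i j : Fin n} (hij : i ≠ j) (v : TensorV n)
    (ε : Fin n → Fin 2) :
    site₂ matP i j v ε = v (ε ∘ Equiv.swap i j) := by
  simp only [site₂, Matrix.toLin'_apply, Matrix.mulVec, dotProduct, Matrix.of_apply, matP]
  rw [Finset.sum_eq_single (ε ∘ Equiv.swap i j)]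
  · rw [if_pos, if_pos, one_mul]
    · simp
    · intro k hk hk'
      simp [Equiv.swap_apply_of_ne_of_ne hk hk']
  · intro δ _ hδ
    by_cases h : ∀ k, k ≠ i → k ≠ j → ε k = δ k
    · rw [if_pos h, if_neg, zero_mul]
      intro h2
      simp only [Prod.swap_prod_mk, Prod.mk.injEq] at h2
      apply hδ
      funext k
      by_cases hk : k = i
      · subst hk; simp [h2.2]
      · by_cases hk' : k = j
        · subst hk'; simp [h2.1]
        · simp [Equiv.swap_apply_of_ne_of_ne hk hk', h k hk hk']
    · rw [if_neg h, zero_mul]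
  · simp

theorem site₂_matR {n : ℕ} (ħ x : ℂ) (i j : Fin n) :
    site₂ (matR ħ x) i j = (x + ħ)⁻¹ • (x • (1 : Module.End ℂ (TensorV n)) + ħ • site₂ matP i j) := by
  have h1 : site₂ (1 : Matrix (Fin 2 × Fin 2) (Fin 2 × Fin 2) ℂ) i j
      = (1 : Module.End ℂ (TensorV n)) := by
    rw [site₂, show (1 : Module.End ℂ (TensorV n)) = LinearMap.id from rfl, ← Matrix.toLin'_one]
    · congr 1
      ext ε δ
      simp only [Matrix.of_apply, Matrix.one_apply, Prod.mk.injEq]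
      by_cases h : ε = δ
      · subst h; simp
      · rw [if_neg h]
        split_ifs with h2 h3
        · exfalso
          apply h
          funext k
          by_cases hk : k = i
          · exact hk ▸ h3.1
          · by_cases hk' : k = j
            · exact hk' ▸ h3.2
            · exact h2 k hk hk'
        · rfl
        · rfl
  rw [← h1]
  simp only [site₂, ← map_smul, ← map_add]
  congr 1
  ext ε δ
  simp only [matR, Matrix.of_apply, Matrix.smul_apply, Matrix.add_apply, smul_eq_mul]
  split_ifs <;> simp

theorem site₂_matP_mul_site {n : ℕ} {i j : Fin n} (hij : i ≠ j) (X : Matrix (Fin 2) (Fin 2) ℂ)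
    (k : Fin n) : site₂ matP i j * site X k = site X (Equiv.swap i j k) * site₂ matP i j := by
  refine LinearMap.ext fun v => funext fun ε => ?_
  simp only [Module.End.mul_apply, site₂_matP_apply hij, site_apply, Function.comp_apply]
  refine Finset.sum_congr rfl fun s _ => ?_
  rw [Function.update_comp_equiv]
  simp

theorem site_matH_apply {n : ℕ} (i : Fin n) (v : TensorV n) (ε : Fin n → Fin 2) :
    site matH i v ε = if ε i = 1 then v ε else 0 := by
  rw [site_apply]
  rcases Fin.exists_fin_two.mp ⟨ε i, rfl⟩ with h | h
  · simp [h, matH]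
  · have h' : Function.update ε i 1 = ε := by rw [← h, Function.update_eq_self]
    simp [h, matH, h']

/-- The operators `σ⁻_k σ⁺_m`, `k ≠ m`, act by transposing two unequal signs. -/
theorem sigmaMinus_sigmaPlus_apply {n : ℕ} {k m : Fin n} (hkm : k ≠ m) (v : TensorV n)
    (ε : Fin n → Fin 2) :
    site sigmaMinus k (site sigmaPlus m v) ε =
      if ε k = 1 ∧ ε m = 0 then v (ε ∘ Equiv.swap k m) else 0 := by
  simp only [site_apply]
  have key : ε k = 1 → ε m = 0 →
      Function.update (Function.update ε k 0) m 1 = ε ∘ Equiv.swap k m := by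
    intro h1 h0
    funext i
    by_cases hi : i = m
    · subst hi; simp [h1]
    · by_cases hi' : i = k
      · subst hi'; simp [hkm, h0]
      · simp [hi, hi', Equiv.swap_apply_of_ne_of_ne hi' hi]
  rcases Fin.exists_fin_two.mp ⟨ε k, rfl⟩ with h | h <;>
  rcases Fin.exists_fin_two.mp ⟨ε m, rfl⟩ with h' | h' <;>
  simp [h, h', sigmaMinus, sigmaPlus, hkm.symm, Function.update_of_ne, key]

theorem site_comm {n : ℕ} {k m : Fin n} (hkm : k ≠ m) (X Y : Matrix (Fin 2) (Fin 2) ℂ) :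
    site X k * site Y m = site Y m * site X k := by
  refine LinearMap.ext fun v => funext fun ε => ?_
  simp only [Module.End.mul_apply, site_apply, Finset.mul_sum]
  rw [Finset.sum_comm]
  refine Finset.sum_congr rfl fun s _ => Finset.sum_congr rfl fun t _ => ?_
  rw [Function.update_comm hkm, Function.update_of_ne hkm.symm, Function.update_of_ne hkm]
  ring

theorem site_mul_site {n : ℕ} (m : Fin n) (X Y : Matrix (Fin 2) (Fin 2) ℂ) :
    site X m * site Y m = site (X * Y) m := by
  refine LinearMap.ext fun v => funext fun ε => ?_
  simp only [Module.End.mul_apply, site_apply, Function.update_idem, Function.update_self,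
    Matrix.mul_apply, Finset.mul_sum, Finset.sum_mul]
  rw [Finset.sum_comm]
  simp only [mul_assoc]

theorem site_smul {n : ℕ} (m : Fin n) (c : ℂ) (X : Matrix (Fin 2) (Fin 2) ℂ) :
    site (c • X) m = c • site X m := by
  refine LinearMap.ext fun v => funext fun ε => ?_
  simp [site_apply, mul_assoc, mul_add]

/-- On two sites, `(H_i - H_j) P = σ⁻_i σ⁺_j - σ⁺_i σ⁻_j`. -/
theorem matH_sub_mul_matP {n : ℕ} {i j : Fin n} (hij : i ≠ j) :
    (site matH i - site matH j) * site₂ matP i j =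
      site sigmaMinus i * site sigmaPlus j - site sigmaPlus i * site sigmaMinus j := by
  rw [site_comm hij sigmaPlus sigmaMinus]
  refine LinearMap.ext fun v => funext fun ε => ?_
  simp only [Module.End.mul_apply, LinearMap.sub_apply, Pi.sub_apply, site_matH_apply,
    site₂_matP_apply hij, sigmaMinus_sigmaPlus_apply hij, sigmaMinus_sigmaPlus_apply hij.symm]
  rw [Equiv.swap_comm j i]
  rcases Fin.exists_fin_two.mp ⟨ε i, rfl⟩ with h | h <;>
  rcases Fin.exists_fin_two.mp ⟨ε j, rfl⟩ with h' | h' <;>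
  simp [h, h']

/-! ### The compatibility of the two systems -/

/-- The pair interaction `e^μ σ⁻_k σ⁺_m + σ⁺_k σ⁻_m` of `opL`, the site `k` preceding `m`. -/
noncomputable def pairOp {n : ℕ} (μ : ℂ) (k m : Fin n) : Module.End ℂ (TensorV n) :=
  exp μ • (site sigmaMinus k * site sigmaPlus m) + site sigmaPlus k * site sigmaMinus m

/-- The order on the sites obtained from the usual one by moving the site `m` to the place right
after the elements of `S`; it is used for `S` an initial segment of the other sites. -/
def Before {n : ℕ} (m : Fin n) (S : Finset (Fin n)) (k k' : Fin n) : Prop :=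
  if k = m then k' ≠ m ∧ k' ∉ S else if k' = m then k ∈ S else k < k'

instance {n : ℕ} (m : Fin n) (S : Finset (Fin n)) (k k' : Fin n) : Decidable (Before m S k k') := by
  unfold Before; infer_instance

/-- The sum of the pair interactions with respect to the order `Before m S` of the sites. -/
noncomputable def pairSum {n : ℕ} (μ : ℂ) (m : Fin n) (S : Finset (Fin n)) :
    Module.End ℂ (TensorV n) :=
  ∑ k, ∑ k', if Before m S k k' then pairOp μ k k' else 0

/-- The operator `opL` with the tensor factors ordered by `Before m S`. -/
noncomputable def opLMoved {n : ℕ} (ħ μ : ℂ) (z : Fin n → ℂ) (m : Fin n) (S : Finset (Fin n)) :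
    Module.End ℂ (TensorV n) :=
  ∑ i, z i • site matH i + (ħ / (exp μ - 1)) • (exp μ • ∑ i : Fin n, site matH i + pairSum μ m S)

theorem opLMoved_eq_opL {n : ℕ} (ħ μ : ℂ) (z : Fin n → ℂ) (m : Fin n) (S : Finset (Fin n))
    (hS : ∀ k, k ≠ m → (k ∈ S ↔ k < m)) : opLMoved ħ μ z m S = opL ħ μ z := by
  have : pairSum μ m S = ∑ m : Fin n, ∑ k ∈ Finset.univ.filter (fun k => k < m),
          (exp μ • (site sigmaMinus k * site sigmaPlus m) +
            site sigmaPlus k * site sigmaMinus m) := by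
    rw [pairSum, Finset.sum_comm]
    refine Finset.sum_congr rfl fun k' _ => ?_
    rw [Finset.sum_filter]
    refine Finset.sum_congr rfl fun k _ => ?_
    have : Before m S k k' ↔ k < k' := by
      unfold Before
      split_ifs with h1 h2
      · subst h1
        constructor
        · rintro ⟨h, h'⟩
          rw [hS _ h] at h'
          exact lt_of_le_of_ne (not_lt.mp h') h.symm
        · intro h
          exact ⟨h.ne', fun h' => absurd ((hS _ h.ne').mp h') h.not_gt⟩
      · subst h2; exact hS _ h1
      · rfl
    simp only [this]
    rfl
  rw [opLMoved, this]
  rfl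

theorem matP_mul_pairOp {n : ℕ} (μ : ℂ) {i j : Fin n} (hij : i ≠ j) (k k' : Fin n) :
    site₂ matP i j * pairOp μ k k' =
      pairOp μ (Equiv.swap i j k) (Equiv.swap i j k') * site₂ matP i j := by
  have h := fun X Y : Matrix (Fin 2) (Fin 2) ℂ =>
    (mul_assoc (site₂ matP i j) (site X k) (site Y k')).symm
  simp only [pairOp, mul_add, mul_smul_comm, h, add_mul, smul_mul_assoc, site₂_matP_mul_site hij]
  simp only [mul_assoc, site₂_matP_mul_site hij]

/-- `R_{mj}` interchanges the neighbours `m` and `j` in the order of the tensor factors. -/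
theorem matR_mul_opLMoved {n : ℕ} (ħ μ : ℂ) (hμ : exp μ ≠ 1) (z : Fin n → ℂ) {m j : Fin n}
    (hmj : m ≠ j) (S : Finset (Fin n)) (hj : j ∉ S)
    (hS : ∀ k, k ≠ m → k ≠ j → (k ∈ S ↔ k < j)) :
    site₂ (matR ħ (z m - z j)) m j * opLMoved ħ μ z m S =
      opLMoved ħ μ z m (insert j S) * site₂ (matR ħ (z m - z j)) m j := by
  have hb : ∀ k k', Before m (insert j S) (Equiv.swap m j k) (Equiv.swap m j k') ↔
      Before m S k k' := by
    intro k k'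
    by_cases h1 : k = m
    · subst h1
      by_cases h2 : k' = k
      · subst h2; simp [Before, hmj.symm]
      · by_cases h3 : k' = j
        · subst h3; simp [Before, hj, hmj.symm]
        · simp only [Equiv.swap_apply_left, Equiv.swap_apply_of_ne_of_ne h2 h3, Before,
            hmj.symm, h2, if_true, if_false, ne_eq, not_false_eq_true, true_and, hS k' h2 h3]
          rw [not_lt, le_iff_lt_or_eq]
          simp [Ne.symm h3]
    · by_cases h1' : k = j
      · subst h1'
        by_cases h2 : k' = m
        · subst h2; simp [Before, hj, h1]
        · by_cases h3 : k' = k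
          · subst h3; simp [Before, hmj.symm]
          · simp only [Equiv.swap_apply_right, Equiv.swap_apply_of_ne_of_ne h2 h3, Before,
              h2, if_true, if_false, ne_eq, not_false_eq_true, true_and, Finset.mem_insert,
              h3, false_or, hS k' h2 h3, h1]
            rw [not_lt, le_iff_lt_or_eq]
            simp [Ne.symm h3]
      · by_cases h2 : k' = m
        · subst h2
          simp [Equiv.swap_apply_of_ne_of_ne h1 h1', Before, h1, hmj.symm, hS k h1 h1']
        · by_cases h3 : k' = j
          · subst h3
            simp [Equiv.swap_apply_of_ne_of_ne h1 h1', Before, h1, h1', hmj.symm, hS k h1 h1']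
          · simp [Equiv.swap_apply_of_ne_of_ne h1 h1', Equiv.swap_apply_of_ne_of_ne h2 h3, Before,
              h1, h2]
  set P := site₂ matP m j with hP
  have hT : P * pairSum μ m S = pairSum μ m (insert j S) * P := by
    unfold pairSum
    simp only [Finset.mul_sum, Finset.sum_mul, mul_ite, ite_mul, mul_zero, zero_mul]
    rw [← Equiv.sum_comp (Equiv.swap m j)
      (fun k => ∑ k', if Before m (insert j S) k k' then pairOp μ k k' * P else 0)]
    refine Finset.sum_congr rfl fun k _ => ?_
    rw [← Equiv.sum_comp (Equiv.swap m j) (fun k' => if Before m (insert j S) _ k' then _ else 0)]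
    refine Finset.sum_congr rfl fun k' _ => ?_
    simp only [hb, hP, matP_mul_pairOp μ hmj]
  have hTT : pairSum μ m (insert j S) = pairSum μ m S + pairOp μ j m - pairOp μ m j := by
    have : ∀ k k', (if Before m (insert j S) k k' then pairOp μ k k' else 0) =
        (if Before m S k k' then pairOp μ k k' else 0) +
          (if k = j then (if k' = m then pairOp μ k k' else 0) else 0) -
          (if k = m then (if k' = j then pairOp μ k k' else 0) else 0) := by
      intro k k'
      unfold Before
      by_cases h1 : k = m
      · subst h1
        by_cases h2 : k' = k
        · subst h2; simp [hmj]
        · by_cases h3 : k' = j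
          · subst h3; simp [hj, hmj, hmj.symm]
          · simp [h2, h3]
      · by_cases h1' : k = j
        · subst h1'
          by_cases h2 : k' = m
          · subst h2; simp [hj, h1]
          · simp [h1, h2]
        · simp [h1, h1']
    simp only [pairSum, this, Finset.sum_sub_distrib, Finset.sum_add_distrib]
    simp
  have hpp : pairOp μ j m - pairOp μ m j =
      -((exp μ - 1) • ((site matH m - site matH j) * P)) := by
    rw [hP, matH_sub_mul_matP hmj, pairOp, pairOp, site_comm hmj.symm, site_comm hmj.symm]
    module
  have hZ : P * (∑ i, z i • site matH i) = (∑ i, z i • site matH i) * P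
      - (z m - z j) • ((site matH m - site matH j) * P) := by
    simp only [Finset.mul_sum, mul_smul_comm, hP, site₂_matP_mul_site hmj]
    have h1 : ∑ i, z i • (site matH (Equiv.swap m j i) * P) =
        ∑ i, z (Equiv.swap m j i) • (site matH i * P) := by
      rw [← Equiv.sum_comp (Equiv.swap m j)]
      simp
    have h2 : ∀ i, z (Equiv.swap m j i) • (site matH i * P) = z i • (site matH i * P)
        - (if i = m then (z m - z j) • (site matH i * P) else 0)
        + (if i = j then (z m - z j) • (site matH i * P) else 0) := by
      intro i
      by_cases h1 : i = m
      · subst h1; simp only [Equiv.swap_apply_left, if_true, hmj, if_false]; module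
      · by_cases h2 : i = j
        · subst h2; simp only [Equiv.swap_apply_right, if_true, if_neg hmj.symm]; module
        · simp [h1, h2, Equiv.swap_apply_of_ne_of_ne h1 h2]
    rw [← hP, h1]
    simp only [h2, Finset.sum_add_distrib, Finset.sum_sub_distrib, Finset.sum_mul,
      smul_mul_assoc, sub_mul, smul_sub]
    simp
    abel
  have hH : P * (∑ i : Fin n, site matH i) = (∑ i : Fin n, site matH i) * P := by
    simp only [Finset.mul_sum, hP, site₂_matP_mul_site hmj, Finset.sum_mul]
    rw [← Equiv.sum_comp (Equiv.swap m j)]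
    simp
  have hμ' : exp μ - 1 ≠ 0 := sub_ne_zero.mpr hμ
  rw [site₂_matR, ← hP]
  simp only [opLMoved, smul_mul_assoc, mul_smul_comm, add_mul, mul_add, one_mul, mul_one, hZ, hT,
    hH, smul_add, smul_sub]
  rw [show pairSum μ m (insert j S) = pairSum μ m S -
    ((exp μ - 1) • ((site matH m - site matH j) * P)) by rw [hTT, add_sub_assoc, hpp]; abel]
  simp only [sub_mul, smul_sub, mul_sub, smul_mul_assoc, smul_smul]
  match_scalars <;> field_simp

/-- A chain of `R`-matrices moves the site `m` across the sites of a sorted list. -/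
theorem prod_matR_mul_opLMoved {n : ℕ} (ħ μ : ℂ) (hμ : exp μ ≠ 1) (z : Fin n → ℂ) (m : Fin n)
    (x : Fin n → ℂ) (hx : ∀ j, j ≠ m → x j = z m - z j) (l : List (Fin n)) :
    ∀ S : Finset (Fin n), l.Pairwise (· < ·) → m ∉ l → (∀ s ∈ S, ∀ j ∈ l, s < j) →
      (∀ j ∈ l, ∀ k, k ≠ m → k < j → k ∈ S ∨ k ∈ l) →
      (l.reverse.map (fun j => site₂ (matR ħ (x j)) m j)).prod * opLMoved ħ μ z m S =
        opLMoved ħ μ z m (S ∪ l.toFinset) *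
          (l.reverse.map (fun j => site₂ (matR ħ (x j)) m j)).prod := by
  induction l with
  | nil => intro S _ _ _ _; simp
  | cons j l ih =>
    intro S hl hm hS hk
    rw [List.pairwise_cons] at hl
    simp only [List.mem_cons, not_or] at hm
    have hjS : j ∉ S := fun h => lt_irrefl _ (hS j h j (by simp))
    have h1 := matR_mul_opLMoved ħ μ hμ z hm.1 S hjS (fun k hkm hkj => by
      constructor
      · intro h; exact hS k h j (by simp)
      · intro h
        rcases hk j (by simp) k hkm h with h' | h'
        · exact h'
        · rcases List.mem_cons.mp h' with h' | h'
          · exact absurd h' hkj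
          · exact absurd (hl.1 k h') h.not_gt)
    have h2 := ih (insert j S) hl.2 hm.2 (by
      intro s hs i hi
      rcases Finset.mem_insert.mp hs with rfl | hs
      · exact hl.1 i hi
      · exact hS s hs i (by simp [hi])) (by
      intro i hi k hkm hki
      rcases hk i (by simp [hi]) k hkm hki with h | h
      · exact Or.inl (by simp [h])
      · rcases List.mem_cons.mp h with h | h
        · exact Or.inl (by simp [h])
        · exact Or.inr h)
    have hset : insert j S ∪ l.toFinset = S ∪ (j :: l).toFinset := by
      ext i; simp
    simp only [List.reverse_cons, List.map_append, List.prod_append, List.map_cons, List.map_nil,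
      List.prod_cons, List.prod_nil, mul_one]
    rw [mul_assoc, hx j (Ne.symm hm.1), h1, ← mul_assoc, h2, hset, mul_assoc]

theorem exp_smul_matH (μ : ℂ) : NormedSpace.exp (μ • matH) = !![1, 0; 0, exp μ] := by
  have h : μ • matH = Matrix.diagonal ![0, μ] := by
    ext i j; fin_cases i <;> fin_cases j <;> simp [matH]
  rw [h, Matrix.exp_diagonal]
  ext i j
  fin_cases i <;> fin_cases j <;>
    simp [Matrix.diagonal, NormedSpace.exp_zero, Pi.coe_exp, Complex.exp_eq_exp_ℂ]

/-- `exp(μ H_m)` moves the site `m` from the last place to the first one, with the shift of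
`z_m` by `p`. -/
theorem exp_mul_opLMoved {n : ℕ} (ħ p μ : ℂ) (z : Fin n → ℂ) (m : Fin n) (S : Finset (Fin n))
    (hS : ∀ k, k ≠ m → k ∈ S) :
    opLMoved ħ μ (shift p z m) m ∅ * site (NormedSpace.exp (μ • matH)) m =
      p • site (matH * NormedSpace.exp (μ • matH)) m +
        site (NormedSpace.exp (μ • matH)) m * opLMoved ħ μ z m S := by
  set E := NormedSpace.exp (μ • matH) with hE
  rw [exp_smul_matH] at hE
  have hEH : E * matH = matH * E := by
    rw [hE]; ext i j; fin_cases i <;> fin_cases j <;> simp [matH, Matrix.mul_apply]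
  have hEp : E * sigmaPlus = exp (-μ) • (sigmaPlus * E) := by
    rw [hE]; ext i j; fin_cases i <;> fin_cases j <;>
      simp [sigmaPlus, Matrix.mul_apply, ← Complex.exp_add]
  have hEm : E * sigmaMinus = exp μ • (sigmaMinus * E) := by
    rw [hE]; ext i j; fin_cases i <;> fin_cases j <;> simp [sigmaMinus, Matrix.mul_apply]
  have hc : ∀ i, site E m * site matH i = site matH i * site E m := by
    intro i
    by_cases h : m = i
    · subst h; rw [site_mul_site, site_mul_site, hEH]
    · exact site_comm h _ _
  have hX : ∀ (k : Fin n), k ≠ m → site E m * pairOp μ k m = pairOp μ m k * site E m := by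
    intro k hk
    have a1 : site E m * site sigmaPlus m = exp (-μ) • (site sigmaPlus m * site E m) := by
      rw [site_mul_site, site_mul_site, hEp, site_smul]
    have a2 : site E m * site sigmaMinus m = exp μ • (site sigmaMinus m * site E m) := by
      rw [site_mul_site, site_mul_site, hEm, site_smul]
    rw [pairOp, pairOp, site_comm hk, site_comm hk, mul_add, add_mul, mul_smul_comm, ← mul_assoc,
      ← mul_assoc, a1, a2]
    simp only [smul_mul_assoc, mul_assoc, site_comm hk.symm E]
    rw [smul_smul, ← Complex.exp_add, add_neg_cancel, Complex.exp_zero, one_smul, add_comm]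
  have hX' : ∀ (k k' : Fin n), k ≠ m → k' ≠ m →
      site E m * pairOp μ k k' = pairOp μ k k' * site E m := by
    intro k k' hk hk'
    have hh := fun (X : Matrix (Fin 2) (Fin 2) ℂ) (i : Fin n) (hi : i ≠ m) =>
      site_comm hi.symm E X
    simp only [pairOp, mul_add, add_mul, mul_smul_comm, smul_mul_assoc]
    simp only [← mul_assoc, hh _ k hk]
    simp only [mul_assoc, hh _ k' hk']
  have hT : pairSum μ m ∅ * site E m = site E m * pairSum μ m S := by
    unfold pairSum
    simp only [Finset.mul_sum, Finset.sum_mul, mul_ite, ite_mul, mul_zero, zero_mul]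
    have split : ∀ (f : Fin n → Fin n → Module.End ℂ (TensorV n)), f m m = 0 →
        ∑ k, ∑ k', f k k' = ∑ k ∈ Finset.univ.erase m, (f m k + f k m) +
          ∑ k ∈ Finset.univ.erase m, ∑ k' ∈ Finset.univ.erase m, f k k' := by
      intro f hf
      rw [← Finset.add_sum_erase _ _ (Finset.mem_univ m)]
      simp only [← Finset.add_sum_erase _ (fun k' => f _ k') (Finset.mem_univ m), hf,
        Finset.sum_add_distrib]
      abel
    rw [split _ (by simp [Before]), split _ (by simp [Before])]
    congr 1
    · refine Finset.sum_congr rfl fun k hk => ?_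
      have hk := Finset.ne_of_mem_erase hk
      simp [Before, hk, hS k hk, hX k hk]
    · refine Finset.sum_congr rfl fun k hk => Finset.sum_congr rfl fun k' hk' => ?_
      have hk := Finset.ne_of_mem_erase hk
      have hk' := Finset.ne_of_mem_erase hk'
      simp [Before, hk, hk', hX' k k' hk hk']
  have hZ : (∑ i, shift p z m i • site matH i) = ∑ i, z i • site matH i + p • site matH m := by
    have : ∀ i, shift p z m i • site matH i = z i • site matH i +
        if i = m then p • site matH i else 0 := by
      intro i
      by_cases h : i = m
      · subst h; simp [shift, add_smul]
      · simp [shift, h]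
    simp [this, Finset.sum_add_distrib]
  simp only [opLMoved, hZ, add_mul, mul_add, smul_mul_assoc, mul_smul_comm, hT, Finset.sum_mul,
    Finset.mul_sum, hc, site_mul_site]
  abel

/-- `L(z_1, …, z_m + p, …, z_n) K_m(z) = p ∂_μ K_m(z) + K_m(z) L(z)`. -/
theorem hasDerivAt_opK {n : ℕ} (ħ p μ : ℂ) (hμ : exp μ ≠ 1) (z : Fin n → ℂ) (m : Fin n)
    (v : TensorV n) :
    HasDerivAt (fun ν => p • opK ħ p ν z m v)
      (opL ħ μ (shift p z m) (opK ħ p μ z m v) - opK ħ p μ z m (opL ħ μ z v)) μ := by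
  set lA := (List.finRange n).filter (fun j => j < m) with hlA
  set lB := (List.finRange n).filter (fun j => m < j) with hlB
  set A := (lA.reverse.map (fun j => site₂ (matR ħ (z m - z j + p)) m j)).prod with hA
  set B := (lB.reverse.map (fun j => site₂ (matR ħ (z m - z j)) m j)).prod with hB
  have hK : ∀ ν, opK ħ p ν z m = A * site (NormedSpace.exp (ν • matH)) m * B := fun ν => rfl
  have hsort : (List.finRange n).Pairwise (· < ·) := List.pairwise_lt_finRange n
  have h1 : A * opLMoved ħ μ (shift p z m) m ∅ = opL ħ μ (shift p z m) * A := by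
    have := prod_matR_mul_opLMoved ħ μ hμ (shift p z m) m (fun j => z m - z j + p)
      (fun j hj => by simp [shift, hj]; ring) lA ∅ (hsort.filter _) (by simp [hlA]) (by simp)
      (by
        intro j hj k hk hkj
        simp only [hlA, List.mem_filter, List.mem_finRange, true_and, decide_eq_true_eq] at hj ⊢
        exact Or.inr (hkj.trans hj))
    rw [hA, this, opLMoved_eq_opL]
    intro k hk
    simp [hlA]
  have h2 : B * opL ħ μ z = opLMoved ħ μ z m (Finset.univ.filter (· < m) ∪ lB.toFinset) * B := by
    rw [← opLMoved_eq_opL ħ μ z m (Finset.univ.filter (· < m)) (by simp)]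
    refine prod_matR_mul_opLMoved ħ μ hμ z m (fun j => z m - z j)
      (fun j hj => rfl) lB _ (hsort.filter _) (by simp [hlB]) ?_ ?_
    · intro s hs j hj
      simp only [hlB, List.mem_filter, List.mem_finRange, true_and, decide_eq_true_eq,
        Finset.mem_filter, Finset.mem_univ] at hs hj
      exact hs.trans hj
    · intro j hj k hk hkj
      simp only [hlB, List.mem_filter, List.mem_finRange, true_and, decide_eq_true_eq,
        Finset.mem_filter, Finset.mem_univ]
      exact lt_or_gt_of_ne hk
  have h3 := exp_mul_opLMoved ħ p μ z m (Finset.univ.filter (· < m) ∪ lB.toFinset) (by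
    intro k hk
    simp only [hlB, List.mem_filter, List.mem_finRange, true_and, decide_eq_true_eq,
        Finset.mem_filter, Finset.mem_univ, Finset.mem_union, List.mem_toFinset]
    exact lt_or_gt_of_ne hk)
  have h4 : opL ħ μ (shift p z m) * opK ħ p μ z m =
      p • (A * site (matH * NormedSpace.exp (μ • matH)) m * B) + opK ħ p μ z m * opL ħ μ z := by
    rw [hK, ← mul_assoc, ← mul_assoc, ← h1, mul_assoc A, h3, mul_assoc (A * _) B, h2]
    simp only [mul_add, add_mul, mul_smul_comm, smul_mul_assoc, mul_assoc]
  have h5 : opL ħ μ (shift p z m) (opK ħ p μ z m v) - opK ħ p μ z m (opL ħ μ z v) =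
      p • (A (site (matH * NormedSpace.exp (μ • matH)) m (B v))) := by
    have := LinearMap.congr_fun h4 v
    simp only [Module.End.mul_apply, LinearMap.add_apply, LinearMap.smul_apply] at this
    rw [this]; abel
  rw [h5]
  simp only [hK, Module.End.mul_apply]
  refine HasDerivAt.const_smul p ?_
  have h6 : HasDerivAt (fun ν => site (NormedSpace.exp (ν • matH)) m (B v))
      (site (matH * NormedSpace.exp (μ • matH)) m (B v)) μ := by
    rw [hasDerivAt_pi]
    intro ε
    simp only [site_apply, exp_smul_matH, Fin.sum_univ_two]
    rcases Fin.exists_fin_two.mp ⟨ε m, rfl⟩ with h | h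
    · simp [h, matH, Matrix.mul_apply, hasDerivAt_const]
    · simp only [h, matH, Matrix.mul_apply]
      simpa using (Complex.hasDerivAt_exp μ).mul_const _
  exact (LinearMap.toContinuousLinearMap A).hasFDerivAt.comp_hasDerivAt μ h6

/-! ### Antisymmetrized products of functions of one variable -/

/-- The factor `∏_{a < b} (t_a - t_b - ħ)`. -/
def quantumVandermonde (ħ : ℂ) {ℓ : ℕ} (t : Fin ℓ → ℂ) : ℂ :=
  ∏ a, ∏ b ∈ Finset.univ.filter (fun b => a < b), (t a - t b - ħ)

/-- The function `∏_a f_a(t_a) ∏_{a < b} (t_a - t_b - ħ)`, where `f_1, …, f_ℓ` are the entries of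
the list `L`; these lists have length `ℓ` wherever the function is used. -/
def starTerm (ħ : ℂ) (ℓ : ℕ) (L : List (ℂ → ℂ)) (t : Fin ℓ → ℂ) : ℂ :=
  (∏ a : Fin ℓ, L.getD a 0 (t a)) * quantumVandermonde ħ t

/-- The antisymmetrization `f_1 ⋆ ⋯ ⋆ f_ℓ` of `starTerm`. -/
def star (ħ : ℂ) (ℓ : ℕ) (L : List (ℂ → ℂ)) : (Fin ℓ → ℂ) → ℂ :=
  asym (starTerm ħ ℓ L)

theorem asym_eq_of_sub_swap {ℓ : ℕ} (F G : (Fin ℓ → ℂ) → ℂ) (t : Fin ℓ → ℂ) {i j : Fin ℓ}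
    (hij : i ≠ j)
    (h : ∀ σ : Equiv.Perm (Fin ℓ), F (t ∘ σ) - F ((t ∘ σ) ∘ Equiv.swap i j) =
      G (t ∘ σ) - G ((t ∘ σ) ∘ Equiv.swap i j)) : asym F t = asym G t := by
  have key : ∀ F : (Fin ℓ → ℂ) → ℂ, 2 * asym F t = ∑ σ : Equiv.Perm (Fin ℓ),
      ((Equiv.Perm.sign σ : ℤ) : ℂ) * (F (t ∘ σ) - F ((t ∘ σ) ∘ Equiv.swap i j)) := by
    intro F
    simp only [mul_sub, Finset.sum_sub_distrib]
    have : asym F t = -∑ σ : Equiv.Perm (Fin ℓ),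
        ((Equiv.Perm.sign σ : ℤ) : ℂ) * F ((t ∘ σ) ∘ Equiv.swap i j) := by
      rw [asym, ← Equiv.sum_comp (Equiv.mulRight (Equiv.swap i j)), ← Finset.sum_neg_distrib]
      refine Finset.sum_congr rfl fun σ _ => ?_
      simp only [Equiv.coe_mulRight, Equiv.Perm.sign_mul, Equiv.Perm.sign_swap hij]
      push_cast
      simp [Function.comp_def]
    rw [two_mul]
    nth_rewrite 2 [this]
    rw [← sub_eq_add_neg]
    rfl
  have h2 : 2 * asym F t = 2 * asym G t := by
    rw [key, key]
    exact Finset.sum_congr rfl fun σ _ => by rw [h]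
  exact mul_left_cancel₀ two_ne_zero h2

/-- Splitting off the factor of `quantumVandermonde` of two neighbours leaves a function that is
symmetric in these. -/
theorem exists_quantumVandermonde_eq (ħ : ℂ) {ℓ : ℕ} {i j : Fin ℓ} (hij : (j : ℕ) = i + 1) :
    ∃ V : (Fin ℓ → ℂ) → ℂ, ∀ s, quantumVandermonde ħ s = (s i - s j - ħ) * V s ∧
      V (s ∘ Equiv.swap i j) = V s := by
  refine ⟨fun s => ∏ x ∈ Finset.univ.filter
    (fun x : Fin ℓ × Fin ℓ => x.1 < x.2 ∧ x ≠ (i, j)), (s x.1 - s x.2 - ħ), fun s => ⟨?_, ?_⟩⟩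
  · have h1 : quantumVandermonde ħ s = ∏ x ∈ Finset.univ.filter
        (fun x : Fin ℓ × Fin ℓ => x.1 < x.2), (s x.1 - s x.2 - ħ) := by
      simp only [quantumVandermonde, Finset.prod_filter]
      rw [Fintype.prod_prod_type]
    rw [h1, ← Finset.mul_prod_erase _ _ (a := (i, j))]
    · congr 1
      refine Finset.prod_congr ?_ fun _ _ => rfl
      ext x
      simp only [Finset.mem_erase, Finset.mem_filter, Finset.mem_univ, true_and]
      tauto
    · simp only [Finset.mem_filter, Finset.mem_univ, true_and]
      exact Fin.lt_def.mpr (by omega)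
  · refine Finset.prod_equiv ((Equiv.swap i j).prodCongr (Equiv.swap i j)) ?_ ?_
    · rintro ⟨a, b⟩
      have hsw : ∀ x : Fin ℓ, ((Equiv.swap i j x : Fin ℓ) : ℕ) =
          if (x : ℕ) = i then (i : ℕ) + 1 else if (x : ℕ) = i + 1 then (i : ℕ) else x := by
        intro x
        rw [Equiv.swap_apply_def]
        simp only [Fin.ext_iff, hij]
        split_ifs <;> simp_all
      simp only [Finset.mem_filter, Finset.mem_univ, true_and, Equiv.prodCongr_apply, ne_eq, Prod.map_apply, Prod.mk.injEq, Fin.lt_def, Fin.ext_iff, hsw, hij]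
      split_ifs <;> omega
    · intro x _
      simp

theorem prod_getD_append_cons {ℓ : ℕ} (A B : List (ℂ → ℂ)) (f : ℂ → ℂ) (s : Fin ℓ → ℂ)
    {i : Fin ℓ} (hi : (i : ℕ) = A.length) :
    ∏ a : Fin ℓ, (A ++ f :: B).getD a 0 (s a) =
      f (s i) * ∏ a ∈ Finset.univ.erase i, (A ++ 0 :: B).getD a 0 (s a) := by
  rw [← Finset.mul_prod_erase _ _ (Finset.mem_univ i)]
  congr 1
  · rw [List.getD_append_right _ _ _ _ hi.ge, hi]; simp
  · refine Finset.prod_congr rfl fun a ha => ?_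
    have ha : (a : ℕ) ≠ A.length := fun h => (Finset.ne_of_mem_erase ha) (Fin.ext (h.trans hi.symm))
    rcases lt_or_gt_of_ne ha with h | h
    · rw [List.getD_append _ _ _ _ h, List.getD_append _ _ _ _ h]
    · rw [List.getD_append_right _ _ _ _ h.le, List.getD_append_right _ _ _ _ h.le]
      obtain ⟨k, hk⟩ := Nat.exists_eq_add_of_lt h
      rw [hk, show A.length + k + 1 - A.length = k + 1 by omega]
      simp

/-- `star` is linear in each entry; the relation between the entries is only needed at the values
of the variables. -/
theorem star_append_cons_linear (ħ : ℂ) {ℓ : ℕ} (A B : List (ℂ → ℂ)) (f g h : ℂ → ℂ) (c : ℂ)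
    (t : Fin ℓ → ℂ) (hA : A.length < ℓ) (hf : ∀ a, f (t a) = g (t a) + c * h (t a)) :
    star ħ ℓ (A ++ f :: B) t = star ħ ℓ (A ++ g :: B) t + c * star ħ ℓ (A ++ h :: B) t := by
  simp only [star, asym, Finset.mul_sum, ← Finset.sum_add_distrib]
  refine Finset.sum_congr rfl fun σ _ => ?_
  simp only [starTerm, prod_getD_append_cons A B _ _ (i := ⟨A.length, hA⟩) rfl, hf]
  ring

/-- Two neighbouring entries `f, g` of `star` may be replaced by `f', g'` if
`f ⋆ g = f' ⋆ g'`. -/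
theorem star_append_cons_cons_congr (ħ : ℂ) {ℓ : ℕ} (A B : List (ℂ → ℂ)) (f g f' g' : ℂ → ℂ)
    (t : Fin ℓ → ℂ) (hA : A.length + 1 < ℓ)
    (h : ∀ a b, f (t a) * g (t b) * (t a - t b - ħ) - f (t b) * g (t a) * (t b - t a - ħ) =
      f' (t a) * g' (t b) * (t a - t b - ħ) - f' (t b) * g' (t a) * (t b - t a - ħ)) :
    star ħ ℓ (A ++ f :: g :: B) t = star ħ ℓ (A ++ f' :: g' :: B) t := by
  set i : Fin ℓ := ⟨A.length, by omega⟩ with hi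
  set j : Fin ℓ := ⟨A.length + 1, hA⟩ with hj
  have hij : i ≠ j := by simp [hi, hj, Fin.ext_iff]
  obtain ⟨V, hV⟩ := exists_quantumVandermonde_eq ħ (i := i) (j := j) rfl
  have hmem : j ∈ Finset.univ.erase i := by simp [hij.symm]
  have key : ∀ (f g : ℂ → ℂ) (s : Fin ℓ → ℂ), starTerm ħ ℓ (A ++ f :: g :: B) s =
      f (s i) * g (s j) * (s i - s j - ħ) *
        ((∏ a ∈ (Finset.univ.erase i).erase j, (A ++ 0 :: 0 :: B).getD a 0 (s a)) * V s) := by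
    intro f g s
    have h2 : ∏ a ∈ Finset.univ.erase i, (A ++ 0 :: g :: B).getD a 0 (s a) =
        g (s j) * ∏ a ∈ (Finset.univ.erase i).erase j, (A ++ 0 :: 0 :: B).getD a 0 (s a) := by
      rw [← Finset.mul_prod_erase _ _ hmem]
      congr 1
      · rw [List.getD_append_right _ _ _ _ (by simp [hj])]; simp [hj]
      · refine Finset.prod_congr rfl fun a ha => ?_
        have ha1 : (a : ℕ) ≠ A.length + 1 := fun h => (Finset.ne_of_mem_erase ha) (Fin.ext h)
        have ha0 : (a : ℕ) ≠ A.length := fun h =>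
          (Finset.ne_of_mem_erase (Finset.mem_of_mem_erase ha)) (Fin.ext h)
        rcases lt_or_gt_of_ne ha0 with h | h
        · rw [List.getD_append _ _ _ _ h, List.getD_append _ _ _ _ h]
        · rw [List.getD_append_right _ _ _ _ h.le, List.getD_append_right _ _ _ _ h.le]
          obtain ⟨k, hk⟩ := Nat.exists_eq_add_of_lt h
          obtain ⟨k', rfl⟩ : ∃ k', k = k' + 1 := ⟨k - 1, by omega⟩
          rw [hk, show A.length + (k' + 1) + 1 - A.length = k' + 1 + 1 by omega]
          simp
    rw [starTerm, prod_getD_append_cons A (g :: B) f s (i := i) rfl, h2, (hV s).1]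
    ring
  refine asym_eq_of_sub_swap _ _ t hij fun σ => ?_
  have hrest : ∀ s : Fin ℓ → ℂ, (∏ a ∈ (Finset.univ.erase i).erase j,
      (A ++ 0 :: 0 :: B).getD a 0 ((s ∘ Equiv.swap i j) a)) =
      ∏ a ∈ (Finset.univ.erase i).erase j, (A ++ 0 :: 0 :: B).getD a 0 (s a) := by
    intro s
    refine Finset.prod_congr rfl fun a ha => ?_
    rw [Function.comp_apply, Equiv.swap_apply_of_ne_of_ne
      (Finset.ne_of_mem_erase (Finset.mem_of_mem_erase ha)) (Finset.ne_of_mem_erase ha)]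
  simp only [key, hrest, (hV _).2]
  simp only [Function.comp_apply, Equiv.swap_apply_left, Equiv.swap_apply_right]
  rw [← sub_mul, ← sub_mul, h]

theorem quantumVandermonde_succ (ħ : ℂ) {r : ℕ} (s : Fin (r + 1) → ℂ) :
    quantumVandermonde ħ s =
      (∏ b : Fin r, (s 0 - s b.succ - ħ)) * quantumVandermonde ħ (fun b => s b.succ) := by
  simp only [quantumVandermonde, Finset.prod_filter, Fin.prod_univ_succ (n := r),
    Fin.succ_pos, if_true, Fin.succ_lt_succ_iff, Fin.not_lt_zero, if_false, one_mul]

theorem quantumVandermonde_castSucc (ħ : ℂ) {r : ℕ} (s : Fin (r + 1) → ℂ) :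
    quantumVandermonde ħ s = (∏ b : Fin r, (s b.castSucc - s (Fin.last r) - ħ)) *
      quantumVandermonde ħ (fun b => s b.castSucc) := by
  simp only [quantumVandermonde, Finset.prod_filter, Fin.prod_univ_castSucc (n := r),
    Fin.castSucc_lt_last, if_true, Fin.castSucc_lt_castSucc_iff, lt_irrefl, if_false, mul_one,
    Finset.prod_mul_distrib, (Fin.le_last _).not_gt, Finset.prod_const_one]
  rw [mul_comm]

/-- If `p = 2ħ`, then `1 ⋆ L - c (L ⋆ X)` is the antisymmetrization of the difference of
`F = ∏_{b > 0} (t_0 - t_b - ħ) ⋅ L(t_1, …, t_r)` and `c X(t_0)` times its shift by `p` in `t_0`. -/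
theorem star_cons_sub_star_append (ħ : ℂ) {r : ℕ} (L : List (ℂ → ℂ)) (hL : L.length = r)
    (X : ℂ → ℂ) (c : ℂ) (t : Fin (r + 1) → ℂ) :
    star ħ (r + 1) ((fun _ => 1) :: L) t - c * star ħ (r + 1) (L ++ [X]) t =
      asym (fun s => (∏ b : Fin r, (s 0 - s b.succ - ħ)) * starTerm ħ r L (fun b => s b.succ) -
        c * X (s 0) * ((∏ b : Fin r, (s 0 + 2 * ħ - s b.succ - ħ)) *
          starTerm ħ r L (fun b => s b.succ))) t := by
  have h1 : ∀ s, starTerm ħ (r + 1) ((fun _ => 1) :: L) s =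
      (∏ b : Fin r, (s 0 - s b.succ - ħ)) * starTerm ħ r L (fun b => s b.succ) := by
    intro s
    simp only [starTerm, Fin.prod_univ_succ, quantumVandermonde_succ]
    simp only [Fin.val_zero, List.getD_cons_zero, Fin.val_succ, List.getD_cons_succ]
    ring
  have h2 : ∀ s : Fin (r + 1) → ℂ, starTerm ħ (r + 1) (L ++ [X]) (fun a => s (finRotate (r + 1) a)) =
      (-1) ^ r * (X (s 0) * ((∏ b : Fin r, (s 0 + 2 * ħ - s b.succ - ħ)) *
        starTerm ħ r L (fun b => s b.succ))) := by
    intro s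
    have e : ∀ b : Fin r, finRotate (r + 1) b.castSucc = b.succ := by
      intro b
      rw [finRotate_apply, Fin.coeSucc_eq_succ]
    have hc : ∀ b : Fin r, (L ++ [X]).getD (b.castSucc : Fin (r + 1)) 0 = L.getD b 0 := by
      intro b
      exact List.getD_append _ _ _ _ (by simp [hL])
    have hl : (L ++ [X]).getD (Fin.last r : Fin (r + 1)) 0 = X := by
      rw [List.getD_append_right _ _ _ _ (by simp [hL])]; simp [hL]
    have h3 : ∏ b : Fin r, (s b.succ - s 0 - ħ) =
        (-1) ^ r * ∏ b : Fin r, (s 0 + 2 * ħ - s b.succ - ħ) := by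
      rw [show (-1 : ℂ) ^ r = ∏ _b : Fin r, (-1 : ℂ) by simp, ← Finset.prod_mul_distrib]
      exact Finset.prod_congr rfl fun b _ => by ring
    simp only [starTerm, Fin.prod_univ_castSucc (n := r), quantumVandermonde_castSucc, e,
      finRotate_last, hc, hl, h3]
    ring
  have h4 : star ħ (r + 1) (L ++ [X]) t = ∑ σ : Equiv.Perm (Fin (r + 1)),
      ((Equiv.Perm.sign σ : ℤ) : ℂ) * (X (t (σ 0)) *
        ((∏ b : Fin r, (t (σ 0) + 2 * ħ - t (σ b.succ) - ħ)) *
        starTerm ħ r L (fun b => t (σ b.succ)))) := by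
    rw [star, asym, ← Equiv.sum_comp (Equiv.mulRight (finRotate (r + 1)))]
    refine Finset.sum_congr rfl fun σ _ => ?_
    have := h2 (fun a => t (σ a))
    simp only [Equiv.coe_mulRight, Equiv.Perm.sign_mul, sign_finRotate, Equiv.Perm.coe_mul,
      Function.comp_apply] at this ⊢
    rw [this, Nat.add_sub_cancel]
    push_cast
    rw [mul_assoc, ← mul_assoc ((-1) ^ r) ((-1) ^ r), ← mul_pow]
    simp
  rw [h4, star, asym, asym, Finset.mul_sum, ← Finset.sum_sub_distrib]
  refine Finset.sum_congr rfl fun σ _ => ?_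
  rw [h1]
  ring

/-! ### The rational functions `w_M` -/

/-- The function `X_k(t) = ∏_{j < k} (t - z_j - ħ)/(t - z_j)` of one variable. -/
noncomputable def xFun {n : ℕ} (ħ : ℂ) (z : Fin n → ℂ) (k : ℕ) (t : ℂ) : ℂ :=
  ∏ j ∈ Finset.univ.filter (fun j : Fin n => (j : ℕ) < k), (t - z j - ħ) / (t - z j)

/-- The function `w_{{k}}` of one variable. -/
noncomputable def omegaFun {n : ℕ} (ħ : ℂ) (z : Fin n → ℂ) (k : Fin n) (t : ℂ) : ℂ :=
  1 / (t - z k) * xFun ħ z k t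

theorem xFun_succ {n : ℕ} (ħ : ℂ) (z : Fin n → ℂ) (k : Fin n) (t : ℂ) :
    xFun ħ z (k + 1) t = (t - z k - ħ) / (t - z k) * xFun ħ z k t := by
  have : Finset.univ.filter (fun j : Fin n => (j : ℕ) < k + 1) =
      insert k (Finset.univ.filter (fun j : Fin n => (j : ℕ) < k)) := by
    ext j
    simp only [Finset.mem_filter, Finset.mem_univ, true_and, Finset.mem_insert, Fin.ext_iff]
    omega
  rw [xFun, this, Finset.prod_insert (by simp)]
  rfl

theorem xFun_eq_add {n : ℕ} (ħ : ℂ) (z : Fin n → ℂ) (k : Fin n) (t : ℂ) (ht : t ≠ z k) :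
    xFun ħ z k t = xFun ħ z (k + 1) t + ħ * omegaFun ħ z k t := by
  have : t - z k ≠ 0 := sub_ne_zero.mpr ht
  rw [xFun_succ, omegaFun]
  field_simp
  ring

/-- The function `w_N`, defined for a set `N` of any cardinality. -/
noncomputable def wFun {n : ℕ} (ħ : ℂ) (z : Fin n → ℂ) (ℓ : ℕ) (N : Finset (Fin n)) :
    (Fin ℓ → ℂ) → ℂ :=
  star ħ ℓ (N.sort.map (omegaFun ħ z))

/-- The product `star` of the functions `w_{{m}}`, `m ∈ N`, with the function `X_k` inserted after
those with `m < k`. -/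
noncomputable def zFun {n : ℕ} (ħ : ℂ) (z : Fin n → ℂ) (ℓ : ℕ) (N : Finset (Fin n)) (k : ℕ) :
    (Fin ℓ → ℂ) → ℂ :=
  star ħ ℓ ((N.filter (fun m : Fin n => (m : ℕ) < k)).sort.map (omegaFun ħ z) ++
    xFun ħ z k :: (N.filter (fun m : Fin n => k ≤ (m : ℕ))).sort.map (omegaFun ħ z))

theorem wM_eq_wFun {n ℓ : ℕ} (ħ : ℂ) (z : Fin n → ℂ) (M : Subsets n ℓ) :
    wM ħ z M = wFun ħ z ℓ M.1 := by
  rw [wM, wFun, star]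
  congr 1
  funext t
  rw [gM, starTerm]
  congr 1
  refine Finset.prod_congr rfl fun a _ => ?_
  have ha : (a : ℕ) < (M.1.sort.map (omegaFun ħ z)).length := by
    rw [List.length_map, Finset.length_sort, M.2]; exact a.2
  have hs : (M.1.sort (fun a b => a ≤ b))[(a : ℕ)]'(by simpa using ha) =
    M.1.orderEmbOfFin M.2 a := (Finset.orderEmbOfFin_apply M.1 M.2 a).symm
  rw [List.getD_eq_getElem _ _ ha, List.getElem_map, hs]
  rfl

theorem sort_union {n : ℕ} {A B : Finset (Fin n)} (h : ∀ a ∈ A, ∀ b ∈ B, a < b) :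
    (A ∪ B).sort = A.sort ++ B.sort := by
  have hd : Disjoint A B := Finset.disjoint_left.mpr fun a ha hb => lt_irrefl _ (h a ha a hb)
  refine List.Perm.eq_of_pairwise (le := (· ≤ ·)) (fun a b _ _ => le_antisymm)
    (Finset.pairwise_sort _ _) ?_ ?_
  · rw [List.pairwise_append]
    refine ⟨Finset.pairwise_sort _ _, Finset.pairwise_sort _ _, fun a ha b hb => ?_⟩
    exact (h a ((Finset.mem_sort _).mp ha) b ((Finset.mem_sort _).mp hb)).le
  · refine List.perm_of_nodup_nodup_toFinset_eq (Finset.sort_nodup _ _) ?_ (by ext; simp)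
    rw [List.nodup_append]
    refine ⟨Finset.sort_nodup _ _, Finset.sort_nodup _ _, fun a ha b hb => ?_⟩
    exact (h a ((Finset.mem_sort _).mp ha) b ((Finset.mem_sort _).mp hb)).ne

theorem sort_eq_of_mem {n : ℕ} {N : Finset (Fin n)} {k : Fin n} (hk : k ∈ N) :
    N.sort = (N.filter (fun m : Fin n => (m : ℕ) < k)).sort ++
      k :: (N.filter (fun m : Fin n => (k : ℕ) + 1 ≤ m)).sort := by
  have h1 : N = N.filter (fun m : Fin n => (m : ℕ) < k) ∪
      ({k} ∪ N.filter (fun m : Fin n => (k : ℕ) + 1 ≤ m)) := by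
    ext m
    simp only [Finset.mem_union, Finset.mem_filter, Finset.mem_singleton, Fin.ext_iff]
    constructor
    · intro h
      rcases lt_trichotomy (m : ℕ) k with h' | h' | h'
      · exact Or.inl ⟨h, h'⟩
      · exact Or.inr (Or.inl h')
      · exact Or.inr (Or.inr ⟨h, h'⟩)
    · rintro (h | h | h)
      · exact h.1
      · exact Fin.ext h ▸ hk
      · exact h.1
  conv_lhs => rw [h1]
  rw [sort_union, sort_union]
  · simp
  · intro a ha b hb
    simp only [Finset.mem_filter, Finset.mem_singleton] at ha hb
    subst ha
    exact Fin.lt_def.mpr hb.2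
  · intro a ha b hb
    simp only [Finset.mem_union, Finset.mem_filter, Finset.mem_singleton] at ha hb
    rcases hb with rfl | hb
    · exact Fin.lt_def.mpr ha.2
    · exact Fin.lt_def.mpr (by omega)

/-- Moving `X_k` across the site `k ∈ N` changes nothing: this is the relation
`w_{{k}} ⋆ X_{k+1} = X_k ⋆ w_{{k}}`. -/
theorem zFun_succ_of_mem {n ℓ : ℕ} (ħ : ℂ) (z : Fin n → ℂ) {N : Finset (Fin n)}
    (hN : N.card + 1 = ℓ) {k : Fin n} (hk : k ∈ N) (t : Fin ℓ → ℂ) (ht : ∀ a j, t a ≠ z j) :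
    zFun ħ z ℓ N k t = zFun ħ z ℓ N (k + 1) t := by
  have h1 : (N.filter (fun m : Fin n => (k : ℕ) ≤ m)).sort =
      k :: (N.filter (fun m : Fin n => (k : ℕ) + 1 ≤ m)).sort := by
    rw [sort_eq_of_mem (N := N.filter (fun m : Fin n => (k : ℕ) ≤ m)) (k := k) (by simp [hk]),
      Finset.filter_filter, Finset.filter_filter, Finset.filter_eq_empty_iff.mpr (by intros; omega)]
    simp only [Finset.sort_empty, List.nil_append]
    congr 3
    ext m
    omega
  have h2 : (N.filter (fun m : Fin n => (m : ℕ) < k + 1)).sort =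
      (N.filter (fun m : Fin n => (m : ℕ) < k)).sort ++ [k] := by
    rw [sort_eq_of_mem (N := N.filter (fun m : Fin n => (m : ℕ) < k + 1)) (k := k) (by simp [hk]),
      Finset.filter_filter, Finset.filter_filter,
      (Finset.filter_eq_empty_iff.mpr (by intros; omega) :
        N.filter (fun m : Fin n => (m : ℕ) < k + 1 ∧ (k : ℕ) + 1 ≤ m) = ∅)]
    simp only [Finset.sort_empty]
    congr 3
    ext m
    omega
  have hlen : (N.filter (fun m : Fin n => (m : ℕ) < k)).sort.length + 1 < ℓ := by
    have h3 := congrArg List.length (sort_eq_of_mem hk)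
    simp only [Finset.length_sort, List.length_append, List.length_cons] at h3 ⊢
    omega
  rw [zFun, zFun, h1, h2]
  simp only [List.map_append, List.map_cons, List.map_nil, List.append_assoc, List.cons_append,
    List.nil_append]
  refine star_append_cons_cons_congr ħ _ _ _ _ _ _ t (by simpa using hlen) fun a b => ?_
  have ha : t a - z k ≠ 0 := sub_ne_zero.mpr (ht a k)
  have hb : t b - z k ≠ 0 := sub_ne_zero.mpr (ht b k)
  simp only [xFun_succ, omegaFun]
  field_simp
  ring

/-- Here `X_k - X_{k+1} = ħ w_{{k}}` is applied to the entry of `star` at the place `k`. -/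
theorem zFun_succ_of_notMem {n ℓ : ℕ} (ħ : ℂ) (z : Fin n → ℂ) {N : Finset (Fin n)}
    (hN : N.card + 1 = ℓ) {k : Fin n} (hk : k ∉ N) (t : Fin ℓ → ℂ) (ht : ∀ a j, t a ≠ z j) :
    zFun ħ z ℓ N k t = zFun ħ z ℓ N (k + 1) t + ħ * wFun ħ z ℓ (insert k N) t := by
  have hne : ∀ m ∈ N, (m : ℕ) ≠ k := fun m hm h => hk (Fin.ext h ▸ hm)
  have h1 : N.filter (fun m : Fin n => (k : ℕ) ≤ m) = N.filter (fun m : Fin n => (k : ℕ) + 1 ≤ m) :=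
    Finset.filter_congr fun m hm => by have := hne m hm; omega
  have h2 : N.filter (fun m : Fin n => (m : ℕ) < k + 1) = N.filter (fun m : Fin n => (m : ℕ) < k) :=
    Finset.filter_congr fun m hm => by have := hne m hm; omega
  have h3 : (insert k N).sort = (N.filter (fun m : Fin n => (m : ℕ) < k)).sort ++
      k :: (N.filter (fun m : Fin n => (k : ℕ) + 1 ≤ m)).sort := by
    rw [sort_eq_of_mem (Finset.mem_insert_self k N), Finset.filter_insert, Finset.filter_insert,
      if_neg (lt_irrefl _), if_neg (by omega)]
  have hlen : (N.filter (fun m : Fin n => (m : ℕ) < k)).sort.length < ℓ := by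
    rw [Finset.length_sort]
    have := Finset.card_filter_le N (fun m : Fin n => (m : ℕ) < k)
    omega
  rw [zFun, zFun, wFun, h1, h2, h3, List.map_append, List.map_cons]
  exact star_append_cons_linear ħ _ _ _ _ _ _ t (by simpa using hlen)
    fun a => xFun_eq_add ħ z k (t a) (ht a k)

/-- The relation `t w_{{m}} = z_m w_{{m}} + X_m`, applied to each of the entries of `star`. -/
theorem sum_mul_wFun {n ℓ : ℕ} (ħ : ℂ) (z : Fin n → ℂ) {M : Finset (Fin n)} (hM : M.card = ℓ)
    (t : Fin ℓ → ℂ) (ht : ∀ a j, t a ≠ z j) :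
    (∑ a, t a - ∑ m ∈ M, z m) * wFun ħ z ℓ M t = ∑ m ∈ M, zFun ħ z ℓ (M.erase m) m t := by
  have hsum : ∀ g : Fin n → ℂ, ∑ m ∈ M, g m = ∑ a, g (M.orderEmbOfFin hM a) := by
    intro g
    conv_lhs => rw [← Finset.map_orderEmbOfFin_univ M hM, Finset.sum_map]
    rfl
  have hterm : ∀ (a : Fin ℓ) (s : Fin ℓ → ℂ), s a ≠ z (M.orderEmbOfFin hM a) →
      (s a - z (M.orderEmbOfFin hM a)) * starTerm ħ ℓ (M.sort.map (omegaFun ħ z)) s =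
      starTerm ħ ℓ (((M.erase (M.orderEmbOfFin hM a)).filter
          (fun m : Fin n => (m : ℕ) < M.orderEmbOfFin hM a)).sort.map (omegaFun ħ z) ++
        xFun ħ z (M.orderEmbOfFin hM a) :: ((M.erase (M.orderEmbOfFin hM a)).filter
          (fun m : Fin n => ((M.orderEmbOfFin hM a : Fin n) : ℕ) ≤ (m : ℕ))).sort.map (omegaFun ħ z)) s := by
    intro a s hs
    set k := M.orderEmbOfFin hM a with hk
    have hkM : k ∈ M := Finset.orderEmbOfFin_mem M hM a
    have e1 : (M.erase k).filter (fun m : Fin n => (m : ℕ) < k) = M.filter (fun m : Fin n => (m : ℕ) < k) := by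
      ext m; simp only [Finset.mem_filter, Finset.mem_erase, ne_eq, Fin.ext_iff];
      constructor <;> rintro ⟨h1, h2⟩
      · exact ⟨h1.2, h2⟩
      · exact ⟨⟨h2.ne, h1⟩, h2⟩
    have e2 : (M.erase k).filter (fun m : Fin n => (k : ℕ) ≤ m) =
        M.filter (fun m : Fin n => (k : ℕ) + 1 ≤ m) := by
      ext m; simp only [Finset.mem_filter, Finset.mem_erase, ne_eq, Fin.ext_iff]
      constructor <;> rintro ⟨h1, h2⟩
      · exact ⟨h1.2, by omega⟩
      · exact ⟨⟨by omega, h1⟩, by omega⟩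
    have hlen : (a : ℕ) = (M.filter (fun m : Fin n => (m : ℕ) < k)).sort.length := by
      have h1 : (a : ℕ) < M.sort.length := by rw [Finset.length_sort, hM]; exact a.2
      have h2 : (M.filter (fun m : Fin n => (m : ℕ) < k)).sort.length < M.sort.length := by
        rw [sort_eq_of_mem hkM]; simp
      have h3 : M.sort[(a : ℕ)] = k := (Finset.orderEmbOfFin_apply M hM a).symm
      have h4 : M.sort[(M.filter (fun m : Fin n => (m : ℕ) < k)).sort.length] = k := by
        have := sort_eq_of_mem hkM
        simp only [this]
        simp
      exact (Finset.sort_nodup M _).getElem_inj_iff.mp (h3.trans h4.symm)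
    have hz : s a - z k ≠ 0 := sub_ne_zero.mpr hs
    rw [e1, e2, sort_eq_of_mem hkM, List.map_append, List.map_cons, starTerm, starTerm,
      prod_getD_append_cons _ _ _ _ (i := a) (by simpa using hlen),
      prod_getD_append_cons _ _ _ _ (i := a) (by simpa using hlen), omegaFun]
    field_simp
  rw [hsum, hsum]
  simp only [wFun, zFun, star, asym]
  rw [Finset.sum_comm, Finset.mul_sum]
  refine Finset.sum_congr rfl fun σ _ => ?_
  rw [← Finset.mul_sum, ← Finset.sum_sub_distrib, mul_left_comm]
  congr 1
  rw [← Finset.sum_congr rfl fun a _ => hterm a (fun a => t (σ a)) (ht _ _), ← Finset.sum_mul]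
  congr 1
  rw [Finset.sum_sub_distrib, Finset.sum_sub_distrib, Equiv.sum_comp σ t]

/-- The sum of the differences `Z_k - Z_{k+1}` over the sites `k` in an interval, each equal to
`ħ w_{N ∪ {k}}` or zero. -/
theorem zFun_sub_zFun {n ℓ : ℕ} (ħ : ℂ) (z : Fin n → ℂ) {N : Finset (Fin n)}
    (hN : N.card + 1 = ℓ) (t : Fin ℓ → ℂ) (ht : ∀ a j, t a ≠ z j) {a b : ℕ} (hab : a ≤ b)
    (hb : b ≤ n) :
    zFun ħ z ℓ N a t - zFun ħ z ℓ N b t = ħ * ∑ k ∈ Finset.univ.filter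
      (fun k : Fin n => k ∉ N ∧ a ≤ (k : ℕ) ∧ (k : ℕ) < b), wFun ħ z ℓ (insert k N) t := by
  induction b, hab using Nat.le_induction with
  | base =>
    rw [Finset.filter_eq_empty_iff.mpr (by intros; omega)]
    simp
  | succ b hab ih =>
    have ih := ih (by omega)
    set k : Fin n := ⟨b, by omega⟩ with hk
    by_cases hkN : k ∈ N
    · have h1 := zFun_succ_of_mem ħ z hN hkN t ht
      have : Finset.univ.filter (fun k : Fin n => k ∉ N ∧ a ≤ (k : ℕ) ∧ (k : ℕ) < b + 1) =
          Finset.univ.filter (fun k : Fin n => k ∉ N ∧ a ≤ (k : ℕ) ∧ (k : ℕ) < b) := by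
        refine Finset.filter_congr fun m _ => ?_
        constructor
        · rintro ⟨h2, h3, h4⟩
          exact ⟨h2, h3, lt_of_le_of_ne (by omega) fun h => h2 ((Fin.ext h : m = k) ▸ hkN)⟩
        · rintro ⟨h1, h2, h3⟩
          exact ⟨h1, h2, by omega⟩
      rw [this, ← ih, ← h1]
    · have h1 := zFun_succ_of_notMem ħ z hN hkN t ht
      have : Finset.univ.filter (fun k : Fin n => k ∉ N ∧ a ≤ (k : ℕ) ∧ (k : ℕ) < b + 1) =
          insert k
            (Finset.univ.filter (fun k : Fin n => k ∉ N ∧ a ≤ (k : ℕ) ∧ (k : ℕ) < b)) := by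
        ext m
        simp only [Finset.mem_filter, Finset.mem_univ, true_and, Finset.mem_insert, Fin.ext_iff, hk]
        constructor
        · rintro ⟨h1, h2, h3⟩
          by_cases h : (m : ℕ) = b
          · exact Or.inl h
          · exact Or.inr ⟨h1, h2, by omega⟩
        · rintro (h | ⟨h1, h2, h3⟩)
          · have : m = k := Fin.ext h
            exact ⟨this ▸ hkN, by omega, by omega⟩
          · exact ⟨h1, h2, by omega⟩
      rw [this, Finset.sum_insert (by simp [hk]), mul_add, ← ih]
      simp only [hk] at h1 ⊢
      rw [h1]
      ring

/-- The identity behind the differential equation: modulo the differences `e^μ Z_n - Z_0`,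
multiplication by `∑_a t_a` acts on the functions `w_M` as the operator `opL`; `q` stands for
`e^μ`. -/
theorem sum_mul_wFun_eq {n ℓ : ℕ} (ħ q : ℂ) (z : Fin n → ℂ) {M : Finset (Fin n)}
    (hM : M.card = ℓ) (t : Fin ℓ → ℂ) (ht : ∀ a j, t a ≠ z j) :
    (q - 1) * ((∑ a, t a) * wFun ħ z ℓ M t) =
      ∑ m ∈ M, (((q - 1) * z m + ħ * q) * wFun ħ z ℓ M t +
        ħ * (q * ∑ k ∈ Finset.univ.filter (fun k => k ∉ M ∧ m < k),
            wFun ħ z ℓ (insert k (M.erase m)) t +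
          ∑ k ∈ Finset.univ.filter (fun k => k ∉ M ∧ k < m),
            wFun ħ z ℓ (insert k (M.erase m)) t) -
        (zFun ħ z ℓ (M.erase m) 0 t - q * zFun ħ z ℓ (M.erase m) n t)) := by
  have h1 := sum_mul_wFun ħ z hM t ht
  have h2 : ∀ m ∈ M, (q - 1) * zFun ħ z ℓ (M.erase m) m t = ħ * q * wFun ħ z ℓ M t +
        ħ * (q * ∑ k ∈ Finset.univ.filter (fun k => k ∉ M ∧ m < k),
            wFun ħ z ℓ (insert k (M.erase m)) t +
          ∑ k ∈ Finset.univ.filter (fun k => k ∉ M ∧ k < m),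
            wFun ħ z ℓ (insert k (M.erase m)) t) -
        (zFun ħ z ℓ (M.erase m) 0 t - q * zFun ħ z ℓ (M.erase m) n t) := by
    intro m hm
    have hN : (M.erase m).card + 1 = ℓ := by rw [Finset.card_erase_add_one hm, hM]
    have a1 := zFun_sub_zFun ħ z hN t ht (Nat.zero_le (m : ℕ)) m.2.le
    have a2 := zFun_sub_zFun ħ z hN t ht (a := (m : ℕ) + 1) (b := n) m.2 le_rfl
    have a3 := zFun_succ_of_notMem ħ z hN (k := m) (by simp) t ht
    rw [Finset.insert_erase hm] at a3
    have f1 : Finset.univ.filter (fun k : Fin n => k ∉ M.erase m ∧ 0 ≤ (k : ℕ) ∧ (k : ℕ) < m) =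
        Finset.univ.filter (fun k => k ∉ M ∧ k < m) := by
      refine Finset.filter_congr fun k _ => ?_
      rw [Fin.lt_def, Finset.mem_erase]
      constructor
      · rintro ⟨h, -, h'⟩
        exact ⟨fun hk => h ⟨fun he => by subst he; omega, hk⟩, h'⟩
      · rintro ⟨h, h'⟩
        exact ⟨fun hk => h hk.2, by omega, h'⟩
    have f2 : Finset.univ.filter
        (fun k : Fin n => k ∉ M.erase m ∧ (m : ℕ) + 1 ≤ (k : ℕ) ∧ (k : ℕ) < n) =
        Finset.univ.filter (fun k => k ∉ M ∧ m < k) := by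
      refine Finset.filter_congr fun k _ => ?_
      rw [Fin.lt_def, Finset.mem_erase]
      constructor
      · rintro ⟨h, h', -⟩
        exact ⟨fun hk => h ⟨fun he => by subst he; omega, hk⟩, h'⟩
      · rintro ⟨h, h'⟩
        exact ⟨fun hk => h hk.2, by omega, k.2⟩
    rw [f1] at a1
    rw [f2] at a2
    rw [mul_add, mul_left_comm ħ q, ← a1, ← a2]
    linear_combination q * a3
  calc (q - 1) * ((∑ a, t a) * wFun ħ z ℓ M t)
      = (q - 1) * ((∑ m ∈ M, z m) * wFun ħ z ℓ M t) +
        (q - 1) * ((∑ a, t a - ∑ m ∈ M, z m) * wFun ħ z ℓ M t) := by ring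
    _ = _ := by
      rw [h1, Finset.sum_mul, Finset.mul_sum, Finset.mul_sum, ← Finset.sum_add_distrib]
      refine Finset.sum_congr rfl fun m hm => ?_
      rw [h2 m hm]
      ring

/-! ### Shifting the contour -/

/-- A parametrized curve running from infinity to infinity: a smooth and proper map. -/
structure IsContour (ρ : ℝ → ℂ) : Prop where
  smooth : ContDiff ℝ ∞ ρ
  proper : Tendsto (fun u => ‖ρ u‖) (cocompact ℝ) atTop

theorem Contour.isContour {n : ℕ} {ħ p : ℂ} {z : Fin n → ℂ} (C : Contour ħ p z) : IsContour C.ρ :=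
  ⟨C.smooth, C.proper⟩

namespace IsContour

variable {ρ : ℝ → ℂ}

theorem continuous (h : IsContour ρ) : Continuous ρ := h.smooth.continuous

theorem hasDerivAt (h : IsContour ρ) (u : ℝ) : HasDerivAt ρ (deriv ρ u) u :=
  (h.smooth.differentiable (by simp) u).hasDerivAt

theorem continuous_deriv (h : IsContour ρ) : Continuous (deriv ρ) :=
  h.smooth.continuous_deriv (by simp)

theorem differentiable_deriv (h : IsContour ρ) : Differentiable ℝ (deriv ρ) :=
  (contDiff_infty.mp h.smooth 2).differentiable_deriv_two

theorem tendsto_cocompact (h : IsContour ρ) : Tendsto ρ (cocompact ℝ) (cocompact ℂ) := by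
  rw [← Metric.cobounded_eq_cocompact (α := ℂ), ← comap_norm_atTop, tendsto_comap_iff]
  exact h.proper

theorem isClosed_range (h : IsContour ρ) : IsClosed (Set.range ρ) :=
  (isProperMap_iff_tendsto_cocompact.mpr ⟨h.continuous, h.tendsto_cocompact⟩).isClosedMap.isClosed_range

theorem tendsto_atTop (h : IsContour ρ) : Tendsto ρ atTop (cocompact ℂ) :=
  h.tendsto_cocompact.mono_left atTop_le_cocompact

theorem tendsto_atBot (h : IsContour ρ) : Tendsto ρ atBot (cocompact ℂ) :=
  h.tendsto_cocompact.mono_left atBot_le_cocompact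

end IsContour

theorem tendsto_inv_sub_pow (c : ℂ) {k : ℕ} (hk : k ≠ 0) :
    Tendsto (fun t : ℂ => ((t - c) ^ k)⁻¹) (cocompact ℂ) (𝓝 0) := by
  have h1 : Tendsto (fun t : ℂ => t - c) (cocompact ℂ) (cocompact ℂ) :=
    (Homeomorph.subRight c).isClosedEmbedding.tendsto_cocompact
  have h2 : Tendsto (fun t : ℂ => t⁻¹) (cocompact ℂ) (𝓝 0) := by
    rw [← Metric.cobounded_eq_cocompact]; exact tendsto_inv₀_cobounded
  have h3 := (h2.comp h1).pow k
  rw [zero_pow hk] at h3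
  refine h3.congr fun t => ?_
  simp [inv_pow]

/-- The integral over the curve of a function with a primitive vanishing at infinity is zero. -/
theorem tendsto_integral_of_primitive {P f : ℝ → ℂ} (hP : ∀ u, HasDerivAt P (f u) u)
    (hf : Continuous f) (htop : Tendsto P atTop (𝓝 0)) (hbot : Tendsto P atBot (𝓝 0)) :
    Tendsto (fun T : ℝ => ∫ u in -T..T, f u) atTop (𝓝 0) := by
  have : ∀ T : ℝ, ∫ u in -T..T, f u = P T - P (-T) := fun T =>
    intervalIntegral.integral_eq_sub_of_hasDerivAt (fun u _ => hP u) (hf.intervalIntegrable _ _)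
  simp only [this]
  simpa using htop.sub (hbot.comp tendsto_neg_atTop_atBot)

theorem tendsto_integral_inv_pow {ρ : ℝ → ℂ} (h : IsContour ρ) {c : ℂ} (hc : c ∉ Set.range ρ)
    {k : ℕ} (hk : k ≠ 0) :
    Tendsto (fun T : ℝ => ∫ u in -T..T, ((ρ u - c) ^ (k + 1))⁻¹ * deriv ρ u) atTop (𝓝 0) := by
  have hne : ∀ u, ρ u - c ≠ 0 := fun u hu => hc ⟨u, sub_eq_zero.mp hu⟩
  have hk' : (k : ℂ) ≠ 0 := Nat.cast_ne_zero.mpr hk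
  have hlim := (tendsto_inv_sub_pow c hk).const_mul (-(k : ℂ)⁻¹)
  rw [mul_zero] at hlim
  refine tendsto_integral_of_primitive (P := fun u => -(k : ℂ)⁻¹ * ((ρ u - c) ^ k)⁻¹)
    (fun u => ?_) ?_ (hlim.comp h.tendsto_atTop) (hlim.comp h.tendsto_atBot)
  · have h1 := ((((h.hasDerivAt u).sub_const c).pow k).inv (pow_ne_zero k (hne u))).const_mul
      (-(k : ℂ)⁻¹)
    refine HasDerivAt.congr_deriv (f := fun u => -(k : ℂ)⁻¹ * ((ρ u - c) ^ k)⁻¹) h1 ?_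
    obtain ⟨j, rfl⟩ := Nat.exists_eq_succ_of_ne_zero hk
    have := hne u
    simp only [Nat.succ_eq_add_one, Nat.add_sub_cancel, Pi.pow_apply] at hk' ⊢
    field_simp
    ring
  · exact (((h.continuous.sub continuous_const).pow _).inv₀ fun u => pow_ne_zero _ (hne u)).mul
      h.continuous_deriv

/-- The integral over the curve of `1/(t - c)`, suitably normalized, is locally constant as a
function of `c`. -/
theorem tendsto_integral_inv_sub_inv {ρ : ℝ → ℂ} (h : IsContour ρ) {K : Set ℂ}
    (hK : IsPreconnected K) (hKρ : K ⊆ (Set.range ρ)ᶜ) {c c' : ℂ} (hc : c ∈ K) (hc' : c' ∈ K) :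
    Tendsto (fun T : ℝ => ∫ u in -T..T, ((ρ u - c')⁻¹ - (ρ u - c)⁻¹) * deriv ρ u)
      atTop (𝓝 0) := by
  have hne : ∀ c ∈ K, ∀ u, ρ u - c ≠ 0 := fun c hc u hu => hKρ hc ⟨u, sub_eq_zero.mp hu⟩
  have hcont : ∀ c ∈ K, Continuous fun u => (ρ u - c)⁻¹ * deriv ρ u := fun c hc =>
    ((h.continuous.sub continuous_const).inv₀ (hne c hc)).mul h.continuous_deriv
  have hcont2 : ∀ c ∈ K, ∀ c' ∈ K, Continuous fun u => ((ρ u - c')⁻¹ - (ρ u - c)⁻¹) * deriv ρ u := by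
    intro c hc c' hc'
    simp only [sub_mul]
    exact (hcont c' hc').sub (hcont c hc)
  refine hK.induction₂ (fun c c' => Tendsto (fun T : ℝ => ∫ u in -T..T,
    ((ρ u - c')⁻¹ - (ρ u - c)⁻¹) * deriv ρ u) atTop (𝓝 0)) ?_ ?_ ?_ hc hc'
  · intro c hc
    obtain ⟨r, hr, hball⟩ := Metric.isOpen_iff.mp h.isClosed_range.isOpen_compl c (hKρ hc)
    filter_upwards [inter_mem_nhdsWithin K (Metric.ball_mem_nhds c hr)] with c' hc'
    have hn : ∀ u, ‖(c - c') / (ρ u - c)‖ < 1 := by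
      intro u
      rw [norm_div, div_lt_one (norm_pos_iff.mpr (hne c hc u))]
      have h1 : ‖c - c'‖ < r := by
        have := hc'.2
        rwa [Metric.mem_ball, dist_comm, dist_eq_norm] at this
      refine h1.trans_le (not_lt.mp fun h2 => ?_)
      exact hball (by rwa [Metric.mem_ball, dist_eq_norm]) ⟨u, rfl⟩
    have hlim : Tendsto (fun t : ℂ => Complex.log (1 + (c - c') / (t - c))) (cocompact ℂ)
        (𝓝 0) := by
      have h1 : Tendsto (fun t : ℂ => 1 + (c - c') / (t - c)) (cocompact ℂ) (𝓝 1) := by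
        have := ((tendsto_inv_sub_pow c one_ne_zero).const_mul (c - c')).const_add 1
        simpa [div_eq_mul_inv] using this
      simpa using h1.clog (by simp)
    refine tendsto_integral_of_primitive
      (P := fun u => Complex.log (1 + (c - c') / (ρ u - c)))
      (fun u => ?_) (hcont2 c hc c' hc'.1) (hlim.comp h.tendsto_atTop) (hlim.comp h.tendsto_atBot)
    have h1 : HasDerivAt (fun u => 1 + (c - c') / (ρ u - c))
        ((0 * (ρ u - c) - (c - c') * deriv ρ u) / (ρ u - c) ^ 2) u :=
      (((hasDerivAt_const u (c - c')).div ((h.hasDerivAt u).sub_const c) (hne c hc u))).const_add 1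
    convert h1.clog_real (Complex.mem_slitPlane_of_norm_lt_one (hn u)) using 1
    have e1 := hne c hc u
    have e2 := hne c' hc'.1 u
    have e3 : 1 + (c - c') / (ρ u - c) = (ρ u - c') / (ρ u - c) := by field_simp; ring
    rw [e3]
    field_simp
    ring
  · intro x y w hx hy hw h1 h2
    have := h1.add h2
    rw [add_zero] at this
    refine this.congr fun T => ?_
    rw [← intervalIntegral.integral_add ((hcont2 x hx y hy).intervalIntegrable _ _)
      ((hcont2 y hy w hw).intervalIntegrable _ _)]
    congr 1
    funext u
    ring
  · intro x y _ _ h1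
    have := h1.neg
    rw [neg_zero] at this
    refine this.congr fun T => ?_
    rw [← intervalIntegral.integral_neg]
    congr 1
    funext u
    ring

/-- The functions `G` with `∫ (G(t + p) - G(t)) dt = 0` along the curve. -/
structure ShiftNull (ρ : ℝ → ℂ) (p : ℂ) (G : ℂ → ℂ) : Prop where
  cont : Continuous fun u => G (ρ u)
  cont_shift : Continuous fun u => G (ρ u + p)
  lim : Tendsto (fun T : ℝ => ∫ u in -T..T, (G (ρ u + p) - G (ρ u)) * deriv ρ u) atTop (𝓝 0)

theorem ShiftNull.add {ρ : ℝ → ℂ} (h : IsContour ρ) {p : ℂ} {G₁ G₂ : ℂ → ℂ}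
    (h₁ : ShiftNull ρ p G₁) (h₂ : ShiftNull ρ p G₂) : ShiftNull ρ p (G₁ + G₂) := by
  refine ⟨h₁.cont.add h₂.cont, h₁.cont_shift.add h₂.cont_shift, ?_⟩
  have := h₁.lim.add h₂.lim
  rw [add_zero] at this
  refine this.congr fun T => ?_
  have hi : ∀ {G : ℂ → ℂ}, ShiftNull ρ p G →
      IntervalIntegrable (fun u => (G (ρ u + p) - G (ρ u)) * deriv ρ u) volume (-T) T := fun hG =>
    ((hG.cont_shift.sub hG.cont).mul h.continuous_deriv).intervalIntegrable _ _
  rw [← intervalIntegral.integral_add (hi h₁) (hi h₂)]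
  congr 1
  funext u
  simp only [Pi.add_apply]
  ring

theorem ShiftNull.smul {ρ : ℝ → ℂ} {p : ℂ} {G : ℂ → ℂ} (c : ℂ) (hG : ShiftNull ρ p G) :
    ShiftNull ρ p (c • G) := by
  refine ⟨hG.cont.const_smul c, hG.cont_shift.const_smul c, ?_⟩
  have := hG.lim.const_mul c
  rw [mul_zero] at this
  refine this.congr fun T => ?_
  rw [← intervalIntegral.integral_const_mul]
  congr 1
  funext u
  simp only [Pi.smul_apply, smul_eq_mul]
  ring

/-- The span of the functions `1/(t - q)^k`, `k ≥ 1`, with `q` in the list. -/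
def polarParts (qs : List ℂ) : Submodule ℂ (ℂ → ℂ) :=
  Submodule.span ℂ {f | ∃ q ∈ qs, ∃ k : ℕ, f = fun t => ((t - q) ^ (k + 1))⁻¹}

theorem exists_polarParts_div_sub (q : ℂ) (qs : List ℂ) {R : ℂ → ℂ} (hR : R ∈ polarParts qs) :
    ∃ R' ∈ polarParts (q :: qs), ∀ t, (∀ x ∈ q :: qs, t ≠ x) → R t / (t - q) = R' t := by
  have hgen : ∀ x ∈ q :: qs, ∀ k : ℕ,
      (fun t : ℂ => ((t - x) ^ (k + 1))⁻¹) ∈ polarParts (q :: qs) :=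
    fun x hx k => Submodule.subset_span ⟨x, hx, k, rfl⟩
  induction hR using Submodule.span_induction with
  | mem f hf =>
    obtain ⟨x, hx, k, rfl⟩ := hf
    have hx' : x ∈ q :: qs := by simp [hx]
    have hq' : q ∈ q :: qs := by simp
    by_cases hxq : x = q
    · subst hxq
      refine ⟨_, hgen x hx' (k + 1), fun t ht => ?_⟩
      have : t - x ≠ 0 := sub_ne_zero.mpr (ht x hx')
      field_simp
      ring
    · have hxq' : x - q ≠ 0 := sub_ne_zero.mpr hxq
      have key : ∀ k : ℕ, ∃ R' ∈ polarParts (q :: qs), ∀ t, (∀ x ∈ q :: qs, t ≠ x) →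
          ((t - x) ^ k)⁻¹ / (t - q) = R' t := by
        intro k
        induction k with
        | zero => exact ⟨_, hgen q hq' 0, fun t _ => by simp⟩
        | succ k ih =>
          obtain ⟨R', hR', hR't⟩ := ih
          refine ⟨(x - q)⁻¹ • ((fun t : ℂ => ((t - x) ^ (k + 1))⁻¹) - R'),
            Submodule.smul_mem _ _ (Submodule.sub_mem _ (hgen x hx' k) hR'), fun t ht => ?_⟩
          have h1 : t - x ≠ 0 := sub_ne_zero.mpr (ht x hx')
          have h2 : t - q ≠ 0 := sub_ne_zero.mpr (ht q hq')
          simp only [Pi.smul_apply, Pi.sub_apply, smul_eq_mul, ← hR't t ht]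
          field_simp
          ring
      exact key (k + 1)
  | zero => exact ⟨0, Submodule.zero_mem _, fun t _ => by simp⟩
  | add f g _ _ hf hg =>
    obtain ⟨f', hf', hf't⟩ := hf
    obtain ⟨g', hg', hg't⟩ := hg
    refine ⟨f' + g', Submodule.add_mem _ hf' hg', fun t ht => ?_⟩
    rw [Pi.add_apply, Pi.add_apply, add_div, hf't t ht, hg't t ht]
  | smul c f _ hf =>
    obtain ⟨f', hf', hf't⟩ := hf
    refine ⟨c • f', Submodule.smul_mem _ _ hf', fun t ht => ?_⟩
    rw [Pi.smul_apply, Pi.smul_apply, smul_eq_mul, smul_eq_mul, mul_div_assoc, hf't t ht]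

/-- A meromorphic function with finitely many poles is the sum of its principal parts and of a
holomorphic function. -/
theorem exists_polarParts_add {U : Set ℂ} (hU : IsOpen U) {N : ℂ → ℂ}
    (hN : DifferentiableOn ℂ N U) (qs : List ℂ) :
    ∃ R ∈ polarParts qs, ∃ N' : ℂ → ℂ, DifferentiableOn ℂ N' U ∧
      ∀ t, (∀ q ∈ qs, t ≠ q) → N t / (qs.map (fun q => t - q)).prod = R t + N' t := by
  induction qs with
  | nil => exact ⟨0, Submodule.zero_mem _, N, hN, fun t _ => by simp⟩
  | cons q qs ih =>
    obtain ⟨R, hR, N', hN', h⟩ := ih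
    obtain ⟨R', hR', hR't⟩ := exists_polarParts_div_sub q qs hR
    have hdiv : ∀ t, (∀ x ∈ q :: qs, t ≠ x) →
        N t / ((q :: qs).map (fun q => t - q)).prod = R' t + N' t / (t - q) := fun t ht => by
      rw [List.map_cons, List.prod_cons, mul_comm, ← div_div, h t fun x hx => ht x (by simp [hx]),
        add_div, hR't t ht]
    by_cases hqU : q ∈ U
    · refine ⟨R' + N' q • fun t => ((t - q) ^ (0 + 1))⁻¹, Submodule.add_mem _ hR'
        (Submodule.smul_mem _ _ (Submodule.subset_span ⟨q, by simp, 0, rfl⟩)), dslope N' q,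
        (Complex.differentiableOn_dslope (hU.mem_nhds hqU)).mpr hN', fun t ht => ?_⟩
      have hq : t - q ≠ 0 := sub_ne_zero.mpr (ht q (by simp))
      rw [hdiv t ht, dslope_of_ne _ (ht q (by simp)), slope_def_field]
      simp only [Pi.add_apply, Pi.smul_apply, smul_eq_mul, zero_add, pow_one]
      field_simp
      ring
    · exact ⟨R', hR', fun t => N' t / (t - q), hN'.div (by fun_prop) fun t ht =>
        sub_ne_zero.mpr fun he => hqU (he ▸ ht), hdiv⟩

/-- The filter of the points of the strip swept by the curve on its way to its translate, close
to its ends. -/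
def sweepEnds : Filter (ℝ × ℝ) := cocompact ℝ ×ˢ 𝓟 (Set.Icc 0 1)

theorem tendsto_sweep {ρ : ℝ → ℂ} (h : IsContour ρ) (p : ℂ) :
    Tendsto (fun x : ℝ × ℝ => ρ x.1 + x.2 * p) sweepEnds (cocompact ℂ) := by
  rw [← Metric.cobounded_eq_cocompact, ← comap_norm_atTop, tendsto_comap_iff]
  have h1 : Tendsto (fun x : ℝ × ℝ => ‖ρ x.1‖ - ‖p‖) sweepEnds atTop :=
    tendsto_atTop_add_const_right _ _ (h.proper.comp tendsto_fst)
  refine tendsto_atTop_mono' _ ?_ h1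
  have : ∀ᶠ x : ℝ × ℝ in sweepEnds, x.2 ∈ Set.Icc (0 : ℝ) 1 :=
    tendsto_snd.eventually (mem_principal_self _)
  filter_upwards [this] with x hx
  have h2 : ‖(x.2 : ℂ) * p‖ ≤ ‖p‖ := by
    rw [norm_mul, Complex.norm_real, Real.norm_of_nonneg hx.1]
    exact mul_le_of_le_one_left (norm_nonneg _) hx.2
  have h3 : ‖ρ x.1‖ ≤ ‖ρ x.1 + x.2 * p‖ + ‖(x.2 : ℂ) * p‖ := by
    simpa using norm_sub_le (ρ x.1 + x.2 * p) (x.2 * p)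
  simp only [Function.comp_apply]
  linarith

theorem polarParts_tendsto {qs : List ℂ} {R : ℂ → ℂ} (hR : R ∈ polarParts qs) :
    Tendsto R (cocompact ℂ) (𝓝 0) := by
  induction hR using Submodule.span_induction with
  | mem f hf =>
    obtain ⟨q, _, k, rfl⟩ := hf
    exact tendsto_inv_sub_pow q (Nat.succ_ne_zero k)
  | zero => exact tendsto_const_nhds
  | add f g _ _ hf hg => rw [← add_zero (0 : ℂ)]; exact hf.add hg
  | smul c f _ hf => rw [← smul_zero c]; exact hf.const_smul c

theorem polarParts_shiftNull {ρ : ℝ → ℂ} (h : IsContour ρ) {p : ℂ} {qs : List ℂ}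
    (hqs : ∀ q ∈ qs, ∃ K ⊆ (Set.range ρ)ᶜ, IsPreconnected K ∧ q ∈ K ∧ q - p ∈ K) {R : ℂ → ℂ}
    (hR : R ∈ polarParts qs) : ShiftNull ρ p R := by
  induction hR using Submodule.span_induction with
  | mem f hf =>
    obtain ⟨q, hq, k, rfl⟩ := hf
    obtain ⟨K, hKρ, hK, hqK, hqpK⟩ := hqs q hq
    have e : ∀ u, ρ u + p - q = ρ u - (q - p) := fun u => by ring
    have hc : ∀ c ∈ K, Continuous fun u => ((ρ u - c) ^ (k + 1))⁻¹ := fun c hc =>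
      ((h.continuous.sub continuous_const).pow _).inv₀ fun u =>
        pow_ne_zero _ fun hu => hKρ hc ⟨u, sub_eq_zero.mp hu⟩
    refine ⟨hc q hqK, by simpa only [e] using hc _ hqpK, ?_⟩
    simp only [e]
    rcases Nat.eq_zero_or_pos k with rfl | hk
    · simpa using tendsto_integral_inv_sub_inv h hK hKρ hqK hqpK
    · have h1 := (tendsto_integral_inv_pow h (hKρ hqpK) hk.ne').sub
        (tendsto_integral_inv_pow h (hKρ hqK) hk.ne')
      rw [sub_zero] at h1
      refine h1.congr fun T => ?_
      have hi : ∀ c ∈ K, IntervalIntegrable (fun u => ((ρ u - c) ^ (k + 1))⁻¹ * deriv ρ u)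
          volume (-T) T := fun c hc' => ((hc c hc').mul h.continuous_deriv).intervalIntegrable _ _
      rw [← intervalIntegral.integral_sub (hi _ hqpK) (hi _ hqK)]
      congr 1
      funext u
      ring
  | zero => exact ⟨continuous_const, continuous_const, by simp⟩
  | add f g _ _ hf hg => exact hf.add h hg
  | smul c f _ hf => exact hf.smul c

/-- Cauchy's theorem for the strip swept by the curve, in the form of the divergence theorem. -/
theorem shiftNull_of_differentiableOn {ρ : ℝ → ℂ} (h : IsContour ρ) {p : ℂ} {U : Set ℂ}
    (hU : IsOpen U) {N : ℂ → ℂ} (hN : DifferentiableOn ℂ N U)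
    (hsweep : ∀ u : ℝ, ∀ s ∈ Set.Icc (0 : ℝ) 1, ρ u + s * p ∈ U)
    (hlim : Tendsto (fun x : ℝ × ℝ => N (ρ x.1 + x.2 * p)) sweepEnds (𝓝 0)) :
    ShiftNull ρ p N := by
  have hγ : Continuous fun x : ℝ × ℝ => ρ x.1 + x.2 * p :=
    (h.continuous.comp continuous_fst).add
      ((Complex.continuous_ofReal.comp continuous_snd).mul continuous_const)
  have hNγ : ContinuousOn (fun x : ℝ × ℝ => N (ρ x.1 + x.2 * p)) (Set.univ ×ˢ Set.Icc 0 1) :=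
    hN.continuousOn.comp hγ.continuousOn fun x hx => hsweep x.1 x.2 hx.2
  have hc : ∀ s ∈ Set.Icc (0 : ℝ) 1, Continuous fun u => N (ρ u + s * p) := by
    intro s hs
    rw [← continuousOn_univ]
    exact hNγ.comp (f := fun u : ℝ => (u, s)) (by fun_prop) fun u _ => ⟨trivial, hs⟩
  refine ⟨by simpa using hc 0 (by simp), by simpa using hc 1 (by simp), ?_⟩
  have hbox : ∀ T : ℝ, 0 ≤ T → ∫ u in -T..T, (N (ρ u + p) - N (ρ u)) * deriv ρ u =
      ∫ s in (0 : ℝ)..1, (p * N (ρ T + s * p) - p * N (ρ (-T) + s * p)) := by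
    intro T hT
    set γ' : ℝ × ℝ → ℝ × ℝ →L[ℝ] ℂ := fun x =>
      (ContinuousLinearMap.fst ℝ ℝ ℝ).smulRight (deriv ρ x.1) +
        (ContinuousLinearMap.snd ℝ ℝ ℝ).smulRight p with hγ'
    have hγd : ∀ x : ℝ × ℝ, HasFDerivAt (fun x : ℝ × ℝ => ρ x.1 + x.2 * p) (γ' x) x := by
      intro x
      have h1 : HasFDerivAt (fun x : ℝ × ℝ => ρ x.1)
          ((ContinuousLinearMap.fst ℝ ℝ ℝ).smulRight (deriv ρ x.1)) x := by
        have := (h.hasDerivAt x.1).hasFDerivAt.comp x (hasFDerivAt_fst (𝕜 := ℝ) (p := x))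
        exact this.congr_fderiv (by ext <;> simp)
      have h2 : HasFDerivAt (fun x : ℝ × ℝ => (x.2 : ℂ) * p)
          ((ContinuousLinearMap.snd ℝ ℝ ℝ).smulRight p) x := by
        have := ((ContinuousLinearMap.snd ℝ ℝ ℝ).smulRight p).hasFDerivAt (x := x)
        convert this using 1
        funext y
        simp
      exact h1.add h2
    have hNd : ∀ x ∈ Set.univ ×ˢ Set.Icc (0 : ℝ) 1,
        HasFDerivAt (fun x : ℝ × ℝ => N (ρ x.1 + x.2 * p))
          (deriv N (ρ x.1 + x.2 * p) • γ' x) x := by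
      intro x hx
      have h1 := (hN.differentiableAt (hU.mem_nhds (hsweep x.1 x.2 hx.2))).hasDerivAt
      exact h1.comp_hasFDerivAt_of_eq x (hγd x) rfl
    have hρ'd : ∀ x : ℝ × ℝ, HasFDerivAt (fun x : ℝ × ℝ => deriv ρ x.1)
        ((ContinuousLinearMap.fst ℝ ℝ ℝ).smulRight (deriv (deriv ρ) x.1)) x := by
      intro x
      have := ((h.differentiable_deriv x.1).hasDerivAt).hasFDerivAt.comp x
        (hasFDerivAt_fst (𝕜 := ℝ) (p := x))
      exact this.congr_fderiv (by ext <;> simp)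
    have hsub : Set.uIcc (-T) T ×ˢ Set.uIcc (0 : ℝ) 1 ⊆ Set.univ ×ˢ Set.Icc 0 1 := by
      rw [Set.uIcc_of_le zero_le_one]
      exact Set.prod_mono (Set.subset_univ _) subset_rfl
    have hsub' : Set.Ioo (min (-T) T) (max (-T) T) ×ˢ Set.Ioo (min (0 : ℝ) 1) (max 0 1) ⊆
        Set.univ ×ˢ Set.Icc 0 1 := by
      refine Set.prod_mono (Set.subset_univ _) ?_
      rw [min_eq_left zero_le_one, max_eq_right zero_le_one]
      exact Set.Ioo_subset_Icc_self
    obtain ⟨f', hf'⟩ : ∃ f' : ℝ × ℝ → ℝ × ℝ →L[ℝ] ℂ, f' = fun x =>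
        p • (deriv N (ρ x.1 + x.2 * p) • γ' x) := ⟨_, rfl⟩
    obtain ⟨g', hg'⟩ : ∃ g' : ℝ × ℝ → ℝ × ℝ →L[ℝ] ℂ, g' = fun x =>
        -(N (ρ x.1 + x.2 * p) • ((ContinuousLinearMap.fst ℝ ℝ ℝ).smulRight
          (deriv (deriv ρ) x.1)) + deriv ρ x.1 • (deriv N (ρ x.1 + x.2 * p) • γ' x)) := ⟨_, rfl⟩
    have hz : ∀ x : ℝ × ℝ, f' x (1, 0) + g' x (0, 1) = 0 := by
      intro x
      simp [hf', hg', hγ']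
      ring
    have key := integral2_divergence_prod_of_hasFDerivAt_off_countable
      (fun x : ℝ × ℝ => p * N (ρ x.1 + x.2 * p))
      (fun x : ℝ × ℝ => -(N (ρ x.1 + x.2 * p) * deriv ρ x.1))
      f' g' (-T) 0 T 1 ∅ Set.countable_empty
      (continuousOn_const.mul (hNγ.mono hsub))
      ((hNγ.mono hsub).mul (h.continuous_deriv.comp continuous_fst).continuousOn).neg
      (fun x hx => hf' ▸ (hNd x (hsub' hx.1)).const_mul p)
      (fun x hx => hg' ▸ ((hNd x (hsub' hx.1)).mul (hρ'd x)).neg)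
      (by simp only [hz]; exact integrableOn_zero)
    simp only [hz, intervalIntegral.integral_zero, intervalIntegral.integral_neg,
      Complex.ofReal_one, one_mul, Complex.ofReal_zero, zero_mul, add_zero] at key
    have hcs : ∀ u, IntervalIntegrable (fun s : ℝ => p * N (ρ u + s * p)) volume 0 1 := by
      intro u
      refine ContinuousOn.intervalIntegrable ?_
      rw [Set.uIcc_of_le zero_le_one]
      exact continuousOn_const.mul (hNγ.comp (f := fun s : ℝ => (u, s)) (by fun_prop)
        fun s hs => ⟨trivial, hs⟩)
    have hcu : ∀ s ∈ Set.Icc (0 : ℝ) 1,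
        IntervalIntegrable (fun u : ℝ => N (ρ u + s * p) * deriv ρ u) volume (-T) T := fun s hs =>
      ((hc s hs).mul h.continuous_deriv).intervalIntegrable _ _
    have e1 := hcu 1 (by simp)
    have e0 := hcu 0 (by simp)
    simp only [Complex.ofReal_one, one_mul, Complex.ofReal_zero, zero_mul, add_zero] at e1 e0
    rw [intervalIntegral.integral_sub (hcs _) (hcs _)]
    simp only [sub_mul]
    rw [intervalIntegral.integral_sub e1 e0]
    linear_combination key
  rw [Metric.tendsto_nhds]
  intro ε hε
  have hε' : 0 < ε / (2 * (‖p‖ + 1)) := by positivity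
  have h1 := (Metric.tendsto_nhds.mp hlim) _ hε'
  rw [sweepEnds, eventually_prod_principal_iff] at h1
  have h2 := h1.filter_mono atTop_le_cocompact
  have h3 := tendsto_neg_atTop_atBot.eventually (h1.filter_mono atBot_le_cocompact)
  filter_upwards [h2, h3, eventually_ge_atTop 0] with T hT hT' hT0
  rw [dist_zero_right, hbox T hT0]
  have hb : ∀ s ∈ Set.uIoc (0 : ℝ) 1,
      ‖p * N (ρ T + s * p) - p * N (ρ (-T) + s * p)‖ ≤
        ‖p‖ * (ε / (2 * (‖p‖ + 1)) + ε / (2 * (‖p‖ + 1))) := by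
    intro s hs
    rw [Set.uIoc_of_le zero_le_one] at hs
    have a1 := hT s (Set.Ioc_subset_Icc_self hs)
    have a2 := hT' s (Set.Ioc_subset_Icc_self hs)
    rw [dist_zero_right] at a1 a2
    rw [← mul_sub, norm_mul]
    exact mul_le_mul_of_nonneg_left ((norm_sub_le _ _).trans (add_le_add a1.le a2.le))
      (norm_nonneg _)
  have h4 := intervalIntegral.norm_integral_le_of_norm_le_const hb
  refine h4.trans_lt ?_
  have : ‖p‖ * (ε / (2 * (‖p‖ + 1)) + ε / (2 * (‖p‖ + 1))) * |(1 : ℝ) - 0| =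
      ε * (‖p‖ / (‖p‖ + 1)) := by
    rw [sub_zero, abs_one]
    field_simp
    ring
  rw [this]
  have h5 : ‖p‖ / (‖p‖ + 1) < 1 := by
    rw [div_lt_one (by positivity)]; linarith
  nlinarith

/-- The integrals of a function over the curve and over its translate by `p` are the same if each
pole `q` in the swept strip lies in the same component of the complement of the curve as
`q - p`. -/
theorem shiftNull_of_poles {ρ : ℝ → ℂ} (h : IsContour ρ) {p : ℂ} {U : Set ℂ}
    (hU : IsOpen U) {F N : ℂ → ℂ} (hN : DifferentiableOn ℂ N U)
    (hsweep : ∀ u : ℝ, ∀ s ∈ Set.Icc (0 : ℝ) 1, ρ u + s * p ∈ U)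
    (qs : List ℂ)
    (hqs : ∀ q ∈ qs, ∃ K ⊆ (Set.range ρ)ᶜ, IsPreconnected K ∧ q ∈ K ∧ q - p ∈ K)
    (hF : ∀ t ∈ U, (∀ q ∈ qs, t ≠ q) → F t = N t / (qs.map (fun q => t - q)).prod)
    (hlim : Tendsto (fun x : ℝ × ℝ => F (ρ x.1 + x.2 * p)) sweepEnds (𝓝 0)) :
    ShiftNull ρ p F := by
  obtain ⟨R, hR, N', hN', hRN⟩ := exists_polarParts_add hU hN qs
  have hRlim := (polarParts_tendsto hR).comp (tendsto_sweep h p)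
  have hfar : ∀ᶠ x : ℝ × ℝ in sweepEnds, ∀ q ∈ qs, ρ x.1 + x.2 * p ≠ q := by
    have h1 : ∀ᶠ t : ℂ in cocompact ℂ, t ∉ {q | q ∈ qs} :=
      (List.finite_toSet qs).isCompact.compl_mem_cocompact
    filter_upwards [(tendsto_sweep h p).eventually h1] with x hx q hq he
    exact hx (by rw [he]; exact hq)
  have hIcc : ∀ᶠ x : ℝ × ℝ in sweepEnds, x.2 ∈ Set.Icc (0 : ℝ) 1 :=
    tendsto_snd.eventually (mem_principal_self _)
  have h1 : ShiftNull ρ p N' := by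
    refine shiftNull_of_differentiableOn h hU hN' hsweep ?_
    have h2 := hlim.sub hRlim
    rw [sub_zero] at h2
    refine h2.congr' ?_
    filter_upwards [hfar, hIcc] with x hx hx2
    rw [hF _ (hsweep x.1 x.2 hx2) hx, hRN _ hx]
    simp
  have h2 := (polarParts_shiftNull h hqs hR).add h h1
  have e0 : ∀ u, F (ρ u) = (R + N') (ρ u) := by
    intro u
    have hu : ∀ q ∈ qs, ρ u ≠ q := by
      rintro q hq rfl
      obtain ⟨K, hK, -, hqK, -⟩ := hqs _ hq
      exact hK hqK ⟨u, rfl⟩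
    rw [hF _ (by simpa using hsweep u 0 (by simp)) hu, hRN _ hu]
    rfl
  have e1 : ∀ u, F (ρ u + p) = (R + N') (ρ u + p) := by
    intro u
    have hu : ∀ q ∈ qs, ρ u + p ≠ q := by
      rintro q hq hq'
      obtain ⟨K, hK, -, -, hqK⟩ := hqs _ hq
      exact hK hqK ⟨u, by rw [← hq']; ring⟩
    rw [hF _ (by simpa using hsweep u 1 (by simp)) hu, hRN _ hu]
    rfl
  refine ⟨?_, ?_, ?_⟩
  · simpa only [e0] using h2.cont
  · simpa only [e1] using h2.cont_shift
  · simpa only [e0, e1] using h2.lim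

/-! ### The kernel `Γ(x - 1/2) Γ(1 - x)` and its decay -/

/-- The ratio `Γ(x - 1/2)/Γ(x)` divided by `1 - e^{2πix}`, with the removable singularities
removed. -/
noncomputable def gammaKer (x : ℂ) : ℂ :=
  Gamma (x - 1 / 2) * Gamma (1 - x) * (exp (-(Real.pi * I * x)) * (I / (2 * Real.pi)))

theorem gamma_mul_gamma_mul_exp (s : ℂ) (hs : exp (2 * Real.pi * I * s) ≠ 1) :
    Gamma s * Gamma (1 - s) * (exp (-(Real.pi * I * s)) * (I / (2 * Real.pi))) =
      1 / (1 - exp (2 * Real.pi * I * s)) := by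
  have hpi : (Real.pi : ℂ) ≠ 0 := Complex.ofReal_ne_zero.mpr Real.pi_ne_zero
  have h1 : 1 - exp (2 * Real.pi * I * s) ≠ 0 := sub_ne_zero.mpr (Ne.symm hs)
  have he : exp (Real.pi * I * s) ≠ 0 := exp_ne_zero _
  have e2 : exp (2 * Real.pi * I * s) = exp (Real.pi * I * s) * exp (Real.pi * I * s) := by
    rw [← Complex.exp_add]; congr 1; ring
  have h2 : Complex.sin (Real.pi * s) =
      (1 - exp (2 * Real.pi * I * s)) * I / (2 * exp (Real.pi * I * s)) := by
    have := Complex.two_sin (Real.pi * s)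
    rw [show -(Real.pi * s : ℂ) * I = -(Real.pi * I * s) by ring,
      show (Real.pi * s : ℂ) * I = Real.pi * I * s by ring, Complex.exp_neg] at this
    rw [e2]
    field_simp
    field_simp at this
    linear_combination this
  rw [Complex.Gamma_mul_Gamma_one_sub, h2, Complex.exp_neg]
  field_simp

theorem gammaKer_eq_of_exp_ne_one {x : ℂ} (hx : exp (2 * Real.pi * I * x) ≠ 1) :
    Gamma (x - 1 / 2) / Gamma x / (1 - exp (2 * Real.pi * I * x)) = gammaKer x := by
  have hΓ : Gamma x ≠ 0 := by
    refine Complex.Gamma_ne_zero fun m hm => hx ?_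
    rw [hm, Complex.exp_eq_one_iff]
    exact ⟨-m, by push_cast; ring⟩
  have := gamma_mul_gamma_mul_exp x hx
  rw [gammaKer, ← mul_one_div, ← this]
  field_simp

theorem gammaKer_add_one {x : ℂ} (h0 : x ≠ 0) (h1 : x ≠ 1 / 2) :
    gammaKer (x + 1) = (x - 1 / 2) / x * gammaKer x := by
  have e1 : Gamma (x + 1 - 1 / 2) = (x - 1 / 2) * Gamma (x - 1 / 2) := by
    rw [← Complex.Gamma_add_one _ (sub_ne_zero.mpr h1)]; congr 1; ring
  have e2 : Gamma (1 - x) = -x * Gamma (1 - (x + 1)) := by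
    rw [show 1 - (x + 1) = -x by ring, ← Complex.Gamma_add_one _ (neg_ne_zero.mpr h0)]
    congr 1; ring
  have e3 : exp (-(Real.pi * I * (x + 1))) = -exp (-(Real.pi * I * x)) := by
    rw [show -(Real.pi * I * (x + 1)) = -(Real.pi * I * x) - Real.pi * I by ring,
      Complex.exp_sub_pi_mul_I]
  rw [gammaKer, gammaKer, e1, e2, e3]
  field_simp

/-- The reflection `x ↦ 3/2 - x`. -/
theorem gammaKer_reflect {x : ℂ} (hx : exp (2 * Real.pi * I * x) ≠ -1)
    (hΓ : Gamma (3 / 2 - x) ≠ 0) :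
    gammaKer x = -I * (Gamma (3 / 2 - x - 1 / 2) / Gamma (3 / 2 - x) *
      (1 / (1 + exp (2 * Real.pi * I * x)))) := by
  have e1 : exp (2 * Real.pi * I * (x - 1 / 2)) = -exp (2 * Real.pi * I * x) := by
    rw [show 2 * Real.pi * I * (x - 1 / 2) = 2 * Real.pi * I * x - Real.pi * I by ring,
      Complex.exp_sub_pi_mul_I]
  have e2 : exp (-(Real.pi * I * (x - 1 / 2))) = I * exp (-(Real.pi * I * x)) := by
    rw [show -(Real.pi * I * (x - 1 / 2)) = Real.pi / 2 * I + -(Real.pi * I * x) by ring,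
      Complex.exp_add, Complex.exp_pi_div_two_mul_I]
  have key := gamma_mul_gamma_mul_exp (x - 1 / 2) (by
    rw [e1]; exact fun h => hx (by rw [← neg_neg (exp _), h]))
  rw [e1, e2, show 1 - (x - 1 / 2) = 3 / 2 - x by ring, sub_neg_eq_add] at key
  rw [← key, gammaKer, show 3 / 2 - x - 1 / 2 = 1 - x by ring]
  generalize Gamma (3 / 2 - x) = G at hΓ
  field_simp
  rw [Complex.I_sq]
  ring

/-- `Γ(x - 1/2)/Γ(x)` is bounded for `Re x ≥ 1`, being a multiple of a beta integral. -/
theorem exists_norm_gamma_div_gamma_le :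
    ∃ K : ℝ, ∀ x : ℂ, 1 ≤ x.re → ‖Gamma (x - 1 / 2) / Gamma x‖ ≤ K := by
  set g : ℝ → ℝ := fun s => ‖(s : ℂ) ^ ((1 / 2 : ℂ) - 1) * (1 - (s : ℂ)) ^ ((1 / 2 : ℂ) - 1)‖
  have hg : IntervalIntegrable g volume 0 1 :=
    (Complex.betaIntegral_convergent (u := 1 / 2) (v := 1 / 2) (by norm_num) (by norm_num)).norm
  refine ⟨(∫ s in (0 : ℝ)..1, g s) / ‖Gamma (1 / 2)‖, fun x hx => ?_⟩
  have hhalf : Gamma (1 / 2) ≠ 0 := Complex.Gamma_ne_zero_of_re_pos (by norm_num)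
  have hΓ : Gamma x ≠ 0 := Complex.Gamma_ne_zero_of_re_pos (by linarith)
  have h1 := Complex.Gamma_mul_Gamma_eq_betaIntegral (s := x - 1 / 2) (t := 1 / 2)
    (by norm_num; linarith) (by norm_num)
  rw [sub_add_cancel] at h1
  have h2 : Gamma (x - 1 / 2) / Gamma x = (x - 1 / 2).betaIntegral (1 / 2) / Gamma (1 / 2) := by
    rw [div_eq_div_iff hΓ hhalf, h1]; ring
  rw [h2, norm_div]
  refine div_le_div_of_nonneg_right ?_ (norm_nonneg _)
  refine intervalIntegral.norm_integral_le_of_norm_le zero_le_one ?_ hg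
  refine Filter.Eventually.of_forall fun s hs => ?_
  simp only [g, norm_mul]
  refine mul_le_mul_of_nonneg_right ?_ (norm_nonneg _)
  rw [Complex.norm_cpow_eq_rpow_re_of_pos hs.1, Complex.norm_cpow_eq_rpow_re_of_pos hs.1]
  refine Real.rpow_le_rpow_of_exponent_ge hs.1 hs.2 ?_
  norm_num
  linarith

theorem norm_exp_two_pi_I_mul (x : ℂ) :
    ‖exp (2 * Real.pi * I * x)‖ = Real.exp (-(2 * Real.pi * x.im)) := by
  rw [Complex.norm_exp]
  congr 1
  simp

/-- The bound for `1/(1 ± e^{2πix})`. -/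
theorem norm_one_div_le {w : ℂ} {y : ℝ} (hw : ‖w‖ = Real.exp (-(2 * Real.pi * y)))
    (hy : 1 ≤ |y|) : w ≠ -1 ∧ ‖1 / (1 + w)‖ ≤ 2 * min 1 (Real.exp (2 * Real.pi * y)) := by
  have hpi := Real.pi_gt_three
  have h2 : (2 : ℝ) ≤ Real.exp 1 := by have := Real.add_one_le_exp (1 : ℝ); linarith
  rcases le_abs'.mp hy with h | h
  · -- here `|w| ≥ 2`
    have hw2 : 2 ≤ ‖w‖ := by
      rw [hw]
      refine h2.trans (Real.exp_le_exp.mpr ?_)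
      nlinarith
    have h3 : ‖w‖ / 2 ≤ ‖1 + w‖ := by
      have := norm_sub_norm_le w (-1)
      rw [sub_neg_eq_add, add_comm w, norm_neg, norm_one] at this
      linarith
    refine ⟨fun h => by rw [h] at hw2; norm_num at hw2, ?_⟩
    rw [min_eq_right (Real.exp_le_one_iff.mpr (by nlinarith)), norm_div, norm_one]
    have h4 : Real.exp (2 * Real.pi * y) = ‖w‖⁻¹ := by rw [hw, ← Real.exp_neg, neg_neg]
    rw [h4, div_le_iff₀ (by linarith)]
    calc (1 : ℝ) = 2 * ‖w‖⁻¹ * (‖w‖ / 2) := by field_simp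
      _ ≤ 2 * ‖w‖⁻¹ * ‖1 + w‖ := by gcongr
  · have hw2 : ‖w‖ ≤ 1 / 2 := by
      rw [hw, Real.exp_neg, one_div]
      refine inv_anti₀ two_pos (h2.trans (Real.exp_le_exp.mpr ?_))
      nlinarith
    have h3 : 1 / 2 ≤ ‖1 + w‖ := by
      have := norm_sub_norm_le 1 (-w)
      rw [sub_neg_eq_add, norm_neg, norm_one] at this
      linarith
    refine ⟨fun h => by rw [h] at hw2; norm_num at hw2, ?_⟩
    rw [min_eq_left (Real.one_le_exp (by nlinarith)), norm_div, norm_one,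
      div_le_iff₀ (by linarith)]
    linarith

theorem exists_norm_gammaKer_le :
    ∃ K : ℝ, 0 ≤ K ∧ ∀ x : ℂ, 1 ≤ |x.im| →
      ‖gammaKer x‖ ≤ K * min 1 (Real.exp (2 * Real.pi * x.im)) := by
  obtain ⟨K, hK⟩ := exists_norm_gamma_div_gamma_le
  have hK0 : 0 ≤ K := (norm_nonneg _).trans (hK 1 (by norm_num))
  have hright : ∀ x : ℂ, 1 ≤ |x.im| → 1 ≤ x.re →
      ‖gammaKer x‖ ≤ K * (2 * min 1 (Real.exp (2 * Real.pi * x.im))) := by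
    intro x hx hre
    obtain ⟨h1, h2⟩ := norm_one_div_le (w := -exp (2 * Real.pi * I * x))
      (by rw [norm_neg, norm_exp_two_pi_I_mul]) hx
    rw [← sub_eq_add_neg] at h2
    rw [← gammaKer_eq_of_exp_ne_one (fun h => h1 (by rw [h])), ← mul_one_div, norm_mul]
    exact mul_le_mul (hK x hre) h2 (norm_nonneg _) hK0
  refine ⟨K * 2 * 2, by positivity, fun x hx => ?_⟩
  have hm : 0 ≤ min 1 (Real.exp (2 * Real.pi * x.im)) := le_min zero_le_one (Real.exp_pos _).le
  have hne : ∀ c : ℝ, x ≠ c := by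
    rintro c rfl
    simp at hx
    linarith
  rcases le_or_gt 1 x.re with hre | hre
  · refine (hright x hx hre).trans ?_
    nlinarith [mul_nonneg hK0 hm]
  · rcases le_or_gt x.re (1 / 2) with hre' | hre'
    · obtain ⟨h1, h2⟩ := norm_one_div_le (w := exp (2 * Real.pi * I * x))
        (norm_exp_two_pi_I_mul x) hx
      have hre3 : 1 ≤ (3 / 2 - x).re := by norm_num; linarith
      rw [gammaKer_reflect h1 (Complex.Gamma_ne_zero_of_re_pos (by linarith)), norm_mul, norm_mul,
        norm_neg, Complex.norm_I, one_mul]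
      refine (mul_le_mul (hK _ hre3) h2 (norm_nonneg _) hK0).trans ?_
      nlinarith [mul_nonneg hK0 hm]
    · have h0 : x ≠ 0 := by exact_mod_cast hne 0
      have h12 : x ≠ 1 / 2 := by have := hne (1 / 2); push_cast at this; exact this
      have h12' : x - 1 / 2 ≠ 0 := sub_ne_zero.mpr h12
      have e : gammaKer x = x / (x - 1 / 2) * gammaKer (x + 1) := by
        rw [gammaKer_add_one h0 h12]
        generalize x - 1 / 2 = d at h12'
        field_simp
      have h3 := hright (x + 1) (by simpa using hx) (by simp; linarith)
      have h4 : ‖x / (x - 1 / 2)‖ ≤ 2 := by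
        have him : 1 ≤ ‖x - 1 / 2‖ := by
          refine hx.trans ?_
          simpa using Complex.abs_im_le_norm (x - 1 / 2)
        rw [norm_div, div_le_iff₀ (by linarith)]
        have := norm_add_le (x - 1 / 2) (1 / 2)
        rw [sub_add_cancel] at this
        have h5 : ‖(1 / 2 : ℂ)‖ = 1 / 2 := by norm_num
        linarith
      rw [e, norm_mul]
      have h6 := mul_le_mul h4 h3 (norm_nonneg _) zero_le_two
      simp only [Complex.add_im, Complex.one_im, add_zero] at h6
      linarith

/-- The kernel `∏_m Γ(x_m - 1/2)/Γ(x_m) ⋅ e^{2πikt/p} / ∏_m (1 - e^{2πi x_m})`,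
`x_m = (t - z_m)/p`, with the removable singularities removed. -/
noncomputable def kerG {n : ℕ} (p : ℂ) (z : Fin n → ℂ) (k : ℕ) (t : ℂ) : ℂ :=
  ex p t ^ k * ∏ m, gammaKer ((t - z m) / p)

theorem norm_ex (p t : ℂ) : ‖ex p t‖ = Real.exp (-(2 * Real.pi * (t / p).im)) := by
  rw [ex, mul_div_assoc, norm_exp_two_pi_I_mul]

/-- `kerG` is bounded where `Im(t/p) → +∞` and decays as `e^{-2πit/p}` where
`Im(t/p) → -∞`. -/
theorem exists_norm_kerG_le {n : ℕ} (p : ℂ) (z : Fin n → ℂ) {k : ℕ} (hk : k < n) :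
    ∃ K B : ℝ, 0 ≤ K ∧ ∀ t : ℂ, B ≤ |(t / p).im| →
      ‖kerG p z k t‖ ≤ K * min 1 (Real.exp (2 * Real.pi * (t / p).im)) := by
  obtain ⟨K, hK0, hK⟩ := exists_norm_gammaKer_le
  set Z : ℝ := ∑ m, |(z m / p).im| with hZ
  have hZm : ∀ m, |(z m / p).im| ≤ Z := fun m =>
    Finset.single_le_sum (f := fun m => |(z m / p).im|) (fun _ _ => abs_nonneg _)
      (Finset.mem_univ m)
  have hZ0 : 0 ≤ Z := Finset.sum_nonneg fun _ _ => abs_nonneg _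
  have hpi := Real.pi_gt_three
  refine ⟨(K * Real.exp (2 * Real.pi * Z)) ^ n, 1 + Z, by positivity, fun t ht => ?_⟩
  set y := (t / p).im with hy
  have him : ∀ m, ((t - z m) / p).im = y - (z m / p).im := fun m => by rw [sub_div, sub_im]
  have hfac : ∀ m, ‖gammaKer ((t - z m) / p)‖ ≤
      K * Real.exp (2 * Real.pi * Z) * min 1 (Real.exp (2 * Real.pi * y)) := by
    intro m
    have h1 : 1 ≤ |((t - z m) / p).im| := by
      rw [him]
      have := abs_sub_abs_le_abs_sub y (z m / p).im
      have := hZm m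
      linarith
    refine (hK _ h1).trans ?_
    rw [mul_assoc K]
    refine mul_le_mul_of_nonneg_left ?_ hK0
    rw [mul_min_of_nonneg _ _ (Real.exp_pos _).le, mul_one, ← Real.exp_add]
    refine min_le_min (Real.one_le_exp (by positivity)) (Real.exp_le_exp.mpr ?_)
    rw [him]
    have := (abs_le.mp (hZm m)).1
    nlinarith
  have hprod : ‖∏ m, gammaKer ((t - z m) / p)‖ ≤
      (K * Real.exp (2 * Real.pi * Z)) ^ n * min 1 (Real.exp (2 * Real.pi * y)) ^ n := by
    rw [norm_prod]
    refine (Finset.prod_le_prod (fun _ _ => norm_nonneg _) fun m _ => hfac m).trans ?_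
    rw [Finset.prod_const, Finset.card_univ, Fintype.card_fin, mul_pow]
  rw [kerG, norm_mul, norm_pow, norm_ex]
  have hmin : Real.exp (-(2 * Real.pi * y)) ^ k * min 1 (Real.exp (2 * Real.pi * y)) ^ n ≤
      min 1 (Real.exp (2 * Real.pi * y)) := by
    rcases le_total 0 y with h | h
    · have h1 : 1 ≤ Real.exp (2 * Real.pi * y) := Real.one_le_exp (by positivity)
      rw [min_eq_left h1, one_pow, mul_one]
      exact pow_le_one₀ (Real.exp_pos _).le (Real.exp_le_one_iff.mpr (by nlinarith))
    · have h1 : Real.exp (2 * Real.pi * y) ≤ 1 := Real.exp_le_one_iff.mpr (by nlinarith)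
      obtain ⟨j, rfl⟩ := Nat.exists_eq_add_of_lt hk
      rw [min_eq_right h1, show k + j + 1 = k + (j + 1) by ring, pow_add, ← mul_assoc, ← mul_pow,
        ← Real.exp_add, neg_add_cancel, Real.exp_zero, one_pow, one_mul, pow_succ]
      exact mul_le_of_le_one_left (Real.exp_pos _).le (pow_le_one₀ (Real.exp_pos _).le h1)
  calc Real.exp (-(2 * Real.pi * y)) ^ k * ‖∏ m, gammaKer ((t - z m) / p)‖
      ≤ Real.exp (-(2 * Real.pi * y)) ^ k *
        ((K * Real.exp (2 * Real.pi * Z)) ^ n * min 1 (Real.exp (2 * Real.pi * y)) ^ n) := by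
        gcongr
    _ = (K * Real.exp (2 * Real.pi * Z)) ^ n *
        (Real.exp (-(2 * Real.pi * y)) ^ k * min 1 (Real.exp (2 * Real.pi * y)) ^ n) := by ring
    _ ≤ _ := by gcongr

theorem kerG_add {n : ℕ} {p : ℂ} (hp : p ≠ 0) (z : Fin n → ℂ) (k : ℕ) {t : ℂ}
    (h0 : ∀ m, t ≠ z m) (h1 : ∀ m, t ≠ z m + p / 2) :
    kerG p z k (t + p) = xFun (p / 2) z n t * kerG p z k t := by
  have hex : ex p (t + p) = ex p t := by
    rw [ex, ex, mul_add, add_div, mul_div_cancel_right₀ _ hp, Complex.exp_add,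
      Complex.exp_two_pi_mul_I, mul_one]
  have hx : xFun (p / 2) z n t = ∏ m, (t - z m - p / 2) / (t - z m) := by
    rw [xFun, Finset.filter_true_of_mem fun m _ => m.2]
  rw [kerG, kerG, hex, hx, mul_left_comm, ← Finset.prod_mul_distrib]
  congr 1
  refine Finset.prod_congr rfl fun m _ => ?_
  have ht : t - z m ≠ 0 := sub_ne_zero.mpr (h0 m)
  rw [show (t + p - z m) / p = (t - z m) / p + 1 by field_simp; ring, gammaKer_add_one]
  · congr 1
    field_simp
  · exact div_ne_zero ht hp
  · intro h
    apply h1 m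
    field_simp at h
    linear_combination h / 2

/-! ### One-dimensional integrals over the contour -/

theorem integrable_exp_neg_mul_abs {δ : ℝ} (hδ : 0 < δ) :
    Integrable fun u : ℝ => Real.exp (-(δ * |u|)) := by
  rw [← integrableOn_univ, ← Set.Iic_union_Ioi (a := (0 : ℝ)), integrableOn_union]
  constructor
  · refine (integrableOn_exp_mul_Iic hδ 0).congr_fun (fun u hu => ?_) measurableSet_Iic
    simp only [abs_of_nonpos (show u ≤ 0 from hu)]
    ring_nf
  · refine (integrableOn_exp_mul_Ioi (neg_neg_of_pos hδ) 0).congr_fun (fun u hu => ?_)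
      measurableSet_Ioi
    simp only [abs_of_pos (show 0 < u from hu)]
    ring_nf

/-- A function whose derivative tends to `α` is asymptotic to `u α`. -/
theorem eventually_norm_sub_smul_le {f f' : ℝ → ℂ} (hf : ∀ u, HasDerivAt f (f' u) u) {α : ℂ}
    (hα : Tendsto f' atTop (𝓝 α)) {ε : ℝ} (hε : 0 < ε) :
    ∀ᶠ u : ℝ in atTop, ‖f u - u * α‖ ≤ ε * u := by
  have h1 : ∀ᶠ u in atTop, ‖f' u - α‖ ≤ ε / 2 := by
    filter_upwards [Metric.tendsto_nhds.mp hα (ε / 2) (half_pos hε)] with u hu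
    rw [← dist_eq_norm]
    exact hu.le
  obtain ⟨a, ha⟩ := eventually_atTop.mp h1
  have hg : ∀ u : ℝ, HasDerivAt (fun u : ℝ => f u - u * α) (f' u - α) u := fun u => by
    have := (hf u).sub ((Complex.ofRealCLM.hasDerivAt (x := u)).mul_const α)
    exact HasDerivAt.congr_deriv (f := fun u : ℝ => f u - u * α) this (by simp)
  filter_upwards [eventually_ge_atTop a, eventually_ge_atTop 0,
    eventually_ge_atTop (2 / ε * (‖f a - a * α‖ + ε / 2 * |a|))] with u hu hu0 hu2
  have h2 := (convex_Ici a).norm_image_sub_le_of_norm_hasDerivWithin_le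
    (f := fun u : ℝ => f u - u * α) (fun x _ => (hg x).hasDerivWithinAt) (fun x hx => ha x hx)
    (Set.self_mem_Ici) (show u ∈ Set.Ici a from hu)
  have h3 : ‖f u - u * α‖ ≤ ‖f a - a * α‖ + ε / 2 * |u - a| := by
    have := norm_sub_norm_le (f u - u * α) (f a - a * α)
    rw [Real.norm_eq_abs] at h2
    linarith
  have h4 : |u - a| ≤ u + |a| := by
    rw [abs_of_nonneg (sub_nonneg.mpr hu)]
    linarith [neg_abs_le a]
  have h5 : ‖f a - a * α‖ + ε / 2 * |a| ≤ ε / 2 * u := by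
    have := mul_le_mul_of_nonneg_left hu2 (half_pos hε).le
    field_simp at this ⊢
    linarith
  nlinarith

theorem exists_re_mul_le {f f' : ℝ → ℂ} (hf : ∀ u, HasDerivAt f (f' u) u) {α : ℂ}
    (hα : Tendsto f' atTop (𝓝 α)) {c : ℂ} (hc : (c * α).re < 0) :
    ∃ δ : ℝ, 0 < δ ∧ ∀ᶠ u : ℝ in atTop, (c * f u).re ≤ -(δ * u) := by
  set δ := -(c * α).re / 2 with hδ
  have hδ0 : 0 < δ := by rw [hδ]; linarith
  refine ⟨δ, hδ0, ?_⟩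
  have hε : 0 < δ / (‖c‖ + 1) := by positivity
  filter_upwards [eventually_norm_sub_smul_le hf hα hε, eventually_ge_atTop 0] with u hu hu0
  have h1 : (c * f u).re = u * (c * α).re + (c * (f u - u * α)).re := by
    rw [← Complex.re_ofReal_mul, ← Complex.add_re]; congr 1; ring
  have h2 : (c * (f u - u * α)).re ≤ ‖c‖ * (δ / (‖c‖ + 1) * u) := by
    refine (Complex.re_le_norm _).trans ?_
    rw [norm_mul]
    gcongr
  have h3 : ‖c‖ * (δ / (‖c‖ + 1) * u) ≤ δ * u := by
    have h4 : ‖c‖ / (‖c‖ + 1) ≤ 1 := by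
      rw [div_le_one (by positivity)]; linarith
    calc ‖c‖ * (δ / (‖c‖ + 1) * u) = ‖c‖ / (‖c‖ + 1) * (δ * u) := by ring
      _ ≤ 1 * (δ * u) := by gcongr
      _ = δ * u := one_mul _
  have h5 : (c * α).re = -(2 * δ) := by rw [hδ]; ring
  rw [h1, h5]
  linarith

theorem eventually_cocompact_of_atTop {P : ℝ → Prop} (h1 : ∀ᶠ u in atTop, P u)
    (h2 : ∀ᶠ u in atTop, P (-u)) : ∀ᶠ u in cocompact ℝ, P u := by
  rw [cocompact_eq_atBot_atTop, eventually_sup]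
  refine ⟨?_, h1⟩
  have := tendsto_neg_atBot_atTop.eventually h2
  simpa using this

/-- Continuous functions on the line growing slower than any exponential. -/
structure SlowGrowth (f : ℝ → ℂ) : Prop where
  cont : Continuous f
  bound : ∀ ε : ℝ, 0 < ε → f =O[cocompact ℝ] fun u => Real.exp (ε * |u|)

namespace SlowGrowth

theorem of_isBigO_one {f : ℝ → ℂ} (hf : Continuous f) (h : f =O[cocompact ℝ] fun _ => (1 : ℝ)) :
    SlowGrowth f := by
  refine ⟨hf, fun ε hε => h.trans (Asymptotics.IsBigO.of_bound 1 (Eventually.of_forall fun u => ?_))⟩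
  rw [norm_one, one_mul, Real.norm_of_nonneg (Real.exp_pos _).le]
  exact Real.one_le_exp (by positivity)

theorem const (c : ℂ) : SlowGrowth fun _ => c :=
  of_isBigO_one continuous_const (Asymptotics.isBigO_const_const _ one_ne_zero _)

theorem add {f g : ℝ → ℂ} (hf : SlowGrowth f) (hg : SlowGrowth g) :
    SlowGrowth fun u => f u + g u :=
  ⟨hf.cont.add hg.cont, fun ε hε => (hf.bound ε hε).add (hg.bound ε hε)⟩

theorem mul {f g : ℝ → ℂ} (hf : SlowGrowth f) (hg : SlowGrowth g) :
    SlowGrowth fun u => f u * g u := by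
  refine ⟨hf.cont.mul hg.cont, fun ε hε => ?_⟩
  refine ((hf.bound _ (half_pos hε)).mul (hg.bound _ (half_pos hε))).congr_right fun u => ?_
  rw [← Real.exp_add]
  ring_nf

theorem pow {f : ℝ → ℂ} (hf : SlowGrowth f) (j : ℕ) : SlowGrowth fun u => f u ^ j := by
  induction j with
  | zero => simpa using const 1
  | succ j ih => simpa only [pow_succ] using ih.mul hf

theorem sub_const {f : ℝ → ℂ} (hf : SlowGrowth f) (c : ℂ) : SlowGrowth fun u => f u - c := by
  simpa only [sub_eq_add_neg] using hf.add (const (-c))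

theorem prod {ι : Type*} (s : Finset ι) {f : ι → ℝ → ℂ} (hf : ∀ i ∈ s, SlowGrowth (f i)) :
    SlowGrowth fun u => ∏ i ∈ s, f i u := by
  classical
  induction s using Finset.induction_on with
  | empty => simpa using const 1
  | insert i s hi ih =>
    simp only [Finset.prod_insert hi]
    exact (hf i (by simp)).mul (ih fun j hj => hf j (by simp [hj]))

end SlowGrowth

section

variable {n : ℕ} {ħ p : ℂ} {z : Fin n → ℂ} (C : Contour ħ p z)

namespace Contour

theorem hasDerivAt_neg (u : ℝ) : HasDerivAt (fun u => C.ρ (-u)) (-deriv C.ρ (-u)) u := by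
  have := (C.isContour.hasDerivAt (-u)).scomp u (_root_.hasDerivAt_neg u)
  exact HasDerivAt.congr_deriv (f := fun u => C.ρ (-u)) this (by simp)

theorem tendsto_deriv_neg : Tendsto (fun u => -deriv C.ρ (-u)) atTop (𝓝 (-C.αBot)) :=
  (C.deriv_bot.comp tendsto_neg_atTop_atBot).neg

theorem exists_norm_le : ∃ K : ℝ, 0 < K ∧ ∀ᶠ u in cocompact ℝ, ‖C.ρ u‖ ≤ K * |u| := by
  refine ⟨‖C.αTop‖ + ‖C.αBot‖ + 1, by positivity, eventually_cocompact_of_atTop ?_ ?_⟩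
  · filter_upwards [eventually_norm_sub_smul_le C.isContour.hasDerivAt C.deriv_top one_pos,
      eventually_ge_atTop 0] with u hu hu0
    have h1 := norm_add_le (C.ρ u - u * C.αTop) (u * C.αTop)
    rw [sub_add_cancel, norm_mul, Complex.norm_real, Real.norm_of_nonneg hu0] at h1
    rw [abs_of_nonneg hu0]
    nlinarith [mul_nonneg hu0 (norm_nonneg C.αBot)]
  · filter_upwards [eventually_norm_sub_smul_le C.hasDerivAt_neg C.tendsto_deriv_neg one_pos,
      eventually_ge_atTop 0] with u hu hu0
    have h1 := norm_add_le (C.ρ (-u) - u * -C.αBot) (u * -C.αBot)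
    rw [sub_add_cancel, norm_mul, norm_neg, Complex.norm_real, Real.norm_of_nonneg hu0] at h1
    rw [abs_neg, abs_of_nonneg hu0]
    nlinarith [mul_nonneg hu0 (norm_nonneg C.αTop)]

theorem slowGrowth : SlowGrowth C.ρ := by
  refine ⟨C.isContour.continuous, fun ε hε => ?_⟩
  obtain ⟨K, hK, h⟩ := C.exists_norm_le
  refine Asymptotics.IsBigO.of_bound (K / ε) (h.mono fun u hu => hu.trans ?_)
  rw [Real.norm_of_nonneg (Real.exp_pos _).le]
  have := Real.add_one_le_exp (ε * |u|)
  calc K * |u| = K / ε * (ε * |u|) := by field_simp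
    _ ≤ K / ε * Real.exp (ε * |u|) := by gcongr; linarith

theorem slowGrowth_deriv : SlowGrowth (deriv C.ρ) := by
  refine SlowGrowth.of_isBigO_one C.isContour.continuous_deriv ?_
  rw [cocompact_eq_atBot_atTop]
  exact (C.deriv_bot.isBigO_one ℝ).sup (C.deriv_top.isBigO_one ℝ)

theorem slowGrowth_inv {c : ℂ} (hc : c ∉ Set.range C.ρ) : SlowGrowth fun u => (C.ρ u - c)⁻¹ := by
  refine SlowGrowth.of_isBigO_one ((C.isContour.continuous.sub continuous_const).inv₀ fun u hu =>
    hc ⟨u, sub_eq_zero.mp hu⟩) ?_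
  have := (tendsto_inv_sub_pow c one_ne_zero).comp C.isContour.tendsto_cocompact
  simpa [Function.comp_def] using this.isBigO_one ℝ

theorem notMem_of_left (m : Fin n) (j : ℕ) : z m + ħ - p * j ∉ Set.range C.ρ := by
  obtain ⟨a, b, ha, -, -⟩ := C.separates
  exact connectedComponentIn_subset _ _ (ha ⟨m, j, rfl⟩)

theorem notMem_of_right (m : Fin n) (j : ℕ) : z m + p * j ∉ Set.range C.ρ := by
  obtain ⟨a, b, -, hb, -⟩ := C.separates
  exact connectedComponentIn_subset _ _ (hb ⟨m, j, rfl⟩)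

theorem ne_z (u : ℝ) (m : Fin n) : C.ρ u ≠ z m := fun h =>
  C.notMem_of_right m 0 ⟨u, by rw [h]; simp⟩

/-- The function `e^{μt/p} kerG(t)` decays exponentially at the ends of the contour, uniformly on
the strip between the contour and its translate by `p`. -/
theorem exists_decay (hp0 : p ≠ 0) {μ : ℂ} (hμ : μ ∈ C.decay) {k : ℕ} (hk : k < n) :
    ∃ δ K : ℝ, 0 < δ ∧ ∀ᶠ u in cocompact ℝ, ∀ s ∈ Set.Icc (0 : ℝ) 1,
      ‖exp (μ * (C.ρ u + s * p) / p) * kerG p z k (C.ρ u + s * p)‖ ≤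
        K * Real.exp (-(δ * |u|)) := by
  obtain ⟨K, B, hK0, hK⟩ := exists_norm_kerG_le p z hk
  obtain ⟨-, -, htop, hbot⟩ := hμ
  have him : ∀ (t : ℂ) (s : ℝ), ((t + s * p) / p).im = (t / p).im := by
    intro t s
    rw [add_div, mul_div_cancel_right₀ _ hp0]
    simp
  have hre : ∀ (t : ℂ), ∀ s ∈ Set.Icc (0 : ℝ) 1,
      ‖exp (μ * (t + s * p) / p)‖ ≤ Real.exp |μ.re| * Real.exp (μ / p * t).re := by
    intro t s hs
    rw [show μ * (t + s * p) / p = s * μ + μ / p * t by field_simp; ring, Complex.norm_exp,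
      Complex.add_re, Real.exp_add, Complex.re_ofReal_mul]
    have : s * μ.re ≤ |μ.re| := (le_abs_self _).trans (by
      rw [abs_mul, abs_of_nonneg hs.1]
      exact mul_le_of_le_one_left (abs_nonneg _) hs.2)
    gcongr
  obtain ⟨δ₁, hδ₁, h₁⟩ := exists_re_mul_le C.isContour.hasDerivAt C.deriv_top (c := μ / p)
    (by rwa [div_mul_eq_mul_div, mul_div_assoc])
  obtain ⟨δ₂, hδ₂, h₂⟩ := exists_re_mul_le C.isContour.hasDerivAt C.deriv_top (c := I / p)
    (by rw [div_mul_eq_mul_div, mul_div_assoc, Complex.I_mul_re]; linarith [C.im_top])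
  obtain ⟨δ₃, hδ₃, h₃⟩ := exists_re_mul_le C.hasDerivAt_neg C.tendsto_deriv_neg
    (c := (μ - 2 * Real.pi * I) / p)
    (by rw [mul_neg, div_mul_eq_mul_div, mul_div_assoc, Complex.neg_re]; linarith)
  obtain ⟨δ₄, hδ₄, h₄⟩ := exists_re_mul_le C.hasDerivAt_neg C.tendsto_deriv_neg (c := -I / p)
    (by
      rw [mul_neg, neg_div, neg_mul, neg_neg, div_mul_eq_mul_div, mul_div_assoc,
        Complex.I_mul_re]
      linarith [C.im_bot])
  refine ⟨min δ₁ δ₃, Real.exp |μ.re| * K, lt_min hδ₁ hδ₃, eventually_cocompact_of_atTop ?_ ?_⟩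
  · filter_upwards [h₁, h₂, eventually_ge_atTop 0, eventually_ge_atTop (|B| / δ₂)]
      with u a1 a2 hu hB s hs
    rw [div_mul_eq_mul_div, mul_div_assoc, Complex.I_mul_re] at a2
    have hB' : |B| ≤ δ₂ * u := by rwa [div_le_iff₀' hδ₂] at hB
    have hy : B ≤ |((C.ρ u + s * p) / p).im| := by
      rw [him]
      exact (le_abs_self B).trans (hB'.trans ((by linarith : δ₂ * u ≤ (C.ρ u / p).im).trans
        (le_abs_self _)))
    rw [norm_mul, abs_of_nonneg hu]
    have h5 := (hK _ hy).trans (mul_le_of_le_one_right hK0 (min_le_left _ _))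
    have h6 : Real.exp (μ / p * C.ρ u).re ≤ Real.exp (-(min δ₁ δ₃ * u)) := by
      refine Real.exp_le_exp.mpr (a1.trans ?_)
      have := mul_le_mul_of_nonneg_right (min_le_left δ₁ δ₃) hu
      linarith
    calc _ ≤ Real.exp |μ.re| * Real.exp (μ / p * C.ρ u).re * K :=
          mul_le_mul (hre _ s hs) h5 (norm_nonneg _) (by positivity)
      _ ≤ Real.exp |μ.re| * Real.exp (-(min δ₁ δ₃ * u)) * K := by gcongr
      _ = _ := by ring
  · filter_upwards [h₃, h₄, eventually_ge_atTop 0, eventually_ge_atTop (|B| / δ₄)]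
      with u a1 a2 hu hB s hs
    rw [neg_div, neg_mul, div_mul_eq_mul_div, mul_div_assoc, Complex.neg_re, Complex.I_mul_re,
      neg_neg] at a2
    have hB' : |B| ≤ δ₄ * u := by rwa [div_le_iff₀' hδ₄] at hB
    have hy : B ≤ |((C.ρ (-u) + s * p) / p).im| := by
      rw [him]
      exact (le_abs_self B).trans (hB'.trans ((by linarith : δ₄ * u ≤ -(C.ρ (-u) / p).im).trans
        (neg_le_abs _)))
    rw [norm_mul, abs_neg, abs_of_nonneg hu]
    have h5 := (hK _ hy).trans (mul_le_mul_of_nonneg_left (min_le_right _ _) hK0)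
    rw [him] at h5
    have h6 : Real.exp (μ / p * C.ρ (-u)).re * Real.exp (2 * Real.pi * (C.ρ (-u) / p).im) ≤
        Real.exp (-(min δ₁ δ₃ * u)) := by
      rw [← Real.exp_add]
      refine Real.exp_le_exp.mpr ?_
      have e : ((μ - 2 * Real.pi * I) / p * C.ρ (-u)).re =
          (μ / p * C.ρ (-u)).re + 2 * Real.pi * (C.ρ (-u) / p).im := by
        rw [show (μ - 2 * Real.pi * I) / p * C.ρ (-u) =
          μ / p * C.ρ (-u) - ((2 * Real.pi : ℝ) : ℂ) * (I * (C.ρ (-u) / p)) by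
            push_cast; ring, Complex.sub_re, Complex.re_ofReal_mul, Complex.I_mul_re]
        ring
      rw [← e]
      have := mul_le_mul_of_nonneg_right (min_le_right δ₁ δ₃) hu
      linarith
    calc _ ≤ Real.exp |μ.re| * Real.exp (μ / p * C.ρ (-u)).re *
            (K * Real.exp (2 * Real.pi * (C.ρ (-u) / p).im)) :=
          mul_le_mul (hre _ s hs) h5 (norm_nonneg _) (by positivity)
      _ = Real.exp |μ.re| * K * (Real.exp (μ / p * C.ρ (-u)).re *
            Real.exp (2 * Real.pi * (C.ρ (-u) / p).im)) := by ring
      _ ≤ _ := by gcongr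

/-- The density `e^{μt/p} kerG(t) dt` pulled back to the line. -/
noncomputable def kernel (k : ℕ) (μ : ℂ) (u : ℝ) : ℂ :=
  exp (μ * C.ρ u / p) * kerG p z k (C.ρ u) * deriv C.ρ u

end Contour

theorem continuous_kerG_comp (hp : p = 2 * ħ) (hp0 : p ≠ 0) (k : ℕ) :
    Continuous fun u => kerG p z k (C.ρ u) := by
  have hρ := C.isContour.continuous
  have hG : ∀ {s : ℝ → ℂ}, Continuous s → (∀ u (j : ℕ), s u ≠ -j) →
      Continuous fun u => Gamma (s u) := fun hs hj =>
    continuous_iff_continuousAt.mpr fun u =>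
      ContinuousAt.comp (Complex.differentiableAt_Gamma _ (hj u)).continuousAt hs.continuousAt
  unfold kerG ex gammaKer
  refine Continuous.mul (by fun_prop) (continuous_finsetProd _ fun m _ => ?_)
  refine Continuous.mul (Continuous.mul (hG (by fun_prop) fun u j h => ?_)
    (hG (by fun_prop) fun u j h => ?_)) (by fun_prop)
  · refine C.notMem_of_left m j ⟨u, ?_⟩
    field_simp at h
    linear_combination h / 2 + hp / 2
  · refine C.notMem_of_right m (j + 1) ⟨u, ?_⟩
    field_simp at h
    push_cast
    linear_combination -h

namespace Contour

theorem continuous_kernel (hp : p = 2 * ħ) (hp0 : p ≠ 0) (k : ℕ) (μ : ℂ) :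
    Continuous (C.kernel k μ) := by
  have hρ := C.isContour.continuous
  exact (Continuous.mul (by fun_prop) (continuous_kerG_comp C hp hp0 k)).mul
    C.isContour.continuous_deriv

theorem exists_isBigO_kernel (hp0 : p ≠ 0) {μ : ℂ} (hμ : μ ∈ C.decay) {k : ℕ} (hk : k < n) :
    ∃ δ : ℝ, 0 < δ ∧ C.kernel k μ =O[cocompact ℝ] fun u => Real.exp (-(δ * |u|)) := by
  obtain ⟨δ, K, hδ, h⟩ := C.exists_decay hp0 hμ hk
  refine ⟨δ / 2, half_pos hδ, ?_⟩
  have h1 : (fun u => exp (μ * C.ρ u / p) * kerG p z k (C.ρ u)) =O[cocompact ℝ]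
      fun u => Real.exp (-(δ * |u|)) := by
    refine Asymptotics.IsBigO.of_bound K (h.mono fun u hu => ?_)
    have := hu 0 (by simp)
    rw [Real.norm_of_nonneg (Real.exp_pos _).le]
    simpa using this
  refine (h1.mul (C.slowGrowth_deriv.bound _ (half_pos hδ))).congr_right fun u => ?_
  rw [← Real.exp_add]
  ring_nf

end Contour

theorem integrable_of_isBigO_exp {f : ℝ → ℂ} (hf : Continuous f) {δ : ℝ} (hδ : 0 < δ)
    (h : f =O[cocompact ℝ] fun u => Real.exp (-(δ * |u|))) : Integrable f :=
  hf.locallyIntegrable.integrable_of_isBigO_cocompact h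
    ((integrable_exp_neg_mul_abs hδ).integrableAtFilter _)

namespace Contour

theorem integrable_mul_kernel (hp : p = 2 * ħ) (hp0 : p ≠ 0) {μ : ℂ} (hμ : μ ∈ C.decay) {k : ℕ}
    (hk : k < n) {f : ℝ → ℂ} (hf : SlowGrowth f) : Integrable fun u => f u * C.kernel k μ u := by
  obtain ⟨δ, hδ, h⟩ := C.exists_isBigO_kernel hp0 hμ hk
  refine integrable_of_isBigO_exp (hf.cont.mul (C.continuous_kernel hp hp0 k μ)) (half_pos hδ) ?_
  refine ((hf.bound _ (half_pos hδ)).mul h).congr_right fun u => ?_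
  rw [← Real.exp_add]
  ring_nf

/-- Differentiation under the integral sign. -/
theorem hasDerivAt_integral_kernel (hp : p = 2 * ħ) (hp0 : p ≠ 0) {μ : ℂ} (hμ : μ ∈ C.decay)
    {k : ℕ} (hk : k < n) {f : ℝ → ℂ} (hf : SlowGrowth f) :
    HasDerivAt (fun ν => ∫ u, f u * C.kernel k ν u)
      (p⁻¹ * ∫ u, C.ρ u * f u * C.kernel k μ u) μ := by
  obtain ⟨δ, hδ, h⟩ := C.exists_isBigO_kernel hp0 hμ hk
  obtain ⟨K, hK, hρK⟩ := C.exists_norm_le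
  have hpn : 0 < ‖p‖ := norm_pos_iff.mpr hp0
  set η : ℝ := δ * ‖p‖ / (4 * K) with hη
  have hη0 : 0 < η := by positivity
  set G : ℝ → ℂ := fun u => C.ρ u * f u * C.kernel k μ u with hG
  have hGs : SlowGrowth fun u => C.ρ u * f u := C.slowGrowth.mul hf
  have hcont : ∀ ν, Continuous fun u => f u * C.kernel k ν u := fun ν =>
    hf.cont.mul (C.continuous_kernel hp hp0 k ν)
  have hker : ∀ ν u, C.kernel k ν u = C.kernel k μ u * exp ((ν - μ) * C.ρ u / p) := by
    intro ν u
    rw [kernel, kernel, show ν * C.ρ u / p = μ * C.ρ u / p + (ν - μ) * C.ρ u / p by ring,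
      Complex.exp_add]
    ring
  -- near `μ` the derivative is dominated by the value at `μ` times `e^{η|t/p|}`
  set bound : ℝ → ℝ := fun u => ‖p‖⁻¹ * (‖G u‖ * Real.exp (η * (‖C.ρ u‖ / ‖p‖))) with hbound
  have hbint : Integrable bound := by
    refine Integrable.const_mul ?_ _
    have hGc : Continuous G := hGs.cont.mul (C.continuous_kernel hp hp0 k μ)
    have hρc := C.isContour.continuous
    have h1 : G =O[cocompact ℝ] fun u => Real.exp (-(δ * 3 / 4 * |u|)) := by
      refine ((hGs.bound _ (show 0 < δ / 4 by positivity)).mul h).congr_right fun u => ?_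
      rw [← Real.exp_add]
      ring_nf
    have h2 : (fun u => Real.exp (η * (‖C.ρ u‖ / ‖p‖))) =O[cocompact ℝ]
        fun u => Real.exp (δ / 4 * |u|) := by
      refine Asymptotics.IsBigO.of_bound 1 (hρK.mono fun u hu => ?_)
      rw [Real.norm_of_nonneg (Real.exp_pos _).le, Real.norm_of_nonneg (Real.exp_pos _).le, one_mul]
      refine Real.exp_le_exp.mpr ?_
      calc η * (‖C.ρ u‖ / ‖p‖) ≤ η * (K * |u| / ‖p‖) := by gcongr
        _ = δ / 4 * |u| := by rw [hη]; field_simp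
    have h3 := h1.norm_left.mul h2
    refine (Continuous.locallyIntegrable (by fun_prop)).integrable_of_isBigO_cocompact h3 ?_
    have h4 := (integrable_exp_neg_mul_abs (half_pos hδ)).integrableAtFilter (cocompact ℝ)
    convert h4 using 2
    rw [← Real.exp_add]
    ring_nf
  have key := hasDerivAt_integral_of_dominated_loc_of_deriv_le (μ := volume)
    (F := fun ν u => f u * C.kernel k ν u) (x₀ := μ)
    (F' := fun ν u => C.ρ u / p * (f u * C.kernel k ν u)) (bound := bound)
    (Metric.ball_mem_nhds μ hη0) (Eventually.of_forall fun ν => (hcont ν).aestronglyMeasurable)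
    (C.integrable_mul_kernel hp hp0 hμ hk hf)
    ((C.isContour.continuous.div_const p).mul (hcont μ)).aestronglyMeasurable
    (Eventually.of_forall fun u ν hν => ?_) hbint (Eventually.of_forall fun u ν hν => ?_)
  · refine key.2.congr_deriv ?_
    rw [← integral_const_mul]
    congr 1
    funext u
    ring
  · rw [hker ν u, hbound, show C.ρ u / p * (f u * (C.kernel k μ u * exp ((ν - μ) * C.ρ u / p))) =
      p⁻¹ * (G u * exp ((ν - μ) * C.ρ u / p)) by rw [hG]; ring, norm_mul, norm_mul, norm_inv]
    refine mul_le_mul_of_nonneg_left (mul_le_mul_of_nonneg_left ?_ (norm_nonneg _))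
      (inv_nonneg.mpr (norm_nonneg _))
    rw [Complex.norm_exp]
    refine Real.exp_le_exp.mpr ((Complex.re_le_norm _).trans ?_)
    rw [mul_div_assoc, norm_mul, norm_div]
    have : ‖ν - μ‖ ≤ η := by
      rw [← dist_eq_norm]; exact (Metric.mem_ball.mp hν).le
    gcongr
  · have h1 : HasDerivAt (fun ν : ℂ => ν * C.ρ u / p) (C.ρ u / p) ν := by
      simpa using ((hasDerivAt_id ν).mul_const (C.ρ u)).div_const p
    have h2 := ((h1.cexp.mul_const (kerG p z k (C.ρ u))).mul_const (deriv C.ρ u)).const_mul (f u)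
    exact HasDerivAt.congr_deriv (f := fun ν => f u * C.kernel k ν u) h2
      (by simp only [kernel]; ring)

end Contour

/-! ### Total differences integrate to zero -/

/-- The functions that are meromorphic on `U` with finitely many poles there, all satisfying
`good`. -/
def PolesIn (U : Set ℂ) (good : ℂ → Prop) (F : ℂ → ℂ) : Prop :=
  ∃ N : ℂ → ℂ, DifferentiableOn ℂ N U ∧ ∃ qs : List ℂ, (∀ q ∈ qs, good q) ∧
    ∀ t ∈ U, (∀ q ∈ qs, t ≠ q) → F t = N t / (qs.map (fun q => t - q)).prod

theorem PolesIn.of_differentiable {U : Set ℂ} {good : ℂ → Prop} {F : ℂ → ℂ}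
    (hF : Differentiable ℂ F) : PolesIn U good F :=
  ⟨F, hF.differentiableOn, [], by simp, by simp⟩

theorem PolesIn.mul {U : Set ℂ} {good : ℂ → Prop} {F G : ℂ → ℂ} (hF : PolesIn U good F)
    (hG : PolesIn U good G) : PolesIn U good fun t => F t * G t := by
  obtain ⟨N₁, hN₁, q₁, hq₁, h₁⟩ := hF
  obtain ⟨N₂, hN₂, q₂, hq₂, h₂⟩ := hG
  refine ⟨fun t => N₁ t * N₂ t, hN₁.mul hN₂, q₁ ++ q₂, fun q hq => ?_, fun t ht hq => ?_⟩
  · rcases List.mem_append.mp hq with h | h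
    · exact hq₁ q h
    · exact hq₂ q h
  · beta_reduce
    rw [h₁ t ht fun q h => hq q (by simp [h]), h₂ t ht fun q h => hq q (by simp [h]),
      List.map_append, List.prod_append, div_mul_div_comm]

theorem PolesIn.prod {ι : Type*} {U : Set ℂ} {good : ℂ → Prop} (s : Finset ι) {F : ι → ℂ → ℂ}
    (hF : ∀ i ∈ s, PolesIn U good (F i)) : PolesIn U good fun t => ∏ i ∈ s, F i t := by
  classical
  induction s using Finset.induction_on with
  | empty => simpa using PolesIn.of_differentiable (differentiable_const 1)
  | insert i s hi ih =>
    simp only [Finset.prod_insert hi]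
    exact (hF i (by simp)).mul (ih fun j hj => hF j (by simp [hj]))

theorem gamma_eq_div_prod {a c : ℂ} (ha : a ≠ 0) (N : ℕ) (t : ℂ)
    (ht : ∀ q ∈ (List.range N).map (fun j : ℕ => c - a * j), t ≠ q) :
    Gamma ((t - c) / a) = a ^ N * Gamma ((t - c) / a + N) /
      (((List.range N).map (fun j : ℕ => c - a * j)).map (fun q => t - q)).prod := by
  induction N with
  | zero => simp
  | succ N ih =>
    have h1 := ih fun q hq => ht q (by
      rw [List.range_succ, List.map_append]; exact List.mem_append_left _ hq)
    have h2 : t - (c - a * N) ≠ 0 := sub_ne_zero.mpr (ht _ (by simp [List.range_succ]))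
    have h3 : (t - c) / a + N ≠ 0 := by
      intro h
      apply h2
      field_simp at h
      linear_combination h
    rw [h1, List.range_succ, List.map_append, List.map_append, List.prod_append]
    simp only [List.map_cons, List.map_nil, List.prod_cons, List.prod_nil, mul_one]
    push_cast
    rw [← add_assoc, Complex.Gamma_add_one _ h3, mul_comm _ (t - (c - a * N)), ← div_div]
    congr 1
    rw [eq_div_iff h2, pow_succ]
    field_simp
    ring

/-- On the union of a disc and of the set where `|Im(t/p)|` is large, `Γ((t - c)/a)`, `a = ± p`,
has finitely many poles. -/
theorem polesIn_gamma {p : ℂ} {a c : ℂ} (ha : a ≠ 0) (hap : a = p ∨ a = -p)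
    {good : ℂ → Prop} (hgood : ∀ j : ℕ, good (c - a * j)) {B r : ℝ} (hB : |(c / p).im| ≤ B) :
    PolesIn ({t | B < |(t / p).im|} ∪ Metric.ball 0 r) good fun t => Gamma ((t - c) / a) := by
  obtain ⟨N, hN⟩ := exists_nat_gt ((r + ‖c‖) / ‖a‖)
  refine ⟨fun t => a ^ N * Gamma ((t - c) / a + N), ?_, (List.range N).map fun j : ℕ => c - a * j,
    ?_, fun t _ ht => gamma_eq_div_prod ha N t ht⟩
  · refine DifferentiableOn.const_mul (fun t ht => DifferentiableAt.differentiableWithinAt ?_) _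
    refine DifferentiableAt.comp t (Complex.differentiableAt_Gamma _ fun j hj => ?_) (by fun_prop)
    rcases ht with ht | ht
    · have h1 : ((t - c) / a).im = 0 := by
        have := congrArg Complex.im hj
        simpa using this
      have h2 : ((t - c) / p).im = 0 := by
        rcases hap with rfl | rfl
        · exact h1
        · rw [div_neg, Complex.neg_im] at h1
          linarith
      rw [sub_div, Complex.sub_im, sub_eq_zero] at h2
      have h3 : B < |(t / p).im| := ht
      rw [h2] at h3
      exact absurd hB h3.not_ge
    · have h1 : ((t - c) / a).re = -j - N := by
        have := congrArg Complex.re hj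
        simp only [Complex.add_re, Complex.natCast_re, Complex.neg_re] at this
        linarith
      have h2 : ‖(t - c) / a‖ < N := by
        refine lt_of_le_of_lt ?_ hN
        rw [norm_div]
        have h3 : ‖t‖ < r := by simpa using ht
        have := norm_sub_le t c
        gcongr
        linarith
      have h3 := Complex.abs_re_le_norm ((t - c) / a)
      rw [h1] at h3
      have h4 := neg_abs_le (-(j : ℝ) - N)
      have h5 : (0 : ℝ) ≤ j := j.cast_nonneg
      linarith
  · intro q hq
    obtain ⟨j, -, rfl⟩ := List.mem_map.mp hq
    exact hgood j

namespace Contour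

theorem slowGrowth_xFun (k : ℕ) : SlowGrowth fun u => xFun ħ z k (C.ρ u) := by
  unfold xFun
  refine SlowGrowth.prod _ fun m _ => ?_
  simp only [div_eq_mul_inv]
  have hm : z m ∉ Set.range C.ρ := fun ⟨u, hu⟩ => C.ne_z u m hu
  exact ((C.slowGrowth.sub_const _).sub_const _).mul (C.slowGrowth_inv hm)

theorem slowGrowth_difference (μ : ℂ) (j : ℕ) :
    SlowGrowth fun u => C.ρ u ^ j - exp μ * xFun ħ z n (C.ρ u) * (C.ρ u + p) ^ j := by
  have h2 := (C.slowGrowth.pow j).add ((SlowGrowth.const (-1)).mul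
    (((SlowGrowth.const (exp μ)).mul (C.slowGrowth_xFun n)).mul
      ((C.slowGrowth.add (SlowGrowth.const p)).pow j)))
  simpa only [neg_mul, one_mul, ← sub_eq_add_neg] using h2

/-- The integral of a total difference over the contour vanishes: no poles lie between the contour
and its translate by `p`. -/
theorem integral_difference_eq_zero (hp : p = 2 * ħ) (hp0 : p ≠ 0) {μ : ℂ} (hμ : μ ∈ C.decay)
    {k : ℕ} (hk : k < n) (j : ℕ) :
    ∫ u, (C.ρ u ^ j - exp μ * xFun ħ z n (C.ρ u) * (C.ρ u + p) ^ j) * C.kernel k μ u = 0 := by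
  have hħ : ħ = p / 2 := by rw [hp]; ring
  have hc := C.isContour
  set F : ℂ → ℂ := fun t => t ^ j * (exp (μ * t / p) * kerG p z k t) with hF
  have hshift : ∀ u, F (C.ρ u + p) = exp μ * xFun ħ z n (C.ρ u) * (C.ρ u + p) ^ j *
      (exp (μ * C.ρ u / p) * kerG p z k (C.ρ u)) := by
    intro u
    simp only [hF]
    have hx : xFun ħ z n (C.ρ u) = xFun (p / 2) z n (C.ρ u) :=
      congrArg (fun h => xFun h z n (C.ρ u)) hħ
    rw [hx, kerG_add hp0 z k (C.ne_z u), mul_add, add_div, mul_div_cancel_right₀ _ hp0,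
      Complex.exp_add]
    · ring
    · intro m h
      refine C.notMem_of_left m 0 ⟨u, ?_⟩
      push_cast
      linear_combination h - hħ
  -- the separation of the poles of the phase function by the contour
  have hnull : ShiftNull C.ρ p F := by
    obtain ⟨a, b, ha, hb, -⟩ := C.separates
    -- `q` and `q - p` belong to a connected subset of the complement of the contour
    set good : ℂ → Prop := fun q => ∃ K ⊆ (Set.range C.ρ)ᶜ, IsPreconnected K ∧ q ∈ K ∧ q - p ∈ K
    obtain ⟨δ, K, hδ, hdecay⟩ := C.exists_decay hp0 hμ hk
    set B : ℝ := ∑ m, (|((z m + ħ) / p).im| + |((z m + p) / p).im|) with hB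
    have hBm : ∀ m, |((z m + ħ) / p).im| + |((z m + p) / p).im| ≤ B := fun m =>
      Finset.single_le_sum (f := fun m => |((z m + ħ) / p).im| + |((z m + p) / p).im|)
        (fun _ _ => by positivity) (Finset.mem_univ m)
    obtain ⟨δ₂, hδ₂, h₂⟩ := exists_re_mul_le C.isContour.hasDerivAt C.deriv_top (c := I / p)
      (by rw [div_mul_eq_mul_div, mul_div_assoc, Complex.I_mul_re]; linarith [C.im_top])
    obtain ⟨δ₄, hδ₄, h₄⟩ := exists_re_mul_le C.hasDerivAt_neg C.tendsto_deriv_neg (c := -I / p)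
      (by
        rw [mul_neg, neg_div, neg_mul, neg_neg, div_mul_eq_mul_div, mul_div_assoc,
          Complex.I_mul_re]
        linarith [C.im_bot])
    have hfar : ∀ᶠ u in cocompact ℝ, B < |(C.ρ u / p).im| := by
      refine eventually_cocompact_of_atTop ?_ ?_
      · filter_upwards [h₂, eventually_gt_atTop (B / δ₂)] with u hu hu'
        rw [div_mul_eq_mul_div, mul_div_assoc, Complex.I_mul_re] at hu
        rw [div_lt_iff₀' hδ₂] at hu'
        exact hu'.trans_le ((by linarith : δ₂ * u ≤ (C.ρ u / p).im).trans (le_abs_self _))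
      · filter_upwards [h₄, eventually_gt_atTop (B / δ₄)] with u hu hu'
        rw [neg_div, neg_mul, div_mul_eq_mul_div, mul_div_assoc, Complex.neg_re, Complex.I_mul_re,
          neg_neg] at hu
        rw [div_lt_iff₀' hδ₄] at hu'
        exact hu'.trans_le ((by linarith : δ₄ * u ≤ -(C.ρ (-u) / p).im).trans (neg_le_abs _))
    obtain ⟨T, hT, hTfar⟩ := mem_cocompact.mp hfar
    obtain ⟨r, hr⟩ := (hT.image hc.continuous).isBounded.exists_norm_le
    have hr' : ∀ u ∈ T, ‖C.ρ u‖ ≤ r := fun u hu => hr _ ⟨u, hu, rfl⟩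
    set U : Set ℂ := {t | B < |(t / p).im|} ∪ Metric.ball 0 (r + ‖p‖ + 1) with hU
    have hUo : IsOpen U := by
      refine IsOpen.union (isOpen_lt continuous_const ?_) Metric.isOpen_ball
      exact (Complex.continuous_im.comp (continuous_id.div_const p)).abs
    have hsweep : ∀ u : ℝ, ∀ s ∈ Set.Icc (0 : ℝ) 1, C.ρ u + s * p ∈ U := by
      intro u s hs
      by_cases hu : u ∈ T
      · right
        rw [mem_ball_zero_iff]
        have h1 := norm_add_le (C.ρ u) (s * p)
        have h2 : ‖(s : ℂ) * p‖ ≤ ‖p‖ := by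
          rw [norm_mul, Complex.norm_real, Real.norm_of_nonneg hs.1]
          exact mul_le_of_le_one_left (norm_nonneg _) hs.2
        linarith [hr' u hu]
      · left
        have h1 := hTfar hu
        rw [Set.mem_ofPred_eq, add_div, mul_div_cancel_right₀ _ hp0]
        simpa using h1
    have hpoles : PolesIn U good F := by
      refine (PolesIn.of_differentiable (by fun_prop)).mul ((PolesIn.of_differentiable
        (by fun_prop)).mul ?_)
      unfold kerG ex
      refine (PolesIn.of_differentiable (by fun_prop)).mul (PolesIn.prod _ fun m _ => ?_)
      unfold gammaKer
      refine PolesIn.mul (PolesIn.mul ?_ ?_) (PolesIn.of_differentiable (by fun_prop))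
      · have e : ∀ t, (t - z m) / p - 1 / 2 = (t - (z m + ħ)) / p := by
          intro t; rw [hħ]; field_simp; ring
        simp only [e]
        refine polesIn_gamma hp0 (Or.inl rfl) (fun j => ?_) ?_
        · refine ⟨_, connectedComponentIn_subset _ a, isPreconnected_connectedComponentIn,
            ha ⟨m, j, rfl⟩, ha ⟨m, j + 1, ?_⟩⟩
          push_cast; ring
        · have := hBm m
          linarith [abs_nonneg ((z m + p) / p).im]
      · have e : ∀ t, 1 - (t - z m) / p = (t - (z m + p)) / -p := by
          intro t; field_simp; ring
        simp only [e]
        refine polesIn_gamma (neg_ne_zero.mpr hp0) (Or.inr rfl) (fun j => ?_) ?_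
        · refine ⟨_, connectedComponentIn_subset _ b, isPreconnected_connectedComponentIn,
            hb ⟨m, j + 1, ?_⟩, hb ⟨m, j, ?_⟩⟩
          · push_cast; ring
          · ring
        · have := hBm m
          linarith [abs_nonneg ((z m + ħ) / p).im]
    have hlim : Tendsto (fun x : ℝ × ℝ => F (C.ρ x.1 + x.2 * p)) sweepEnds (𝓝 0) := by
      obtain ⟨K', hK', hρK⟩ := C.exists_norm_le
      have h1 : Tendsto (fun v : ℝ => (K' * v + ‖p‖) ^ j * (K * Real.exp (-(δ * v)))) atTop
          (𝓝 0) := by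
        have h2 : Tendsto (fun v : ℝ => v ^ j * Real.exp (-(δ * v))) atTop (𝓝 0) := by
          have := (isLittleO_pow_exp_pos_mul_atTop j hδ).tendsto_div_nhds_zero
          simpa only [div_eq_mul_inv, ← Real.exp_neg] using this
        have h3 := h2.const_mul ((K' + ‖p‖) ^ j * |K|)
        rw [mul_zero] at h3
        refine squeeze_zero_norm' ?_ h3
        filter_upwards [eventually_ge_atTop 1] with v hv
        have hv0 : 0 ≤ v := by linarith
        have hle : K' * v + ‖p‖ ≤ (K' + ‖p‖) * v := by nlinarith [norm_nonneg p]
        have hnn : 0 ≤ K' * v + ‖p‖ := by positivity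
        rw [norm_mul, norm_mul, norm_pow, Real.norm_of_nonneg hnn, Real.norm_eq_abs K,
          Real.norm_of_nonneg (Real.exp_pos _).le]
        calc (K' * v + ‖p‖) ^ j * (|K| * Real.exp (-(δ * v)))
            ≤ ((K' + ‖p‖) * v) ^ j * (|K| * Real.exp (-(δ * v))) := by gcongr
          _ = _ := by rw [mul_pow]; ring
      have habs : Tendsto (fun u : ℝ => |u|) (cocompact ℝ) atTop := tendsto_norm_cocompact_atTop
      refine squeeze_zero_norm' ?_ ((h1.comp habs).comp tendsto_fst)
      have h2 := hρK.and hdecay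
      rw [sweepEnds, eventually_prod_principal_iff]
      filter_upwards [h2] with u hu s hs
      simp only [hF, Function.comp_apply]
      rw [norm_mul, norm_pow]
      refine mul_le_mul (pow_le_pow_left₀ (norm_nonneg _) ?_ j) (hu.2 s hs) (norm_nonneg _)
        (by positivity)
      have h1 := norm_add_le (C.ρ u) (s * p)
      have h2 : ‖(s : ℂ) * p‖ ≤ ‖p‖ := by
        rw [norm_mul, Complex.norm_real, Real.norm_of_nonneg hs.1]
        exact mul_le_of_le_one_left (norm_nonneg _) hs.2
      linarith [hu.1]
    obtain ⟨N, hN, qs, hqs, hFN⟩ := hpoles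
    exact shiftNull_of_poles hc hUo hN hsweep qs hqs hFN hlim
  have hint := C.integrable_mul_kernel hp hp0 hμ hk (C.slowGrowth_difference μ j)
  have hlim := intervalIntegral_tendsto_integral hint tendsto_neg_atTop_atBot tendsto_id
  have hnull' := hnull.lim.neg
  rw [neg_zero] at hnull'
  refine tendsto_nhds_unique hlim (hnull'.congr fun T => ?_)
  rw [← intervalIntegral.integral_neg]
  congr 1
  funext u
  rw [hshift, kernel]
  simp only [hF]
  ring

end Contour

end

/-! ### Functions of several contour variables -/

/-- The products `∏_a f_a(u_a)` of functions of slow growth. -/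
def productFun (ℓ : ℕ) : Submonoid ((Fin ℓ → ℝ) → ℂ) where
  carrier := {F | ∃ f : Fin ℓ → ℝ → ℂ, (∀ a, SlowGrowth (f a)) ∧ F = fun u => ∏ a, f a (u a)}
  one_mem' := ⟨fun _ _ => 1, fun _ => SlowGrowth.const 1, by funext u; simp⟩
  mul_mem' := by
    rintro _ _ ⟨f, hf, rfl⟩ ⟨g, hg, rfl⟩
    refine ⟨fun a u => f a u * g a u, fun a => (hf a).mul (hg a), ?_⟩
    funext u
    simp [Finset.prod_mul_distrib]

/-- The algebra of finite sums of products of functions of slow growth in one variable. -/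
def slowAlg (ℓ : ℕ) : Subalgebra ℂ ((Fin ℓ → ℝ) → ℂ) :=
  Algebra.adjoin ℂ (productFun ℓ : Set ((Fin ℓ → ℝ) → ℂ))

theorem mem_span_of_mem_slowAlg {ℓ : ℕ} {F : (Fin ℓ → ℝ) → ℂ} (hF : F ∈ slowAlg ℓ) :
    F ∈ Submodule.span ℂ (productFun ℓ : Set ((Fin ℓ → ℝ) → ℂ)) := by
  rw [← Subalgebra.mem_toSubmodule, slowAlg, Algebra.adjoin_eq_span, Submonoid.closure_eq] at hF
  exact hF

theorem prod_mem_slowAlg {ℓ : ℕ} {f : Fin ℓ → ℝ → ℂ} (hf : ∀ a, SlowGrowth (f a)) :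
    (fun u : Fin ℓ → ℝ => ∏ a, f a (u a)) ∈ slowAlg ℓ :=
  Algebra.subset_adjoin ⟨f, hf, rfl⟩

theorem coord_mem_slowAlg {ℓ : ℕ} {f : ℝ → ℂ} (hf : SlowGrowth f) (a : Fin ℓ) :
    (fun u : Fin ℓ → ℝ => f (u a)) ∈ slowAlg ℓ := by
  have h := prod_mem_slowAlg (ℓ := ℓ) (f := fun b => if b = a then f else fun _ => 1) fun b => by
    split_ifs
    exacts [hf, SlowGrowth.const 1]
  convert h using 2 with u
  rw [Finset.prod_eq_single a (fun b _ hb => by simp [hb]) (by simp)]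
  simp

theorem slowAlg_finsetProd {ι : Type*} {ℓ : ℕ} (s : Finset ι) {F : ι → (Fin ℓ → ℝ) → ℂ}
    (hF : ∀ i ∈ s, F i ∈ slowAlg ℓ) : (fun u => ∏ i ∈ s, F i u) ∈ slowAlg ℓ := by
  have := Subalgebra.prod_mem (slowAlg ℓ) hF
  convert this using 1
  funext u
  simp

theorem slowAlg_finsetSum {ι : Type*} {ℓ : ℕ} (s : Finset ι) {F : ι → (Fin ℓ → ℝ) → ℂ}
    (hF : ∀ i ∈ s, F i ∈ slowAlg ℓ) : (fun u => ∑ i ∈ s, F i u) ∈ slowAlg ℓ := by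
  have := Subalgebra.sum_mem (slowAlg ℓ) hF
  convert this using 1
  funext u
  simp

theorem slowAlg_const {ℓ : ℕ} (c : ℂ) : (fun _ : Fin ℓ → ℝ => c) ∈ slowAlg ℓ :=
  (slowAlg ℓ).algebraMap_mem c

theorem slowAlg_mul {ℓ : ℕ} {F G : (Fin ℓ → ℝ) → ℂ} (hF : F ∈ slowAlg ℓ) (hG : G ∈ slowAlg ℓ) :
    (fun u => F u * G u) ∈ slowAlg ℓ := mul_mem hF hG

theorem slowAlg_sub {ℓ : ℕ} {F G : (Fin ℓ → ℝ) → ℂ} (hF : F ∈ slowAlg ℓ) (hG : G ∈ slowAlg ℓ) :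
    (fun u => F u - G u) ∈ slowAlg ℓ := sub_mem hF hG

section

variable {n : ℕ} {ħ p : ℂ} {z : Fin n → ℂ} (C : Contour ħ p z)

namespace Contour

theorem slowGrowth_omegaFun (k : Fin n) : SlowGrowth fun u => omegaFun ħ z k (C.ρ u) := by
  unfold omegaFun
  have hm : z k ∉ Set.range C.ρ := fun ⟨u, hu⟩ => C.ne_z u k hu
  simpa only [one_div] using (C.slowGrowth_inv hm).mul (C.slowGrowth_xFun k)

theorem slowGrowth_getD {L : List (ℂ → ℂ)} (hL : ∀ f ∈ L, SlowGrowth fun u => f (C.ρ u)) (i : ℕ) :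
    SlowGrowth fun u => L.getD i 0 (C.ρ u) := by
  by_cases hi : i < L.length
  · rw [List.getD_eq_getElem _ _ hi]
    exact hL _ (List.getElem_mem hi)
  · rw [List.getD_eq_default _ _ (not_lt.mp hi)]
    exact SlowGrowth.const 0

theorem starTerm_mem_slowAlg {r ℓ : ℕ} {L : List (ℂ → ℂ)}
    (hL : ∀ f ∈ L, SlowGrowth fun u => f (C.ρ u)) (τ : Fin r → Fin ℓ) :
    (fun u : Fin ℓ → ℝ => starTerm ħ r L fun a => C.ρ (u (τ a))) ∈ slowAlg ℓ := by
  have hρ : ∀ a : Fin ℓ, (fun u : Fin ℓ → ℝ => C.ρ (u a)) ∈ slowAlg ℓ :=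
    fun a => coord_mem_slowAlg C.slowGrowth a
  refine slowAlg_mul (slowAlg_finsetProd _ fun a _ =>
    coord_mem_slowAlg (C.slowGrowth_getD hL a) (τ a)) ?_
  unfold quantumVandermonde
  exact slowAlg_finsetProd _ fun a _ => slowAlg_finsetProd _ fun b _ =>
    slowAlg_sub (slowAlg_sub (hρ _) (hρ _)) (slowAlg_const ħ)

theorem star_mem_slowAlg (ℓ : ℕ) {L : List (ℂ → ℂ)}
    (hL : ∀ f ∈ L, SlowGrowth fun u => f (C.ρ u)) :
    (fun u : Fin ℓ → ℝ => star ħ ℓ L fun a => C.ρ (u a)) ∈ slowAlg ℓ := by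
  unfold star asym
  exact slowAlg_finsetSum _ fun σ _ => slowAlg_mul (slowAlg_const _) (C.starTerm_mem_slowAlg hL σ)

/-! ### Integrals against a product of kernels -/

/-- The integral of `F` against `∏_a e^{μ t_a/p} kerG(t_a) dt_a`, with the exponent `d_a` for the
`a`-th variable. -/
noncomputable def monoInt {ℓ : ℕ} (d : Fin ℓ → ℕ) (F : (Fin ℓ → ℝ) → ℂ) (μ : ℂ) : ℂ :=
  ∫ u : Fin ℓ → ℝ, F u * ∏ a, C.kernel (d a) μ (u a)

theorem monoInt_prod {ℓ : ℕ} (d : Fin ℓ → ℕ) (f : Fin ℓ → ℝ → ℂ) (μ : ℂ) :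
    C.monoInt d (fun u => ∏ a, f a (u a)) μ = ∏ a, ∫ u, f a u * C.kernel (d a) μ u := by
  rw [← integral_fintype_prod_volume_eq_prod]
  simp only [monoInt, Finset.prod_mul_distrib]

theorem integrable_mono (hp : p = 2 * ħ) (hp0 : p ≠ 0) {μ : ℂ} (hμ : μ ∈ C.decay) {ℓ : ℕ}
    {d : Fin ℓ → ℕ} (hd : ∀ a, d a < n) {F : (Fin ℓ → ℝ) → ℂ} (hF : F ∈ slowAlg ℓ) :
    Integrable fun u : Fin ℓ → ℝ => F u * ∏ a, C.kernel (d a) μ (u a) := by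
  have hspan := mem_span_of_mem_slowAlg hF
  clear hF
  induction hspan using Submodule.span_induction with
  | mem F hF =>
    obtain ⟨f, hf, rfl⟩ := hF
    have := Integrable.fintype_prod (f := fun a u => f a u * C.kernel (d a) μ u)
      (μ := fun _ => volume) fun a => C.integrable_mul_kernel hp hp0 hμ (hd a) (hf a)
    simp only [Finset.prod_mul_distrib] at this
    exact this
  | zero => simp
  | add F G _ _ hF hG =>
    simp only [Pi.add_apply, add_mul]
    exact hF.add hG
  | smul c F _ hF => simpa only [Pi.smul_apply, smul_eq_mul, mul_assoc] using hF.const_mul c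

theorem monoInt_add (hp : p = 2 * ħ) (hp0 : p ≠ 0) {μ : ℂ} (hμ : μ ∈ C.decay) {ℓ : ℕ}
    {d : Fin ℓ → ℕ} (hd : ∀ a, d a < n) {F G : (Fin ℓ → ℝ) → ℂ} (hF : F ∈ slowAlg ℓ)
    (hG : G ∈ slowAlg ℓ) : C.monoInt d (F + G) μ = C.monoInt d F μ + C.monoInt d G μ := by
  simp only [monoInt, Pi.add_apply, add_mul]
  exact integral_add (C.integrable_mono hp hp0 hμ hd hF) (C.integrable_mono hp hp0 hμ hd hG)

theorem monoInt_smul {μ : ℂ} {ℓ : ℕ} (d : Fin ℓ → ℕ) (c : ℂ) (F : (Fin ℓ → ℝ) → ℂ) :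
    C.monoInt d (c • F) μ = c * C.monoInt d F μ := by
  simp only [monoInt, Pi.smul_apply, smul_eq_mul, mul_assoc]
  exact integral_const_mul _ _

theorem isOpen_decay : IsOpen C.decay := by
  have h1 : Continuous fun μ : ℂ => (μ * (C.αTop / p)).re :=
    Complex.continuous_re.comp (by fun_prop)
  have h2 : Continuous fun μ : ℂ => ((μ - 2 * Real.pi * I) * (C.αBot / p)).re :=
    Complex.continuous_re.comp (by fun_prop)
  exact (isOpen_lt continuous_const Complex.continuous_im).inter
    ((isOpen_lt Complex.continuous_im continuous_const).inter
      ((isOpen_lt h1 continuous_const).inter (isOpen_lt continuous_const h2)))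

/-- Differentiation in `μ` brings down the factor `∑_a t_a / p`. -/
theorem hasDerivAt_monoInt (hp : p = 2 * ħ) (hp0 : p ≠ 0) {μ : ℂ} (hμ : μ ∈ C.decay) {ℓ : ℕ}
    {d : Fin ℓ → ℕ} (hd : ∀ a, d a < n) {F : (Fin ℓ → ℝ) → ℂ} (hF : F ∈ slowAlg ℓ) :
    HasDerivAt (fun ν => C.monoInt d F ν)
      (p⁻¹ * C.monoInt d (fun u => (∑ a, C.ρ (u a)) * F u) μ) μ := by
  have hsum : (fun u : Fin ℓ → ℝ => ∑ a, C.ρ (u a)) ∈ slowAlg ℓ :=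
    slowAlg_finsetSum _ fun a _ => coord_mem_slowAlg C.slowGrowth a
  have hspan := mem_span_of_mem_slowAlg hF
  clear hF
  suffices h : F ∈ slowAlg ℓ ∧ HasDerivAt (fun ν => C.monoInt d F ν)
      (p⁻¹ * C.monoInt d (fun u => (∑ a, C.ρ (u a)) * F u) μ) μ from h.2
  have hopen := C.isOpen_decay.mem_nhds hμ
  induction hspan using Submodule.span_induction with
  | mem F hF =>
    obtain ⟨f, hf, rfl⟩ := hF
    refine ⟨prod_mem_slowAlg hf, ?_⟩
    simp only [monoInt_prod]
    have h1 := HasDerivAt.fun_finsetProd (u := Finset.univ) fun a _ =>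
      C.hasDerivAt_integral_kernel hp hp0 hμ (hd a) (hf a)
    refine h1.congr_deriv ?_
    have hmem : ∀ a, (fun u : Fin ℓ → ℝ => C.ρ (u a) * ∏ b, f b (u b)) ∈ slowAlg ℓ := fun a =>
      slowAlg_mul (coord_mem_slowAlg C.slowGrowth a) (prod_mem_slowAlg hf)
    have h2 : C.monoInt d (fun u => (∑ a, C.ρ (u a)) * ∏ b, f b (u b)) μ =
        ∑ a, C.monoInt d (fun u => C.ρ (u a) * ∏ b, f b (u b)) μ := by
      simp only [monoInt, Finset.sum_mul]
      exact integral_finsetSum _ fun a _ => C.integrable_mono hp hp0 hμ hd (hmem a)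
    rw [h2, Finset.mul_sum]
    refine Finset.sum_congr rfl fun a _ => ?_
    have h3 : (fun u : Fin ℓ → ℝ => C.ρ (u a) * ∏ b, f b (u b)) = fun u =>
        ∏ b, (Function.update f a fun x => C.ρ x * f a x) b (u b) := by
      funext u
      rw [← Finset.mul_prod_erase _ _ (Finset.mem_univ a), ← Finset.mul_prod_erase _ _
        (Finset.mem_univ a), Function.update_self, ← mul_assoc]
      congr 1
      refine Finset.prod_congr rfl fun b hb => ?_
      rw [Function.update_of_ne (Finset.ne_of_mem_erase hb)]
    rw [h3, monoInt_prod, ← Finset.mul_prod_erase _ _ (Finset.mem_univ a), Function.update_self,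
      smul_eq_mul]
    have h4 : ∏ b ∈ Finset.univ.erase a, ∫ x, (Function.update f a fun x => C.ρ x * f a x) b x *
        C.kernel (d b) μ x = ∏ b ∈ Finset.univ.erase a, ∫ x, f b x * C.kernel (d b) μ x := by
      refine Finset.prod_congr rfl fun b hb => ?_
      rw [Function.update_of_ne (Finset.ne_of_mem_erase hb)]
    rw [h4]
    ring
  | zero =>
    refine ⟨zero_mem _, ?_⟩
    simpa [monoInt] using hasDerivAt_const μ (0 : ℂ)
  | add F G _ _ hF hG =>
    refine ⟨add_mem hF.1 hG.1, ?_⟩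
    have h1 : (fun ν => C.monoInt d (F + G) ν) =ᶠ[𝓝 μ] fun ν =>
        C.monoInt d F ν + C.monoInt d G ν := by
      filter_upwards [hopen] with ν hν
      exact C.monoInt_add hp hp0 hν hd hF.1 hG.1
    have h2 : (fun u : Fin ℓ → ℝ => (∑ a, C.ρ (u a)) * (F + G) u) =
        (fun u => (∑ a, C.ρ (u a)) * F u) + fun u => (∑ a, C.ρ (u a)) * G u := by
      funext u
      simp [mul_add]
    rw [h2, C.monoInt_add hp hp0 hμ hd (slowAlg_mul hsum hF.1) (slowAlg_mul hsum hG.1), mul_add]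
    exact (hF.2.add hG.2).congr_of_eventuallyEq h1
  | smul c F _ hF =>
    refine ⟨Subalgebra.smul_mem _ hF.1 c, ?_⟩
    have h2 : (fun u : Fin ℓ → ℝ => (∑ a, C.ρ (u a)) * (c • F) u) =
        c • fun u => (∑ a, C.ρ (u a)) * F u := by
      funext u
      simp only [Pi.smul_apply, smul_eq_mul]
      ring
    simp only [monoInt_smul, h2]
    exact (hF.2.const_mul c).congr_deriv (by ring)

/-! ### Total differences in several variables -/

/-- The span of the products that have a total difference as one of their factors. -/
def nullSpan (μ : ℂ) (ℓ : ℕ) : Submodule ℂ ((Fin ℓ → ℝ) → ℂ) :=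
  Submodule.span ℂ {F | ∃ f : Fin ℓ → ℝ → ℂ, F = (fun u => ∏ a, f a (u a)) ∧
    (∀ a, SlowGrowth (f a)) ∧ ∃ a, ∃ j : ℕ, f a = fun u =>
      C.ρ u ^ j - exp μ * xFun ħ z n (C.ρ u) * (C.ρ u + p) ^ j}

theorem monoInt_eq_zero_of_mem_nullSpan (hp : p = 2 * ħ) (hp0 : p ≠ 0) {μ : ℂ} (hμ : μ ∈ C.decay)
    {ℓ : ℕ} {d : Fin ℓ → ℕ} (hd : ∀ a, d a < n) {F : (Fin ℓ → ℝ) → ℂ}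
    (hF : F ∈ C.nullSpan μ ℓ) : C.monoInt d F μ = 0 := by
  have hF' := hF
  unfold nullSpan at hF'
  suffices h : F ∈ slowAlg ℓ ∧ C.monoInt d F μ = 0 from h.2
  clear hF
  induction hF' using Submodule.span_induction with
  | mem F hF =>
    obtain ⟨f, rfl, hf, a, j, hj⟩ := hF
    refine ⟨prod_mem_slowAlg hf, ?_⟩
    rw [monoInt_prod]
    refine Finset.prod_eq_zero (Finset.mem_univ a) ?_
    rw [hj]
    exact C.integral_difference_eq_zero hp hp0 hμ (hd a) j
  | zero => exact ⟨zero_mem _, by simp [monoInt]⟩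
  | add F G _ _ hF hG =>
    exact ⟨add_mem hF.1 hG.1, by rw [C.monoInt_add hp hp0 hμ hd hF.1 hG.1, hF.2, hG.2, add_zero]⟩
  | smul c F _ hF =>
    exact ⟨Subalgebra.smul_mem _ hF.1 c, by rw [monoInt_smul, hF.2, mul_zero]⟩

theorem comp_perm_mem_nullSpan {μ : ℂ} {ℓ : ℕ} (σ : Equiv.Perm (Fin ℓ)) {F : (Fin ℓ → ℝ) → ℂ}
    (hF : F ∈ C.nullSpan μ ℓ) : (fun u => F fun a => u (σ a)) ∈ C.nullSpan μ ℓ := by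
  unfold nullSpan at hF
  induction hF using Submodule.span_induction with
  | mem F hF =>
    obtain ⟨f, rfl, hf, a, j, hj⟩ := hF
    refine Submodule.subset_span ⟨fun b => f (σ.symm b), ?_, fun b => hf _, σ a, j, by simpa⟩
    funext u
    rw [← Equiv.prod_comp σ]
    simp
  | zero => exact zero_mem _
  | add F G _ _ hF hG => exact add_mem hF hG
  | smul c F _ hF => exact Submodule.smul_mem _ c hF

theorem difference_mul_mem_nullSpan {μ : ℂ} {r : ℕ} (j : ℕ) {G : (Fin r → ℝ) → ℂ}
    (hG : G ∈ slowAlg r) :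
    (fun u : Fin (r + 1) → ℝ =>
      (C.ρ (u 0) ^ j - exp μ * xFun ħ z n (C.ρ (u 0)) * (C.ρ (u 0) + p) ^ j) *
        G fun b => u b.succ) ∈ C.nullSpan μ (r + 1) := by
  have hspan := mem_span_of_mem_slowAlg hG
  clear hG
  induction hspan using Submodule.span_induction with
  | mem G hG =>
    obtain ⟨f, hf, rfl⟩ := hG
    refine Submodule.subset_span ⟨Fin.cons (fun u => C.ρ u ^ j -
      exp μ * xFun ħ z n (C.ρ u) * (C.ρ u + p) ^ j) f, ?_, ?_, 0, j, rfl⟩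
    · funext u
      rw [Fin.prod_univ_succ]
      simp
    · refine Fin.cases ?_ fun b => ?_
      · exact C.slowGrowth_difference μ j
      · exact hf b
  | zero =>
    convert zero_mem (C.nullSpan μ (r + 1)) using 1
    funext u
    simp
  | add F G _ _ hF hG =>
    convert add_mem hF hG using 1
    funext u
    simp [mul_add]
  | smul c F _ hF =>
    convert Submodule.smul_mem _ c hF using 1
    funext u
    simp only [Pi.smul_apply, smul_eq_mul]
    ring

/-- The difference of `1 ⋆ f_1 ⋆ ⋯ ⋆ f_r` and `e^μ f_1 ⋆ ⋯ ⋆ f_r ⋆ X_n` is a combination of total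
differences. -/
theorem star_cons_sub_mem_nullSpan (hp : p = 2 * ħ) (μ : ℂ) {r : ℕ} {L : List (ℂ → ℂ)}
    (hLr : L.length = r) (hL : ∀ f ∈ L, SlowGrowth fun u => f (C.ρ u)) :
    (fun u : Fin (r + 1) → ℝ => star ħ (r + 1) ((fun _ => 1) :: L) (fun a => C.ρ (u a)) -
      exp μ * star ħ (r + 1) (L ++ [xFun ħ z n]) fun a => C.ρ (u a)) ∈ C.nullSpan μ (r + 1) := by
  -- in the first variable, the difference is a combination of differences of monomials
  have hexp : ∀ (x : ℂ) (s : Fin r → ℂ), ∏ b, (x - s b - ħ) =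
      ∑ S : Finset (Fin r), x ^ S.card * ∏ b ∈ Finset.univ \ S, (-s b - ħ) := by
    intro x s
    have := Finset.prod_add (fun _ => x) (fun b => -s b - ħ) Finset.univ
    rw [Finset.powerset_univ] at this
    simp only [Finset.prod_const] at this
    rw [← this]
    exact Finset.prod_congr rfl fun b _ => by ring
  have key : (fun u : Fin (r + 1) → ℝ =>
      (∏ b : Fin r, (C.ρ (u 0) - C.ρ (u b.succ) - ħ)) *
          starTerm ħ r L (fun b => C.ρ (u b.succ)) -
        exp μ * xFun ħ z n (C.ρ (u 0)) *
          ((∏ b : Fin r, (C.ρ (u 0) + 2 * ħ - C.ρ (u b.succ) - ħ)) *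
          starTerm ħ r L (fun b => C.ρ (u b.succ)))) ∈ C.nullSpan μ (r + 1) := by
    have hmem : ∀ S : Finset (Fin r), (fun u : Fin r → ℝ =>
        (∏ b ∈ Finset.univ \ S, (-C.ρ (u b) - ħ)) * starTerm ħ r L fun b => C.ρ (u b)) ∈
          slowAlg r := fun S => by
      refine slowAlg_mul (slowAlg_finsetProd _ fun b _ => slowAlg_sub ?_ (slowAlg_const ħ))
        (C.starTerm_mem_slowAlg hL id)
      exact neg_mem (coord_mem_slowAlg C.slowGrowth b)
    have h := Submodule.sum_mem (C.nullSpan μ (r + 1)) (t := Finset.univ)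
      fun (S : Finset (Fin r)) _ =>
      C.difference_mul_mem_nullSpan (μ := μ) S.card (hmem S)
    convert h using 1
    funext u
    rw [Finset.sum_apply, hexp, hexp, ← hp]
    simp only [Finset.sum_mul, Finset.mul_sum, ← Finset.sum_sub_distrib]
    exact Finset.sum_congr rfl fun S _ => by ring
  have h := Submodule.sum_mem (C.nullSpan μ (r + 1)) (t := Finset.univ)
    fun (σ : Equiv.Perm (Fin (r + 1))) _ => Submodule.smul_mem _ ((Equiv.Perm.sign σ : ℤ) : ℂ)
      (C.comp_perm_mem_nullSpan σ key)
  convert h using 1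
  funext u
  rw [star_cons_sub_star_append ħ L hLr (xFun ħ z n) (exp μ), asym, Finset.sum_apply]
  rfl

end Contour

end

/-! ### The differential equation in the domain of convergence -/

section

variable {n : ℕ} {ħ p : ℂ} {z : Fin n → ℂ} (C : Contour ħ p z)

namespace Contour

theorem ae_ex_ne_one (hp0 : p ≠ 0) (ℓ : ℕ) :
    ∀ᵐ u : Fin ℓ → ℝ, ∀ a m, ex p (C.ρ (u a) - z m) ≠ 1 := by
  have h1 : {t : ℂ | ∃ m, ex p (t - z m) = 1}.Countable := by
    refine Set.Countable.mono ?_ (Set.countable_range fun x : Fin n × ℤ => z x.1 + x.2 * p)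
    rintro t ⟨m, hm⟩
    obtain ⟨k, hk⟩ := Complex.exp_eq_one_iff.mp hm
    refine ⟨(m, k), ?_⟩
    have := Complex.two_pi_I_ne_zero
    have h2 : (t - z m) / p = k := by
      refine mul_left_cancel₀ this ?_
      rw [← mul_div_assoc, hk, mul_comm]
    rw [div_eq_iff hp0] at h2
    change z m + k * p = t
    rw [← h2]
    ring
  have h2 : ∀ᵐ x : ℝ, ∀ m, ex p (C.ρ x - z m) ≠ 1 := by
    have h3 := (h1.preimage C.simple).measure_zero volume
    filter_upwards [compl_mem_ae_iff.mpr h3] with x hx m h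
    exact hx ⟨m, h⟩
  exact eventually_all.mpr fun a =>
    (Measure.tendsto_eval_ae_ae (α := fun _ : Fin ℓ => ℝ) (μ := fun _ => volume)
      (i := a)).eventually h2

theorem phase_eq (hp : p = 2 * ħ) (hp0 : p ≠ 0) (μ : ℂ) {t : ℂ}
    (ht : ∀ m, ex p (t - z m) ≠ 1) :
    phase ħ p μ z t = exp (μ * t / p) * (∏ m, gammaKer ((t - z m) / p)) *
      ∏ m, (1 - ex p (t - z m)) := by
  rw [phase, mul_assoc, ← Finset.prod_mul_distrib]
  congr 1
  refine Finset.prod_congr rfl fun m _ => ?_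
  have h1 : ex p (t - z m) = exp (2 * Real.pi * I * ((t - z m) / p)) := by
    rw [ex, mul_div_assoc]
  have h2 := ht m
  rw [h1] at h2 ⊢
  have h3 : 1 - exp (2 * Real.pi * I * ((t - z m) / p)) ≠ 0 := sub_ne_zero.mpr h2.symm
  rw [← gammaKer_eq_of_exp_ne_one h2, div_mul_cancel₀ _ h3]
  congr 2
  have : p / 2 = ħ := by rw [hp]; ring
  rw [← this]
  field_simp

/-- The product of the periodic function and of the phase functions is a combination of products
of kernels. -/
theorem integrand_ae_eq (hp : p = 2 * ħ) (hp0 : p ≠ 0) {ℓ : ℕ} {W : (Fin ℓ → ℂ) → ℂ}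
    {P : MvPolynomial (Fin ℓ) ℂ} (hP : ∀ t : Fin ℓ → ℂ, (∀ a m, ex p (t a - z m) ≠ 1) →
      W t * ∏ m, ∏ a, (1 - ex p (t a - z m)) = MvPolynomial.eval (fun a => ex p (t a)) P)
    (w : (Fin ℓ → ℂ) → ℂ) (μ : ℂ) :
    integrand C w W μ =ᵐ[volume] fun u => ∑ d ∈ P.support, P.coeff d *
      (w (fun a => C.ρ (u a)) * ∏ a, C.kernel (d a) μ (u a)) := by
  filter_upwards [C.ae_ex_ne_one hp0 ℓ] with u hu
  have h1 := hP (fun a => C.ρ (u a)) hu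
  have h2 : ∏ a, (phase ħ p μ z (C.ρ (u a)) * deriv C.ρ (u a)) =
      (∏ a, (exp (μ * C.ρ (u a) / p) * (∏ m, gammaKer ((C.ρ (u a) - z m) / p)) *
        deriv C.ρ (u a))) * ∏ m, ∏ a, (1 - ex p (C.ρ (u a) - z m)) := by
    rw [Finset.prod_comm, ← Finset.prod_mul_distrib]
    refine Finset.prod_congr rfl fun a _ => ?_
    rw [phase_eq hp hp0 μ (hu a)]
    ring
  rw [integrand, h2, show ∀ x y A B : ℂ, x * y * (A * B) = x * A * (y * B) by intros; ring, h1,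
    MvPolynomial.eval_eq', Finset.mul_sum]
  refine Finset.sum_congr rfl fun d _ => ?_
  have h3 : ∏ a, C.kernel (d a) μ (u a) = (∏ a, (exp (μ * C.ρ (u a) / p) *
      (∏ m, gammaKer ((C.ρ (u a) - z m) / p)) * deriv C.ρ (u a))) *
        ∏ a, ex p (C.ρ (u a)) ^ d a := by
    rw [← Finset.prod_mul_distrib]
    refine Finset.prod_congr rfl fun a _ => ?_
    rw [kernel, kerG]
    ring
  rw [h3]
  ring

theorem integrable_integrand (hp : p = 2 * ħ) (hp0 : p ≠ 0) {μ : ℂ} (hμ : μ ∈ C.decay) {ℓ : ℕ}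
    {W : (Fin ℓ → ℂ) → ℂ} {P : MvPolynomial (Fin ℓ) ℂ} (hd : ∀ d ∈ P.support, ∀ a, d a < n)
    (hP : ∀ t : Fin ℓ → ℂ, (∀ a m, ex p (t a - z m) ≠ 1) →
      W t * ∏ m, ∏ a, (1 - ex p (t a - z m)) = MvPolynomial.eval (fun a => ex p (t a)) P)
    {w : (Fin ℓ → ℂ) → ℂ} (hw : (fun u : Fin ℓ → ℝ => w fun a => C.ρ (u a)) ∈ slowAlg ℓ) :
    Integrable (integrand C w W μ) := by
  refine Integrable.congr ?_ (C.integrand_ae_eq hp hp0 hP w μ).symm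
  exact integrable_finsetSum P.support fun d hd' =>
    (C.integrable_mono hp hp0 hμ (hd d hd') hw).const_mul _

/-- The function `w_N` on the contour. -/
noncomputable def wAlg (ℓ : ℕ) (N : Finset (Fin n)) : slowAlg ℓ :=
  ⟨fun u => wFun ħ z ℓ N fun a => C.ρ (u a), C.star_mem_slowAlg ℓ fun f hf => by
    obtain ⟨k, -, rfl⟩ := List.mem_map.mp hf
    exact C.slowGrowth_omegaFun k⟩

/-- The function `∑_a t_a` on the contour. -/
noncomputable def tAlg (ℓ : ℕ) : slowAlg ℓ :=
  ⟨fun u => ∑ a, C.ρ (u a), slowAlg_finsetSum _ fun a _ => coord_mem_slowAlg C.slowGrowth a⟩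

/-- The linear functional `F ↦ (1/ℓ!) ∫ F W ∏_a φ(t_a) dt_a` on functions of slow growth. -/
noncomputable def totalInt {ℓ : ℕ} (P : MvPolynomial (Fin ℓ) ℂ) (F : (Fin ℓ → ℝ) → ℂ) (μ : ℂ) : ℂ :=
  1 / (ℓ.factorial : ℂ) * ∑ d ∈ P.support, P.coeff d * C.monoInt d F μ

theorem rawInt_eq_totalInt (hp : p = 2 * ħ) (hp0 : p ≠ 0) {μ : ℂ} (hμ : μ ∈ C.decay) {ℓ : ℕ}
    {W : (Fin ℓ → ℂ) → ℂ} {P : MvPolynomial (Fin ℓ) ℂ} (hd : ∀ d ∈ P.support, ∀ a, d a < n)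
    (hP : ∀ t : Fin ℓ → ℂ, (∀ a m, ex p (t a - z m) ≠ 1) →
      W t * ∏ m, ∏ a, (1 - ex p (t a - z m)) = MvPolynomial.eval (fun a => ex p (t a)) P)
    {w : (Fin ℓ → ℂ) → ℂ} (hw : (fun u : Fin ℓ → ℝ => w fun a => C.ρ (u a)) ∈ slowAlg ℓ) :
    rawInt C w W μ = C.totalInt P (fun u => w fun a => C.ρ (u a)) μ := by
  rw [rawInt, totalInt, integral_congr_ae (C.integrand_ae_eq hp hp0 hP w μ), integral_finsetSum P.support
    fun d hd' => (C.integrable_mono hp hp0 hμ (hd d hd') hw).const_mul _]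
  simp only [integral_const_mul, monoInt]

theorem hasDerivAt_totalInt (hp : p = 2 * ħ) (hp0 : p ≠ 0) {μ : ℂ} (hμ : μ ∈ C.decay) {ℓ : ℕ}
    {P : MvPolynomial (Fin ℓ) ℂ} (hd : ∀ d ∈ P.support, ∀ a, d a < n) (F : slowAlg ℓ) :
    HasDerivAt (fun ν => C.totalInt P F ν)
      (p⁻¹ * C.totalInt P (C.tAlg ℓ * F : slowAlg ℓ) μ) μ := by
  unfold totalInt
  have h1 := (HasDerivAt.fun_sum (u := P.support) fun d hd' =>
    (C.hasDerivAt_monoInt hp hp0 hμ (hd d hd') F.2).const_mul (P.coeff d)).const_mul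
      (1 / (ℓ.factorial : ℂ))
  refine h1.congr_deriv ?_
  simp only [Finset.mul_sum]
  refine Finset.sum_congr rfl fun d _ => ?_
  have h2 : C.monoInt d (C.tAlg ℓ * F : slowAlg ℓ) μ =
      C.monoInt d (fun u => (∑ a, C.ρ (u a)) * F.1 u) μ := rfl
  rw [h2]
  ring

/-- `totalInt` as a linear functional. -/
noncomputable def totalIntLin (hp : p = 2 * ħ) (hp0 : p ≠ 0) {μ : ℂ} (hμ : μ ∈ C.decay) {ℓ : ℕ}
    {P : MvPolynomial (Fin ℓ) ℂ} (hd : ∀ d ∈ P.support, ∀ a, d a < n) : slowAlg ℓ →ₗ[ℂ] ℂ where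
  toFun F := C.totalInt P F μ
  map_add' F G := by
    rw [totalInt, totalInt, totalInt, ← mul_add, ← Finset.sum_add_distrib]
    congr 1
    refine Finset.sum_congr rfl fun d hd' => ?_
    rw [← mul_add, ← C.monoInt_add hp hp0 hμ (hd d hd') F.2 G.2]
    rfl
  map_smul' c F := by
    simp only [totalInt, RingHom.id_apply, smul_eq_mul, Finset.mul_sum]
    refine Finset.sum_congr rfl fun d _ => ?_
    have h2 : C.monoInt d (c • F : slowAlg ℓ) μ = c * C.monoInt d F μ := C.monoInt_smul d c F
    rw [h2]
    ring

theorem totalInt_eq_zero (hp : p = 2 * ħ) (hp0 : p ≠ 0) {μ : ℂ} (hμ : μ ∈ C.decay) {ℓ : ℕ}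
    {P : MvPolynomial (Fin ℓ) ℂ} (hd : ∀ d ∈ P.support, ∀ a, d a < n) {F : (Fin ℓ → ℝ) → ℂ}
    (hF : F ∈ C.nullSpan μ ℓ) : C.totalInt P F μ = 0 := by
  rw [totalInt, Finset.sum_eq_zero, mul_zero]
  intro d hd'
  rw [C.monoInt_eq_zero_of_mem_nullSpan hp hp0 hμ (hd d hd') hF, mul_zero]

theorem zFun_sub_mem_nullSpan (hp : p = 2 * ħ) (μ : ℂ) {r : ℕ} {N : Finset (Fin n)}
    (hN : N.card = r) :
    (fun u : Fin (r + 1) → ℝ => zFun ħ z (r + 1) N 0 (fun a => C.ρ (u a)) -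
      exp μ * zFun ħ z (r + 1) N n fun a => C.ρ (u a)) ∈ C.nullSpan μ (r + 1) := by
  have h := C.star_cons_sub_mem_nullSpan hp μ (L := N.sort.map (omegaFun ħ z)) (by simpa)
    fun f hf => by
      obtain ⟨k, -, rfl⟩ := List.mem_map.mp hf
      exact C.slowGrowth_omegaFun k
  have h0 : zFun ħ z (r + 1) N 0 =
      star ħ (r + 1) ((fun _ => 1) :: N.sort.map (omegaFun ħ z)) := by
    have h1 : xFun ħ z 0 = fun _ => 1 := by
      funext t
      simp [xFun]
    simp [zFun, h1]
  have h1 : zFun ħ z (r + 1) N n =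
      star ħ (r + 1) (N.sort.map (omegaFun ħ z) ++ [xFun ħ z n]) := by
    have h2 : N.filter (fun m : Fin n => n ≤ (m : ℕ)) = ∅ :=
      Finset.filter_false_of_mem fun m _ => not_le.mpr m.2
    have h3 : N.filter (fun m : Fin n => (m : ℕ) < n) = N :=
      Finset.filter_true_of_mem fun m _ => m.2
    rw [zFun, h2, h3]
    simp
  rw [h0, h1]
  exact h

/-- The relation between the integrals of the functions `w_N`: the total differences in the identity
for `(∑_a t_a) w_M` integrate to zero. -/
theorem apply_tAlg_mul_wAlg (hp : p = 2 * ħ) {μ : ℂ} {ℓ : ℕ} (T : slowAlg ℓ →ₗ[ℂ] ℂ)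
    (hT : ∀ F : slowAlg ℓ, F.1 ∈ C.nullSpan μ ℓ → T F = 0) {M : Finset (Fin n)}
    (hM : M.card = ℓ) :
    (exp μ - 1) * T (C.tAlg ℓ * C.wAlg ℓ M) =
      ∑ m ∈ M, (((exp μ - 1) * z m + ħ * exp μ) * T (C.wAlg ℓ M) +
        ħ * (exp μ * ∑ k ∈ Finset.univ.filter (fun k => k ∉ M ∧ m < k),
            T (C.wAlg ℓ (insert k (M.erase m))) +
          ∑ k ∈ Finset.univ.filter (fun k => k ∉ M ∧ k < m),
            T (C.wAlg ℓ (insert k (M.erase m))))) := by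
  have hnull : ∀ m ∈ M, (fun u : Fin ℓ → ℝ => zFun ħ z ℓ (M.erase m) 0 (fun a => C.ρ (u a)) -
      exp μ * zFun ħ z ℓ (M.erase m) n fun a => C.ρ (u a)) ∈ C.nullSpan μ ℓ := by
    intro m hm
    have hc := Finset.card_erase_add_one hm
    obtain rfl : (M.erase m).card + 1 = ℓ := hc.trans hM
    exact C.zFun_sub_mem_nullSpan hp μ rfl
  set R : slowAlg ℓ := ∑ m ∈ M, (((exp μ - 1) * z m + ħ * exp μ) • C.wAlg ℓ M +
        ħ • (exp μ • ∑ k ∈ Finset.univ.filter (fun k => k ∉ M ∧ m < k),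
            C.wAlg ℓ (insert k (M.erase m)) +
          ∑ k ∈ Finset.univ.filter (fun k => k ∉ M ∧ k < m),
            C.wAlg ℓ (insert k (M.erase m)))) with hR
  have h0 : T ((exp μ - 1) • (C.tAlg ℓ * C.wAlg ℓ M) - R) = 0 := by
    refine hT _ ?_
    have h1 := Submodule.neg_mem _ (Submodule.sum_mem _ hnull)
    convert h1 using 1
    funext u
    have h2 := sum_mul_wFun_eq ħ (exp μ) z hM (fun a => C.ρ (u a)) fun a j => C.ne_z (u a) j
    rw [Finset.sum_sub_distrib] at h2
    simp only [hR, AddSubgroupClass.coe_sub, Subalgebra.coe_smul, Subalgebra.coe_mul,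
      AddSubmonoidClass.coe_finsetSum, Subalgebra.coe_add, Pi.sub_apply, Pi.smul_apply,
      Pi.mul_apply, Finset.sum_apply, Pi.add_apply, smul_eq_mul, Pi.neg_apply, tAlg, wAlg]
    rw [h2]
    ring
  rw [map_sub, sub_eq_zero, map_smul, smul_eq_mul] at h0
  rw [h0, hR]
  simp only [map_sum, map_add, map_smul, smul_eq_mul]

end Contour

/-! ### The operator `L` in components -/

/-- The vector with component `c_M` along `v_M` for all sets `M` with `ℓ` elements. -/
noncomputable def weightVec (ℓ : ℕ) (c : Finset (Fin n) → ℂ) : TensorV n := fun ε =>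
  if (Finset.univ.filter fun m => ε m = 1).card = ℓ then c (Finset.univ.filter fun m => ε m = 1)
  else 0

theorem sum_smul_vM (ℓ : ℕ) (c : Finset (Fin n) → ℂ) :
    ∑ M : Subsets n ℓ, c M.1 • vM M = weightVec ℓ c := by
  funext ε
  have hvM : ∀ M : Subsets n ℓ, vM M ε = if M.1 = Finset.univ.filter (fun m => ε m = 1) then 1
      else 0 := by
    intro M
    rw [vM, Pi.single_apply]
    refine if_congr ⟨fun h => ?_, fun h => ?_⟩ rfl rfl
    · ext m
      simp [h]
    · funext m
      have hm : m ∈ M.1 ↔ ε m = 1 := by rw [h]; simp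
      by_cases h1 : ε m = 1
      · simp [hm, h1]
      · simp only [hm, h1, if_false]
        omega
  simp only [Finset.sum_apply, Pi.smul_apply, hvM, smul_eq_mul, mul_ite, mul_one, mul_zero,
    weightVec]
  split_ifs with h
  · rw [Finset.sum_eq_single ⟨_, h⟩]
    · simp
    · intro M _ hM
      rw [if_neg fun h' => hM (Subtype.ext h')]
    · simp
  · refine Finset.sum_eq_zero fun M _ => if_neg fun h' => h ?_
    rw [← h', M.2]

theorem weightVec_swap (ℓ : ℕ) (c : Finset (Fin n) → ℂ) {ε : Fin n → Fin 2} {k m : Fin n}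
    (hk : ε k = 1) (hm : ε m = 0) :
    weightVec ℓ c (ε ∘ Equiv.swap k m) = if (Finset.univ.filter fun i => ε i = 1).card = ℓ then
      c (insert m ((Finset.univ.filter fun i => ε i = 1).erase k)) else 0 := by
  have hkm : k ≠ m := by rintro rfl; simp [hk] at hm
  have h1 : Finset.univ.filter (fun i => (ε ∘ Equiv.swap k m) i = 1) =
      insert m ((Finset.univ.filter fun i => ε i = 1).erase k) := by
    ext i
    simp only [Finset.mem_filter, Finset.mem_univ, true_and, Finset.mem_insert, Finset.mem_erase]
    rw [Function.comp_apply, Equiv.swap_apply_def]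
    split_ifs with h2 h3
    · subst h2; simp [hm, hkm]
    · subst h3; simp [hk]
    · simp [h2, h3]
  have h2 : (insert m ((Finset.univ.filter fun i => ε i = 1).erase k)).card =
      (Finset.univ.filter fun i => ε i = 1).card := by
    rw [Finset.card_insert_of_notMem (by simp [hm])]
    exact Finset.card_erase_add_one (by simp [hk])
  rw [weightVec, h1, h2]

theorem opL_weightVec_apply {μ : ℂ} (hμ : exp μ ≠ 1) (z : Fin n → ℂ) (ℓ : ℕ)
    (c : Finset (Fin n) → ℂ) (ε : Fin n → Fin 2) {M : Finset (Fin n)}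
    (hM : M = Finset.univ.filter fun m => ε m = 1) :
    (exp μ - 1) * opL ħ μ z (weightVec ℓ c) ε = if M.card = ℓ then
      ∑ m ∈ M, (((exp μ - 1) * z m + ħ * exp μ) * c M +
        ħ * (exp μ * ∑ k ∈ Finset.univ.filter (fun k => k ∉ M ∧ m < k),
            c (insert k (M.erase m)) +
          ∑ k ∈ Finset.univ.filter (fun k => k ∉ M ∧ k < m), c (insert k (M.erase m))))
      else 0 := by
  have hq : exp μ - 1 ≠ 0 := sub_ne_zero.mpr hμ
  have hmem : ∀ m, m ∈ M ↔ ε m = 1 := fun m => by rw [hM]; simp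
  have hnot : ∀ m, m ∉ M ↔ ε m = 0 := fun m => by rw [hmem]; omega
  have h1 : ∀ k m : Fin n, k < m → (site sigmaMinus k * site sigmaPlus m) (weightVec ℓ c) ε =
      if k ∈ M ∧ m ∉ M then (if M.card = ℓ then c (insert m (M.erase k)) else 0) else 0 := by
    intro k m hkm
    rw [Module.End.mul_apply, sigmaMinus_sigmaPlus_apply hkm.ne]
    refine if_ctx_congr (by rw [hmem, hnot]) (fun h => ?_) fun _ => rfl
    rw [weightVec_swap ℓ c ((hmem _).mp h.1) ((hnot _).mp h.2), hM]
  have h2 : ∀ k m : Fin n, k < m → (site sigmaPlus k * site sigmaMinus m) (weightVec ℓ c) ε =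
      if m ∈ M ∧ k ∉ M then (if M.card = ℓ then c (insert k (M.erase m)) else 0) else 0 := by
    intro k m hkm
    rw [site_comm hkm.ne, Module.End.mul_apply,
      sigmaMinus_sigmaPlus_apply hkm.ne']
    refine if_ctx_congr (by rw [hmem, hnot]) (fun h => ?_) fun _ => rfl
    rw [weightVec_swap ℓ c ((hmem _).mp h.1) ((hnot _).mp h.2), hM]
  have h3 : opL ħ μ z (weightVec ℓ c) ε =
      ∑ m, z m * (if m ∈ M then (if M.card = ℓ then c M else 0) else 0) +
      ħ / (exp μ - 1) * (exp μ * ∑ m : Fin n, (if m ∈ M then (if M.card = ℓ then c M else 0) else 0) +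
        ∑ m : Fin n, ∑ k ∈ Finset.univ.filter (fun k => k < m),
          (exp μ * (if k ∈ M ∧ m ∉ M then (if M.card = ℓ then c (insert m (M.erase k)) else 0) else 0) +
            if m ∈ M ∧ k ∉ M then (if M.card = ℓ then c (insert k (M.erase m)) else 0) else 0)) := by
    have h4 : ∀ m, site matH m (weightVec ℓ c) ε =
        if m ∈ M then (if M.card = ℓ then c M else 0) else 0 := by
      intro m
      rw [site_matH_apply]
      refine if_congr (hmem m).symm ?_ rfl
      rw [weightVec, hM]
    rw [opL]
    simp only [LinearMap.add_apply, LinearMap.sum_apply, LinearMap.smul_apply, Pi.add_apply,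
      Finset.sum_apply, Pi.smul_apply, smul_eq_mul, h4]
    congr 3
    refine Finset.sum_congr rfl fun m _ => Finset.sum_congr rfl fun k hk => ?_
    rw [h1 k m (Finset.mem_filter.mp hk).2, h2 k m (Finset.mem_filter.mp hk).2]
  rw [h3]
  by_cases hc : M.card = ℓ
  · simp only [hc, if_true]
    have h5 : ∀ f : Fin n → ℂ, ∑ m ∈ M, f m = ∑ m, if m ∈ M then f m else 0 := fun f => by
      rw [← Finset.sum_filter]
      simp
    have e1 : ∑ m : Fin n, ∑ k ∈ Finset.univ.filter (fun k => k < m),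
        (exp μ * (if k ∈ M ∧ m ∉ M then c (insert m (M.erase k)) else 0)) =
        ∑ m ∈ M, exp μ * ∑ k ∈ Finset.univ.filter (fun k => k ∉ M ∧ m < k),
          c (insert k (M.erase m)) := by
      rw [h5]
      simp only [Finset.sum_filter, Finset.mul_sum]
      rw [Finset.sum_comm]
      refine Finset.sum_congr rfl fun m _ => ?_
      split_ifs with hm
      · refine Finset.sum_congr rfl fun k _ => ?_
        by_cases h6 : m < k <;> by_cases h7 : k ∈ M <;> simp [h6, h7, hm]
      · simp [hm]
    have e2 : ∑ m : Fin n, ∑ k ∈ Finset.univ.filter (fun k => k < m),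
        (if m ∈ M ∧ k ∉ M then c (insert k (M.erase m)) else 0) =
        ∑ m ∈ M, ∑ k ∈ Finset.univ.filter (fun k => k ∉ M ∧ k < m), c (insert k (M.erase m)) := by
      rw [h5]
      simp only [Finset.sum_filter]
      refine Finset.sum_congr rfl fun m _ => ?_
      split_ifs with hm
      · refine Finset.sum_congr rfl fun k _ => ?_
        by_cases h6 : k < m <;> by_cases h7 : k ∈ M <;> simp [h6, h7, hm]
      · simp [hm]
    have e3 : ∑ m, z m * (if m ∈ M then c M else 0) = ∑ m ∈ M, z m * c M := by
      rw [h5]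
      simp only [mul_ite, mul_zero]
    have e4 : ∑ m : Fin n, (if m ∈ M then c M else 0) = ∑ m ∈ M, c M := (h5 _).symm
    simp only [Finset.sum_add_distrib]
    rw [e1, e2, e3, e4]
    simp only [Finset.sum_add_distrib, mul_add, add_mul, ← Finset.mul_sum, mul_assoc]
    field_simp
    simp only [← Finset.mul_sum, ← Finset.sum_mul]
    ring
  · simp [hc]

end

/-! ### Linear differential equations up to the boundary -/

section

variable {E : Type*} [NormedAddCommGroup E] [NormedSpace ℂ E] {S : Set ℂ} {f : ℂ → E}
  {A : ℂ → E →L[ℂ] E}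

/-- Solutions of a linear equation with bounded coefficients on a bounded convex set are bounded, by
Gronwall's inequality on segments. -/
theorem exists_norm_le_of_linear_ode (hSc : Convex ℝ S)
    (hf : ∀ y ∈ S, HasDerivAt f (A y (f y)) y) {K D : ℝ} (hK : ∀ y ∈ S, ‖A y‖ ≤ K)
    (hD : ∀ x ∈ S, ∀ y ∈ S, ‖y - x‖ ≤ D) : ∃ B : ℝ, ∀ y ∈ S, ‖f y‖ ≤ B := by
  rcases S.eq_empty_or_nonempty with rfl | ⟨x, hx⟩
  · exact ⟨0, by simp⟩
  refine ⟨‖f x‖ * Real.exp (D * K), fun y hy => ?_⟩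
  have hmem : ∀ t ∈ Set.Icc (0 : ℝ) 1, x + t * (y - x) ∈ S := fun t ht => by
    have := hSc.add_smul_sub_mem hx hy ht
    rwa [Complex.real_smul] at this
  have hder : ∀ t ∈ Set.Icc (0 : ℝ) 1, HasDerivAt (fun t : ℝ => f (x + t * (y - x)))
      ((y - x) • A (x + t * (y - x)) (f (x + t * (y - x)))) t := by
    intro t ht
    have h1 : HasDerivAt (fun t : ℝ => x + (t : ℂ) * (y - x)) (y - x) t := by
      have := ((Complex.ofRealCLM.hasDerivAt (x := t)).mul_const (y - x)).const_add x
      exact HasDerivAt.congr_deriv (f := fun t : ℝ => x + (t : ℂ) * (y - x)) this (by simp)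
    exact (hf _ (hmem t ht)).scomp t h1
  have hD0 : 0 ≤ D := (norm_nonneg _).trans (hD x hx y hy)
  have h := norm_le_gronwallBound_of_norm_deriv_right_le (δ := ‖f x‖) (K := D * K) (ε := 0)
    (a := 0) (b := 1) (f := fun t : ℝ => f (x + t * (y - x)))
    (fun t ht => (hder t ht).continuousAt.continuousWithinAt)
    (fun t ht => (hder t ⟨ht.1, ht.2.le⟩).hasDerivWithinAt) (by simp) (fun t ht => ?_) 1 (by simp)
  · simpa [gronwallBound_ε0] using h
  · have hm := hmem t ⟨ht.1, ht.2.le⟩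
    rw [norm_smul, add_zero, mul_assoc]
    exact mul_le_mul (hD x hx y hy) ((ContinuousLinearMap.le_opNorm _ _).trans
      (mul_le_mul_of_nonneg_right (hK _ hm) (norm_nonneg _))) (norm_nonneg _) hD0

/-- Solutions of a linear equation have limits at the boundary points where its coefficients are
continuous. -/
theorem exists_tendsto_of_linear_ode [CompleteSpace E] (hSc : Convex ℝ S)
    (hf : ∀ y ∈ S, HasDerivAt f (A y (f y)) y) {x : ℂ} (hx : x ∈ closure S)
    (hA : ContinuousAt A x) : ∃ v, Tendsto f (𝓝[S] x) (𝓝 v) := by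
  obtain ⟨r, hr, hAr⟩ : ∃ r > 0, ∀ y ∈ Metric.ball x r, ‖A y‖ ≤ ‖A x‖ + 1 := by
    have h1 : ∀ᶠ y in 𝓝 x, ‖A y‖ < ‖A x‖ + 1 :=
      hA.norm.eventually_lt continuousAt_const (lt_add_one _)
    obtain ⟨r, hr, h⟩ := Metric.eventually_nhds_iff_ball.mp h1
    exact ⟨r, hr, fun y hy => (h y hy).le⟩
  have hc : Convex ℝ (S ∩ Metric.ball x r) := hSc.inter (convex_ball x r)
  obtain ⟨B, hB⟩ := exists_norm_le_of_linear_ode hc (fun y hy => hf y hy.1)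
    (fun y hy => hAr y hy.2) (D := r + r) fun a ha b hb => by
      rw [← dist_eq_norm]
      exact (dist_triangle_right b a x).trans (add_le_add hb.2.le ha.2.le)
  have hlip : LipschitzOnWith (Real.toNNReal ((‖A x‖ + 1) * B)) f (S ∩ Metric.ball x r) := by
    refine hc.lipschitzOnWith_of_nnnorm_hasDerivWithin_le
      (fun y hy => (hf y hy.1).hasDerivWithinAt) fun y hy => ?_
    rw [← NNReal.coe_le_coe, coe_nnnorm]
    refine le_trans ?_ (Real.le_coe_toNNReal _)
    refine (ContinuousLinearMap.le_opNorm _ _).trans ?_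
    exact mul_le_mul (hAr y hy.2) (hB y hy) (norm_nonneg _) (by positivity)
  have : (𝓝[S] x).NeBot := mem_closure_iff_nhdsWithin_neBot.mp hx
  have hcau : Cauchy (𝓝[S] x) := cauchy_nhds.mono nhdsWithin_le_nhds
  have hle : 𝓝[S] x ≤ 𝓟 (S ∩ Metric.ball x r) := by
    rw [le_principal_iff]
    exact inter_mem self_mem_nhdsWithin (mem_nhdsWithin_of_mem_nhds (Metric.ball_mem_nhds x hr))
  obtain ⟨v, hv⟩ := CompleteSpace.complete (hcau.map_of_le hlip.uniformContinuousOn hle)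
  exact ⟨v, hv⟩

/-- The continuous extension of a solution satisfies the equation at the boundary as well. -/
theorem hasDerivWithinAt_closure_of_linear_ode {g : ℂ → E} (hSo : IsOpen S) (hSc : Convex ℝ S)
    (hg : ∀ y ∈ S, HasDerivAt g (A y (g y)) y) {x : ℂ} (hx : x ∈ closure S)
    (hlim : ∀ᶠ y in 𝓝 x, y ∈ closure S → Tendsto g (𝓝[S] y) (𝓝 (g y)))
    (hA : ContinuousAt A x) : HasDerivWithinAt g (A x (g x)) (closure S) x := by
  obtain ⟨r, hr, hball⟩ := Metric.nhds_basis_closedBall.eventually_iff.mp hlim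
  set S' := S ∩ Metric.ball x r with hS'
  have hder : ∀ y ∈ S', HasFDerivAt g
      ((ContinuousLinearMap.toSpanSingletonCLE (A y (g y)) : ℂ →L[ℂ] E).restrictScalars ℝ) y :=
    fun y hy => (hg y hy.1).hasFDerivAt.restrictScalars ℝ
  have hnhds : 𝓝[S'] x ≤ 𝓝[S] x := nhdsWithin_mono x Set.inter_subset_left
  have hgx := hball (Metric.mem_closedBall_self hr.le) hx
  have h1 : Tendsto (fun y => A y (g y)) (𝓝[S'] x) (𝓝 (A x (g x))) :=
    ContinuousWithinAt.clm_apply hA.continuousWithinAt (hgx.mono_left hnhds)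
  have h2 : Continuous fun a : E =>
      (ContinuousLinearMap.toSpanSingletonCLE a : ℂ →L[ℂ] E).restrictScalars ℝ :=
    (ContinuousLinearMap.restrictScalarsL ℂ ℂ E ℝ ℝ).continuous.comp
      (ContinuousLinearMap.toSpanSingletonCLE (𝕜 := ℂ)).continuous
  have h := hasFDerivWithinAt_closure_of_tendsto_fderiv (f := g) (s := S') (x := x)
    (f' := (ContinuousLinearMap.toSpanSingletonCLE (A x (g x)) : ℂ →L[ℂ] E).restrictScalars ℝ)
    (fun y hy => (hder y hy).differentiableAt.differentiableWithinAt)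
    (hSc.inter (convex_ball x r)) (hSo.inter Metric.isOpen_ball)
    (fun y hy => ?_) ?_
  · have h3 : HasDerivWithinAt g (A x (g x)) (closure S') x :=
      HasFDerivWithinAt.of_restrictScalars ℝ h rfl
    refine h3.mono_of_mem_nhdsWithin ?_
    refine mem_of_superset (inter_mem self_mem_nhdsWithin
      (mem_nhdsWithin_of_mem_nhds (Metric.ball_mem_nhds x hr))) ?_
    exact Metric.isOpen_ball.closure_inter
  · have hyS : y ∈ closure S := closure_mono Set.inter_subset_left hy
    have hyb : y ∈ Metric.closedBall x r :=
      Metric.closure_ball_subset_closedBall (closure_mono Set.inter_subset_right hy)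
    exact (hball hyb hyS).mono_left (nhdsWithin_mono y Set.inter_subset_left)
  · refine Tendsto.congr' ?_ ((h2.tendsto _).comp h1)
    filter_upwards [self_mem_nhdsWithin] with y hy
    exact (hder y hy).fderiv.symm

end

/-! ### The hypergeometric solution -/

section

variable {n : ℕ} {ħ p : ℂ} {z : Fin n → ℂ} (C : Contour ħ p z)

namespace Contour

theorem convex_decay : Convex ℝ C.decay := by
  have hlin : ∀ c : ℂ, IsLinearMap ℝ fun μ : ℂ => (μ * c).re := fun c =>
    ⟨fun x y => by rw [add_mul, Complex.add_re], fun a x => by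
      rw [smul_mul_assoc, Complex.smul_re]⟩
  have h4 : Convex ℝ {μ : ℂ | 0 < ((μ - 2 * Real.pi * I) * (C.αBot / p)).re} := by
    simp only [sub_mul, Complex.sub_re, sub_pos]
    exact convex_halfSpace_gt (hlin _) _
  exact (convex_halfSpace_im_gt 0).inter ((convex_halfSpace_im_lt _).inter
    ((convex_halfSpace_lt (hlin _) 0).inter h4))

theorem exp_ne_one_of_strip {μ : ℂ} (h0 : 0 ≤ μ.im) (h1 : μ.im < 2 * Real.pi) (hμ : μ ≠ 0) :
    exp μ ≠ 1 := by
  intro h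
  obtain ⟨k, hk⟩ := Complex.exp_eq_one_iff.mp h
  have him : μ.im = k * (2 * Real.pi) := by rw [hk]; simp
  have hpi := Real.two_pi_pos
  have hk0 : k = 0 := by
    rw [him] at h0 h1
    have h2 : (k : ℝ) < 1 := by nlinarith
    have h3 : (-1 : ℝ) < k := by nlinarith
    have h2' : k < 1 := by exact_mod_cast h2
    have h3' : -1 < k := by exact_mod_cast h3
    omega
  exact hμ (by rw [hk, hk0]; simp)

theorem exp_ne_one_of_mem_decay {μ : ℂ} (hμ : μ ∈ C.decay) : exp μ ≠ 1 :=
  exp_ne_one_of_strip hμ.1.le hμ.2.1 (by rintro rfl; exact lt_irrefl _ hμ.1)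

/-- The differential equation for the convergent integrals. -/
theorem hasDerivAt_weightVec_rawInt (hp : p = 2 * ħ) (hp0 : p ≠ 0) {μ : ℂ} (hμ : μ ∈ C.decay)
    {ℓ : ℕ} {W : (Fin ℓ → ℂ) → ℂ} {P : MvPolynomial (Fin ℓ) ℂ}
    (hd : ∀ d ∈ P.support, ∀ a, d a < n)
    (hP : ∀ t : Fin ℓ → ℂ, (∀ a m, ex p (t a - z m) ≠ 1) →
      W t * ∏ m, ∏ a, (1 - ex p (t a - z m)) = MvPolynomial.eval (fun a => ex p (t a)) P) :
    HasDerivAt (fun ν => weightVec ℓ fun N => rawInt C (wFun ħ z ℓ N) W ν)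
      (p⁻¹ • opL ħ μ z (weightVec ℓ fun N => rawInt C (wFun ħ z ℓ N) W μ)) μ := by
  have hraw : ∀ N, ∀ ν ∈ C.decay, rawInt C (wFun ħ z ℓ N) W ν = C.totalInt P (C.wAlg ℓ N) ν :=
    fun N ν hν => C.rawInt_eq_totalInt hp hp0 hν hd hP (C.wAlg ℓ N).2
  have hq := C.exp_ne_one_of_mem_decay hμ
  refine hasDerivAt_pi.mpr fun ε => ?_
  have hL := opL_weightVec_apply (ħ := ħ) hq z ℓ (fun N => rawInt C (wFun ħ z ℓ N) W μ) ε rfl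
  by_cases hc : (Finset.univ.filter fun m => ε m = 1).card = ℓ
  · rw [if_pos hc] at hL
    have h1 := C.hasDerivAt_totalInt hp hp0 hμ hd (C.wAlg ℓ (Finset.univ.filter fun m => ε m = 1))
    have h2 := C.apply_tAlg_mul_wAlg hp (C.totalIntLin hp hp0 hμ hd)
      (fun F hF => C.totalInt_eq_zero hp hp0 hμ hd hF) hc
    have h3 : C.totalInt P (C.tAlg ℓ * C.wAlg ℓ (Finset.univ.filter fun m => ε m = 1) :
        slowAlg ℓ) μ = opL ħ μ z (weightVec ℓ fun N => rawInt C (wFun ħ z ℓ N) W μ) ε := by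
      refine mul_left_cancel₀ (sub_ne_zero.mpr hq) ?_
      rw [hL]
      simp only [hraw _ μ hμ]
      exact h2
    rw [Pi.smul_apply, ← h3, smul_eq_mul]
    refine h1.congr_of_eventuallyEq ?_
    filter_upwards [C.isOpen_decay.mem_nhds hμ] with ν hν
    rw [weightVec, if_pos hc, hraw _ ν hν]
  · rw [if_neg hc] at hL
    have h0 := (mul_eq_zero.mp hL).resolve_left (sub_ne_zero.mpr hq)
    rw [Pi.smul_apply, h0, smul_zero]
    simp only [weightVec, if_neg hc]
    exact hasDerivAt_const _ _

end Contour

theorem Psi_eq_weightVec {ℓ : ℕ} (W : (Fin ℓ → ℂ) → (Fin n → ℂ) → ℂ) (μ : ℂ) :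
    Psi C W μ = weightVec ℓ fun N => hypInt C (wFun ħ z ℓ N) (fun t => W t z) μ := by
  rw [← sum_smul_vM, Psi]
  simp only [wM_eq_wFun]

/-- `p⁻¹ L` as a continuous operator. -/
noncomputable def opLCont (ħ p : ℂ) (z : Fin n → ℂ) (μ : ℂ) : TensorV n →L[ℂ] TensorV n :=
  p⁻¹ • LinearMap.toContinuousLinearMap (opL ħ μ z)

theorem continuousAt_opLCont (ħ p : ℂ) (z : Fin n → ℂ) {μ : ℂ} (hμ : exp μ ≠ 1) :
    ContinuousAt (opLCont ħ p z) μ := by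
  have hq : exp μ - 1 ≠ 0 := sub_ne_zero.mpr hμ
  have h1 : ContinuousAt (fun ν : ℂ => ħ / (exp ν - 1)) μ :=
    continuousAt_const.div (by fun_prop) hq
  have h2 : ContinuousAt (fun ν : ℂ => exp ν) μ := by fun_prop
  unfold opLCont opL
  simp only [map_add, map_smul, map_sum]
  have h3 : ∀ X : TensorV n →L[ℂ] TensorV n, ContinuousAt (fun ν : ℂ => exp ν • X) μ :=
    fun X => h2.smul continuousAt_const
  have h4 : ∀ F : ℂ → TensorV n →L[ℂ] TensorV n, ContinuousAt F μ →
      ContinuousAt (fun ν : ℂ => (ħ / (exp ν - 1)) • F ν) μ := fun F hF => h1.smul hF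
  have h5 : ∀ F : ℂ → TensorV n →L[ℂ] TensorV n, ContinuousAt F μ →
      ContinuousAt (fun ν : ℂ => p⁻¹ • F ν) μ := fun F hF => hF.const_smul p⁻¹
  refine h5 _ (ContinuousAt.add continuousAt_const (h4 _ (ContinuousAt.add (h3 _) ?_)))
  exact tendsto_finsetSum _ fun m _ => tendsto_finsetSum _ fun k _ =>
    (h3 _).add continuousAt_const

theorem hasDerivWithinAt_Psi (hp : p = 2 * ħ) (hp0 : p ≠ 0) {ℓ : ℕ}
    {W : (Fin ℓ → ℂ) → (Fin n → ℂ) → ℂ} (hW : IsPeriodicFun p W) {μ : ℂ} (hμ : μ ∈ C.domain) :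
    HasDerivWithinAt (fun ν => p • Psi C W ν) (opL ħ μ z (Psi C W μ)) C.domain μ := by
  obtain ⟨P, -, hd, hP⟩ := hW.2 z
  obtain ⟨him0, him1, hμ0, hcl⟩ := hμ
  have hode := fun ν (hν : ν ∈ C.decay) =>
    C.hasDerivAt_weightVec_rawInt hp hp0 hν (W := fun t => W t z) hd hP
  set f : ℂ → TensorV n := fun ν =>
    weightVec ℓ fun N => rawInt C (wFun ħ z ℓ N) (fun t => W t z) ν with hf
  have heq : ∀ ν ∈ C.decay, Psi C W ν = f ν := fun ν hν => by
    rw [Psi_eq_weightVec]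
    simp only [hypInt, if_pos hν, hf]
  have hder : ∀ ν ∈ C.decay, HasDerivAt f (opLCont ħ p z ν (f ν)) ν := hode
  have hderPsi : ∀ ν ∈ C.decay, HasDerivAt (Psi C W) (opLCont ħ p z ν (Psi C W ν)) ν := by
    intro ν hν
    rw [heq ν hν]
    refine (hder ν hν).congr_of_eventuallyEq ?_
    filter_upwards [C.isOpen_decay.mem_nhds hν] with x hx
    exact heq x hx
  have hexp : exp μ ≠ 1 := Contour.exp_ne_one_of_strip him0 him1 hμ0
  have hlim : ∀ ν, exp ν ≠ 1 → ν ∈ closure C.decay →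
      Tendsto (Psi C W) (𝓝[C.decay] ν) (𝓝 (Psi C W ν)) := by
    intro ν hν hcl
    by_cases hmem : ν ∈ C.decay
    · exact (hderPsi ν hmem).continuousAt.tendsto.mono_left nhdsWithin_le_nhds
    have : (𝓝[C.decay] ν).NeBot := mem_closure_iff_nhdsWithin_neBot.mp hcl
    obtain ⟨v, hv⟩ := exists_tendsto_of_linear_ode C.convex_decay hder hcl
      (continuousAt_opLCont ħ p z hν)
    have hPsi : Psi C W ν = v := by
      rw [Psi_eq_weightVec]
      funext ε
      have h1 := tendsto_pi_nhds.mp hv ε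
      simp only [hf, weightVec] at h1
      rw [weightVec]
      split_ifs at h1 ⊢ with hc
      · rw [hypInt, if_neg hmem]
        exact h1.limUnder_eq
      · exact tendsto_nhds_unique tendsto_const_nhds h1
    rw [hPsi]
    refine hv.congr' ?_
    filter_upwards [self_mem_nhdsWithin] with x hx
    exact (heq x hx).symm
  have h := hasDerivWithinAt_closure_of_linear_ode C.isOpen_decay C.convex_decay hderPsi hcl
    ((Complex.continuous_exp.continuousAt.eventually_ne hexp).mono hlim)
    (continuousAt_opLCont ħ p z hexp)
  have h2 := (h.mono (fun ν hν => hν.2.2.2 : C.domain ⊆ closure C.decay)).const_smul p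
  refine HasDerivWithinAt.congr_deriv (f := fun ν => p • Psi C W ν) h2 ?_
  change p • p⁻¹ • opL ħ μ z (Psi C W μ) = _
  rw [smul_smul, mul_inv_cancel₀ hp0, one_smul]

end

end QKZ

theorem theorem6p1 (ħ p : ℂ) (hħ : ħ ≠ 0) (hp : p = 2 * ħ) (n ℓ : ℕ) :
    -- the differential equation for the hypergeometric solutions
    (∀ W : (Fin ℓ → ℂ) → (Fin n → ℂ) → ℂ, QKZ.IsPeriodicFun p W →
      ∀ z : Fin n → ℂ, QKZ.Generic ħ p z → ∀ C : QKZ.Contour ħ p z,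
        (∀ μ ∈ C.decay, ∀ M : QKZ.Subsets n ℓ,
          MeasureTheory.Integrable
            (QKZ.integrand C (QKZ.wM ħ z M) (fun t => W t z) μ)) ∧
        ∀ μ ∈ C.domain,
          HasDerivWithinAt (fun ν => p • QKZ.Psi C W ν)
            (QKZ.opL ħ μ z (QKZ.Psi C W μ)) C.domain μ) ∧
    -- compatibility with the qKZ equation:
    -- `L(z_1, …, z_m + p, …, z_n) K_m(z) = p ∂_μ K_m(z) + K_m(z) L(z)`
    (∀ z : Fin n → ℂ, QKZ.Generic ħ p z → ∀ μ : ℂ, Complex.exp μ ≠ 1 →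
      ∀ (m : Fin n) (v : QKZ.TensorV n),
        HasDerivAt (fun ν => p • QKZ.opK ħ p ν z m v)
          (QKZ.opL ħ μ (QKZ.shift p z m) (QKZ.opK ħ p μ z m v) -
            QKZ.opK ħ p μ z m (QKZ.opL ħ μ z v)) μ) := by
  have hp0 : p ≠ 0 := by
    rw [hp]
    exact mul_ne_zero two_ne_zero hħ
  refine ⟨fun W hW z _ C => ⟨fun μ hμ M => ?_, fun μ hμ => ?_⟩, fun z _ μ hμ m v => ?_⟩
  · obtain ⟨P, -, hd, hP⟩ := hW.2 z
    refine C.integrable_integrand hp hp0 hμ hd hP ?_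
    rw [QKZ.wM_eq_wFun]
    exact (C.wAlg ℓ M.1).2
  · exact QKZ.hasDerivWithinAt_Psi C hp hp0 hW hμ
  · exact QKZ.hasDerivAt_opK ħ p μ hμ z m v
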